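/- Let $R$ be a commutative ring and let $Sym$ be the Hopf algebra of symmetric functions over $R$ in the variables $X=\{x_1,x_2,\dots\}$, with coproduct $\Delta f=f(X+Y)$, where $X+Y$ is the disjoint union of two sets of variables and $f(X)g(Y)$ is identified with $f\otimes g$. Let $h_n$ be the complete homogeneous symmetric functions, and let $g(t)=\sum_{n\ge 0}g_nt^n$ be the (commutative symmetric) Lagrange series, i.e. the unique formal power series over $Sym$ with $$g(t)=\sum_{n\ge 0}h_n\,t^n g(t)^n .$$ For a finite multiset $\mu$ of natural numbers, put $g^{\mu}=\prod_i g_{\mu_i}$ (with $g_0=1$). Let ${\rm NC}_n$ be the lattice of noncrossing partitions of $\{1,\dots,n\}$, ordered by refinement ($\pi\le\pi'$ if $\pi$ is finer than $\pi'$), with minimal element ${\bf 0}_n$ (singletons) and maximal element ${\bf 1}_n$ (one block). The reduced type $\alpha(\pi)$ of $\pi\in{\rm NC}_n$ is the multiset of the nonzero numbers $|B|-1$, where $B$ runs over the blocks of $\pi$. Let $w_\pi$ be the permutation whose cycles are the blocks of $\pi$ read in increasing order; the right Kreweras complement $K(\pi)$ is the noncrossing partition with $w_{K(\pi)}=w_\pi^{-1}\gamma_n$,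 where $\gamma_n=(1\,2\,\dots\,n)$ (products of permutations are compositions of maps, the right factor being applied first). The reduced incidence Hopf algebra ${\mathcal H}_{\rm NC}$ is the free $R$-module on the isomorphism classes (as partially ordered sets) of intervals of the lattices ${\rm NC}_n$, with product given by the Cartesian product of intervals, with coproduct $\delta[\pi,\sigma]=\sum_{\pi\le\tau\le\sigma}[\pi,\tau]\otimes[\tau,\sigma]$, and with counit equal to $1$ on one-element intervals and $0$ on the others. Let $y_n$ be the class of the interval $[{\bf 0}_{n+1},{\bf 1}_{n+1}]={\rm NC}_{n+1}$. Then: 1. For all $n\ge 0$, $$\Delta g_n=\sum_{\pi\in{\rm NC}_{n+1}}g^{\alpha(\pi)}\otimes g^{\alpha(K(\pi))}.$$ 2. For all $n\ge 0$, $$\Delta g_n=\sum_{t}\ \prod_{\ell\in L(t)}g_{e(\ell)}\otimes\prod_{r\in R(t)}g_{e(r)},$$ where $t$ runs over the binary trees with $n+1$ nodes, $L(t)$ and $R(t)$ are the sets of left and of right branches of $t$ (maximal chains of left, resp. right, edges, a single node with no such edge being a branch with $0$ edges), and $e(b)$ is the number of edges of a branch $b$. 3. There is an isomorphism of Hopf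 algebras ${\mathcal H}_{\rm NC}\to Sym$ such that $y_n\mapsto g_n(X)$ for all $n\ge 0$. 4. There is an isomorphism of Hopf algebras ${\mathcal H}_{\rm NC}\to Sym$ such that $y_n\mapsto g_n(-X)=S(g_n)$ for all $n\ge 0$, where $S$ is the antipode of $Sym$. -/

import Mathlib

open scoped TensorProduct
open Finset

noncomputable section

/-! ### The ring of symmetric functions -/

/-- The ring of symmetric functions in the variables `x₀, x₁, …`: power series of bounded degree
which are invariant under all permutations of the variables. -/
def symSubalgebra (R : Type*) [CommRing R] : Subalgebra R (MvPowerSeries ℕ R) where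
  carrier := {f | (∃ d : ℕ, ∀ m : ℕ →₀ ℕ, MvPowerSeries.coeff m f ≠ 0 → m.degree ≤ d) ∧
    ∀ e : Equiv.Perm ℕ, MvPowerSeries.renameEquiv R e f = f}
  mul_mem' := by
    rintro f g ⟨⟨d, hd⟩, hf⟩ ⟨⟨d', hd'⟩, hg⟩
    refine ⟨⟨d + d', fun m hm => ?_⟩, fun e => by rw [map_mul, hf, hg]⟩
    classical
    rw [MvPowerSeries.coeff_mul] at hm
    obtain ⟨p, hp, hne⟩ := Finset.exists_ne_zero_of_sum_ne_zero hm
    have h1 := hd p.1 (left_ne_zero_of_mul hne)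
    have h2 := hd' p.2 (right_ne_zero_of_mul hne)
    rw [← Finset.HasAntidiagonal.mem_antidiagonal.mp hp, map_add]
    lia
  add_mem' := by
    rintro f g ⟨⟨d, hd⟩, hf⟩ ⟨⟨d', hd'⟩, hg⟩
    refine ⟨⟨max d d', fun m hm => ?_⟩, fun e => by rw [map_add, hf, hg]⟩
    by_contra! hlt
    apply hm
    have h1 : MvPowerSeries.coeff m f = 0 := by
      by_contra h; have := hd m h; lia
    have h2 : MvPowerSeries.coeff m g = 0 := by
      by_contra h; have := hd' m h; lia
    rw [map_add, h1, h2, add_zero]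
  algebraMap_mem' r := by
    classical
    refine ⟨⟨0, fun m hm => ?_⟩, fun e => AlgEquiv.commutes _ r⟩
    rw [MvPowerSeries.algebraMap_apply, MvPowerSeries.coeff_C] at hm
    by_cases h : m = 0
    · simp [h]
    · simp [h] at hm

/-- The algebra `Sym` of symmetric functions over `R`. -/
abbrev SymFun (R : Type*) [CommRing R] : Type _ := symSubalgebra R

namespace SymFun

variable (R : Type*) [CommRing R]

lemma exists_eq_embDomain {σ τ : Type*} (e : σ ≃ τ) (m : τ →₀ ℕ) :
    ∃ m', m = Finsupp.embDomain e.toEmbedding m' :=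
  ⟨Finsupp.equivMapDomain e.symm m, by
    ext i
    rw [← e.apply_symm_apply i]
    refine Eq.trans ?_ (Finsupp.embDomain_apply_self e.toEmbedding _ (e.symm i)).symm
    rw [Finsupp.equivMapDomain_apply, Equiv.symm_symm]⟩

lemma degree_embDomain {σ τ : Type*} (e : σ ↪ τ) (m : σ →₀ ℕ) :
    (m.embDomain e).degree = m.degree := by
  rw [Finsupp.embDomain_eq_mapDomain, Finsupp.degree_mapDomain]

/-- A power series with coefficient `1` on the monomials satisfying a condition
that is invariant under permutations of the variables. -/
lemma rename_indicator (P : (ℕ →₀ ℕ) → Prop) [DecidablePred P] (e : Equiv.Perm ℕ)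
    (hP : ∀ m, P (m.embDomain e.toEmbedding) ↔ P m) :
    MvPowerSeries.renameEquiv R e (fun m => if P m then (1 : R) else 0 : MvPowerSeries ℕ R) =
      (fun m => if P m then (1 : R) else 0 : MvPowerSeries ℕ R) := by
  ext m
  obtain ⟨m, rfl⟩ := exists_eq_embDomain e m
  refine (MvPowerSeries.coeff_embDomain_rename e.toEmbedding _ m).trans ?_
  change (if P m then (1 : R) else 0) = if P _ then (1 : R) else 0
  simp only [hP]

/-- The complete homogeneous symmetric function `h_n`: the sum of all monomials of degree `n`. -/
def h (n : ℕ) : SymFun R :=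
  ⟨fun m => if m.degree = n then 1 else 0, ⟨n, fun m hm => by
    change (if m.degree = n then (1 : R) else 0) ≠ 0 at hm
    by_contra hlt
    exact hm (if_neg (by lia))⟩,
    fun e => rename_indicator R (fun m => m.degree = n) e fun m => by rw [degree_embDomain]⟩

open Classical in
/-- The elementary symmetric function `e_n`: the sum of all squarefree monomials of degree `n`. -/
def e (n : ℕ) : SymFun R :=
  ⟨fun m => if m.degree = n ∧ ∀ i, m i ≤ 1 then 1 else 0, ⟨n, fun m hm => by
    change (if m.degree = n ∧ _ then (1 : R) else 0) ≠ 0 at hm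
    by_contra hlt
    exact hm (if_neg (by lia))⟩,
    fun e => rename_indicator R (fun m => m.degree = n ∧ ∀ i, m i ≤ 1) e fun m => by
      rw [degree_embDomain, e.surjective.forall]
      simp only [Finsupp.embDomain_eq_mapDomain, Equiv.coe_toEmbedding,
        Finsupp.mapDomain_apply e.injective]⟩

variable {R}

lemma coeff_h (n : ℕ) (m : ℕ →₀ ℕ) :
    MvPowerSeries.coeff m (h R n).1 = if m.degree = n then 1 else 0 := rfl

open Classical in
lemma coeff_e (n : ℕ) (m : ℕ →₀ ℕ) : MvPowerSeries.coeff m (e R n).1 =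
    if m.degree = n ∧ ∀ i, m i ≤ 1 then 1 else 0 := rfl

@[simp] lemma e_zero : e R 0 = 1 := by
  classical
  ext m
  rw [coeff_e, OneMemClass.coe_one, MvPowerSeries.coeff_one]
  refine if_congr ⟨fun hm => (Finsupp.degree_eq_zero_iff m).mp hm.1, ?_⟩ rfl rfl
  rintro rfl; simp

@[simp] lemma h_zero : h R 0 = 1 := by
  classical
  ext m
  rw [coeff_h, OneMemClass.coe_one, MvPowerSeries.coeff_one]
  exact if_congr (Finsupp.degree_eq_zero_iff m) rfl rfl

/-- `∑ (-1)^i e_i h_{n-i} = 0` for `n > 0`. -/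
lemma sum_e_mul_h (n : ℕ) :
    ∑ p ∈ antidiagonal n, (-1) ^ p.1 * (e R p.1 * h R p.2) = if n = 0 then 1 else 0 := by
  classical
  rcases Nat.eq_zero_or_pos n with rfl | hn
  · simp
  rw [if_neg hn.ne']
  ext m
  have key : ∀ p ∈ antidiagonal n,
      MvPowerSeries.coeff m ((((-1) ^ p.1 * (e R p.1 * h R p.2) : SymFun R)) : MvPowerSeries ℕ R) =
      ∑ q ∈ antidiagonal m, if (q.1.degree, q.2.degree) = p ∧ ∀ i, q.1 i ≤ 1
        then (-1) ^ q.1.degree else 0 := by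
    intro p _
    have : ((((-1) ^ p.1 * (e R p.1 * h R p.2) : SymFun R)) : MvPowerSeries ℕ R) =
        MvPowerSeries.C ((-1) ^ p.1) * ((e R p.1).1 * (h R p.2).1) := by simp
    rw [this, MvPowerSeries.coeff_C_mul, MvPowerSeries.coeff_mul, Finset.mul_sum]
    refine Finset.sum_congr rfl fun q _ => ?_
    rw [coeff_e, coeff_h]
    by_cases h1 : q.1.degree = p.1 <;> by_cases h2 : q.2.degree = p.2 <;>
      by_cases h3 : ∀ i, q.1 i ≤ 1 <;> simp [h1, h2, h3, Prod.ext_iff]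
  have : (((∑ p ∈ antidiagonal n, (-1) ^ p.1 * (e R p.1 * h R p.2) : SymFun R)) :
      MvPowerSeries ℕ R) = ∑ p ∈ antidiagonal n,
        ((((-1) ^ p.1 * (e R p.1 * h R p.2) : SymFun R)) : MvPowerSeries ℕ R) := by
    simp
  rw [this, map_sum, Finset.sum_congr rfl key, Finset.sum_comm]
  simp only [ite_and, Finset.sum_ite_eq]
  rw [ZeroMemClass.coe_zero, map_zero]
  by_cases hm : m.degree = n
  · have hmem : ∀ q ∈ antidiagonal m, (q.1.degree, q.2.degree) ∈ antidiagonal n := by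
      intro q hq
      rw [HasAntidiagonal.mem_antidiagonal] at hq ⊢
      rw [← hm, ← hq, map_add]
    rw [Finset.sum_congr rfl fun q hq => if_pos (hmem q hq), ← Finset.sum_filter]
    have hne : m.support.Nonempty := by
      rw [Finset.nonempty_iff_ne_empty]
      intro h0
      rw [Finsupp.support_eq_empty] at h0
      subst h0
      simp at hm
      lia
    trans ((∑ s ∈ m.support.powerset, (-1 : ℤ) ^ s.card : ℤ) : R)
    · push_cast
      symm
      refine Finset.sum_nbij' (fun s => (Finsupp.indicator s (fun _ _ => 1),
        m - Finsupp.indicator s (fun _ _ => 1))) (fun q => q.1.support) ?_ ?_ ?_ ?_ ?_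
      · intro s hs
        rw [Finset.mem_powerset] at hs
        simp only [mem_filter, HasAntidiagonal.mem_antidiagonal]
        constructor
        · ext i
          by_cases hi : i ∈ s
          · have := Finsupp.mem_support_iff.mp (hs hi)
            simp [hi]; lia
          · simp [hi]
        · intro i
          by_cases hi : i ∈ s <;> simp [hi]
      · rintro ⟨q, q'⟩ hq
        simp only [mem_filter, HasAntidiagonal.mem_antidiagonal] at hq
        rw [Finset.mem_powerset, ← hq.1]
        intro i hi
        simp at hi ⊢
        lia
      · intro s hs
        ext i
        by_cases hi : i ∈ s <;> simp [hi]
      · rintro ⟨q, q'⟩ hq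
        simp only [mem_filter, HasAntidiagonal.mem_antidiagonal] at hq
        have : Finsupp.indicator q.support (fun _ _ => 1) = q := by
          ext i
          by_cases hi : q i = 0
          · simp [hi]
          · have := hq.2 i
            simp [hi]; lia
        simp only [this, Prod.mk.injEq, true_and]
        rw [← hq.1]; simp
      · intro s hs
        simp only
        congr 1
        have hsup : (Finsupp.indicator s (fun _ _ => 1) : ℕ →₀ ℕ).support = s := by
          ext i; simp
        rw [Finsupp.degree_apply, hsup, Finset.card_eq_sum_ones]
        exact Finset.sum_congr rfl fun i hi => by simp [hi]
    · rw [Finset.sum_powerset_neg_one_pow_card_of_nonempty hne, Int.cast_zero]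
  · refine Finset.sum_eq_zero fun q hq => if_neg fun hq' => hm ?_
    rw [HasAntidiagonal.mem_antidiagonal] at hq hq'
    rw [← hq, map_add, hq']


/-! #### The fundamental theorem: `Sym` is the polynomial algebra on `e_1, e_2, …` -/

variable (R) in
/-- The evaluation `X_i ↦ e_{i+1}`. -/
def eHom : MvPolynomial ℕ R →ₐ[R] SymFun R := MvPolynomial.aeval fun i => e R (i + 1)

/-- Setting all variables but the first `N` equal to zero. -/
def res (N : ℕ) : SymFun R →ₐ[R] MvPowerSeries (Fin N) R :=
  (MvPowerSeries.killCompl Fin.valEmbedding).comp (symSubalgebra R).val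

lemma coeff_res {N : ℕ} (f : SymFun R) (m : Fin N →₀ ℕ) :
    MvPowerSeries.coeff m (res N f) =
      MvPowerSeries.coeff (m.embDomain Fin.valEmbedding) f.1 :=
  MvPowerSeries.coeff_killCompl _ _

lemma res_e (N n : ℕ) : res N (e R n) = (MvPolynomial.esymm (Fin N) R n : MvPowerSeries _ R) := by
  classical
  ext m
  rw [coeff_res, coeff_e, degree_embDomain, MvPolynomial.coeff_coe,
    MvPolynomial.esymm_eq_sum_monomial, MvPolynomial.coeff_sum]
  simp only [MvPolynomial.coeff_monomial]
  have h1 : (∀ i, (m.embDomain Fin.valEmbedding) i ≤ 1) ↔ ∀ i, m i ≤ 1 := by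
    constructor
    · intro H i
      have := H (Fin.valEmbedding i)
      rwa [Finsupp.embDomain_apply_self] at this
    · intro H i
      by_cases hi : i ∈ Set.range (Fin.valEmbedding (n := N))
      · obtain ⟨j, rfl⟩ := hi
        rw [Finsupp.embDomain_apply_self]; exact H j
      · rw [Finsupp.embDomain_of_notMem_range _ _ _ hi]; exact Nat.zero_le _
  rw [h1]
  have h2 : ∀ s : Finset (Fin N), (∑ i ∈ s, Finsupp.single i 1 : Fin N →₀ ℕ) = m ↔
      (∀ i, m i ≤ 1) ∧ s = m.support := by
    intro s
    have : ∀ j, (∑ i ∈ s, Finsupp.single i 1 : Fin N →₀ ℕ) j = if j ∈ s then 1 else 0 := by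
      intro j
      simp [Finsupp.finsetSum_apply, Finsupp.single_apply]
    constructor
    · rintro rfl
      refine ⟨fun i => by rw [this]; split_ifs <;> simp, ?_⟩
      ext i
      rw [Finsupp.mem_support_iff, this]; simp
    · rintro ⟨hm, rfl⟩
      ext j
      rw [this]
      have := hm j
      by_cases hj : m j = 0
      · simp [hj]
      · simp [hj]; lia
  simp only [h2, ite_and]
  by_cases hm : ∀ i, m i ≤ 1
  · simp only [hm, implies_true, if_true]
    rw [Finset.sum_ite_eq']
    refine if_congr ?_ rfl rfl
    rw [Finset.mem_powersetCard, Finsupp.degree_apply]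
    have : ∑ i ∈ m.support, m i = m.support.card := by
      rw [Finset.card_eq_sum_ones]
      refine Finset.sum_congr rfl fun i hi => ?_
      have := hm i
      rw [Finsupp.mem_support_iff] at hi
      lia
    simp [this]
  · simp [hm]

lemma res_eHom {N : ℕ} (q : MvPolynomial (Fin N) R) :
    res N (eHom R (MvPolynomial.rename Fin.val q)) =
      ((MvPolynomial.esymmAlgHom (Fin N) R N q).1 : MvPowerSeries (Fin N) R) := by
  have : ((res N).comp (eHom R)).comp (MvPolynomial.rename (Fin.val (n := N))) =
      ((MvPolynomial.coeToMvPowerSeries.algHom R).comp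
        (MvPolynomial.symmetricSubalgebra (Fin N) R).val).comp
        (MvPolynomial.esymmAlgHom (Fin N) R N) := by
    ext i : 1
    simp [eHom, res_e, MvPolynomial.esymmAlgHom]
  simpa using DFunLike.congr_fun this q

lemma eHom_injective : Function.Injective (eHom R) := by
  rw [injective_iff_map_eq_zero]
  intro p hp
  obtain ⟨N, hN⟩ : ∃ N, p.vars ⊆ Finset.range N :=
    ⟨p.vars.sup id + 1, fun i hi => by
      have := Finset.le_sup (f := id) hi
      simp at this ⊢; lia⟩
  obtain ⟨q, rfl⟩ := MvPolynomial.exists_rename_eq_of_vars_subset_range p (Fin.val (n := N))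
    Fin.val_injective (by
      intro i hi
      exact ⟨⟨i, by simpa using hN hi⟩, rfl⟩)
  have h1 := res_eHom q
  rw [hp, map_zero] at h1
  have h2 : MvPolynomial.esymmAlgHom (Fin N) R N q = 0 := by
    apply Subtype.ext
    apply MvPolynomial.coe_injective
    simpa using h1.symm
  rw [MvPolynomial.esymmAlgHom_injective R (by simp) (h2.trans (map_zero _).symm), map_zero]

/-- Homogeneous symmetric functions of degree `n`. -/
def IsHomog (n : ℕ) (f : SymFun R) : Prop :=
  ∀ m : ℕ →₀ ℕ, m.degree ≠ n → MvPowerSeries.coeff m f.1 = 0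

lemma IsHomog.mul {a b : ℕ} {f g : SymFun R} (hf : IsHomog a f) (hg : IsHomog b g) :
    IsHomog (a + b) (f * g) := by
  classical
  intro m hm
  rw [MulMemClass.coe_mul, MvPowerSeries.coeff_mul]
  refine Finset.sum_eq_zero fun p hp => ?_
  rw [HasAntidiagonal.mem_antidiagonal] at hp
  by_cases h1 : p.1.degree = a
  · rw [hg p.2, mul_zero]
    rintro h2
    apply hm
    rw [← hp, map_add, h1, h2]
  · rw [hf p.1 h1, zero_mul]

lemma isHomog_algebraMap (r : R) : IsHomog 0 (algebraMap R (SymFun R) r) := by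
  classical
  intro m hm
  have : (algebraMap R (SymFun R) r).1 = MvPowerSeries.C r := rfl
  rw [this, MvPowerSeries.coeff_C, if_neg]
  rintro rfl; simp at hm

lemma isHomog_e (n : ℕ) : IsHomog n (e R n) := by
  classical
  intro m hm
  rw [coeff_e, if_neg fun hh => hm hh.1]

lemma IsHomog.pow {a : ℕ} {f : SymFun R} (hf : IsHomog a f) (k : ℕ) :
    IsHomog (k * a) (f ^ k) := by
  induction k with
  | zero => simpa using isHomog_algebraMap (1 : R)
  | succ k ih => rw [pow_succ, add_mul, one_mul]; exact ih.mul hf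

lemma isHomog_eHom_monomial (s : ℕ →₀ ℕ) (r : R) :
    IsHomog (∑ i ∈ s.support, s i * (i + 1)) (eHom R (MvPolynomial.monomial s r)) := by
  rw [eHom, MvPolynomial.aeval_monomial, Finsupp.prod]
  rw [← zero_add (∑ i ∈ s.support, s i * (i + 1))]
  refine (isHomog_algebraMap r).mul ?_
  induction s.support using Finset.induction with
  | empty => simpa using isHomog_algebraMap (1 : R)
  | insert i t hi ih =>
    rw [Finset.prod_insert hi, Finset.sum_insert hi]
    exact ((isHomog_e _).pow _).mul ih

lemma coeff_perm (f : SymFun R) (σ : Equiv.Perm ℕ) (m : ℕ →₀ ℕ) :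
    MvPowerSeries.coeff (m.embDomain σ.toEmbedding) f.1 = MvPowerSeries.coeff m f.1 := by
  conv_lhs => rw [← f.2.2 σ]
  exact MvPowerSeries.coeff_embDomain_rename σ.toEmbedding _ m

/-- A symmetric function is determined in degree at most `N` by its restriction to `N`
variables. -/
lemma coeff_eq_of_res_eq {N : ℕ} {f g : SymFun R} (hfg : res N f = res N g) (m : ℕ →₀ ℕ)
    (hm : m.degree ≤ N) : MvPowerSeries.coeff m f.1 = MvPowerSeries.coeff m g.1 := by
  classical
  have hcard : m.support.card ≤ N := by
    refine le_trans ?_ hm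
    rw [Finsupp.degree_apply, Finset.card_eq_sum_ones]
    exact Finset.sum_le_sum fun i hi => Nat.one_le_iff_ne_zero.mpr (Finsupp.mem_support_iff.mp hi)
  obtain ⟨σ, hσ⟩ : ∃ σ : Equiv.Perm ℕ, ∀ i ∈ m.support, σ i < N := by
    have hc : Fintype.card m.support ≤ Fintype.card (Fin N) := by simpa using hcard
    obtain ⟨ι⟩ := Function.Embedding.nonempty_of_card_le hc
    let f0 : m.support → ℕ := fun x => (ι x : ℕ)
    have hf0 : Function.Injective f0 := Fin.val_injective.comp ι.injective
    obtain ⟨σ, hσ⟩ := Equiv.Perm.exists_extending_pair (Subtype.val : m.support → ℕ) f0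
      Subtype.val_injective hf0
    exact ⟨σ, fun i hi => by rw [hσ ⟨i, hi⟩]; exact (ι _).2⟩
  obtain ⟨m', hm'⟩ : ∃ m' : Fin N →₀ ℕ, m'.embDomain Fin.valEmbedding =
      m.embDomain σ.toEmbedding := by
    rw [← Set.mem_range, Finsupp.mem_range_embDomain_iff, Finsupp.support_embDomain]
    intro i hi
    simp only [Finset.coe_map, Set.mem_image] at hi
    obtain ⟨j, hj, rfl⟩ := hi
    exact ⟨⟨σ j, hσ j hj⟩, rfl⟩
  rw [← coeff_perm f σ, ← coeff_perm g σ, ← hm', ← coeff_res, ← coeff_res, hfg]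

lemma eHom_surjective : Function.Surjective (eHom R) := by
  classical
  intro f
  obtain ⟨d, hd⟩ := f.2.1
  -- the restriction to `d` variables is a symmetric polynomial
  have hfin : {m : Fin d →₀ ℕ | m.degree ≤ d}.Finite :=
    Finsupp.finite_of_degree_le d
  let P : MvPolynomial (Fin d) R := ∑ m ∈ hfin.toFinset,
    MvPolynomial.monomial m (MvPowerSeries.coeff m (res d f))
  have hP : (P : MvPowerSeries (Fin d) R) = res d f := by
    ext m
    simp only [P, MvPolynomial.coeff_coe, MvPolynomial.coeff_sum, MvPolynomial.coeff_monomial]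
    rw [Finset.sum_ite_eq']
    split_ifs with h1
    · rfl
    · by_contra hne
      rw [coeff_res] at hne
      have := hd _ (Ne.symm hne)
      rw [degree_embDomain] at this
      simp [this] at h1
  have hPs : P ∈ MvPolynomial.symmetricSubalgebra (Fin d) R := by
    intro τ
    apply MvPolynomial.coe_injective
    rw [← MvPowerSeries.rename_coe, hP]
    ext m
    obtain ⟨m, rfl⟩ := exists_eq_embDomain τ m
    refine (MvPowerSeries.coeff_embDomain_rename τ.toEmbedding _ m).trans ?_
    obtain ⟨σ, hσ⟩ := Equiv.Perm.exists_extending_pair (Fin.val : Fin d → ℕ) (fun i => (τ i : ℕ))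
      Fin.val_injective (Fin.val_injective.comp τ.injective)
    rw [coeff_res, coeff_res, ← coeff_perm f σ]
    simp only [Finsupp.embDomain_eq_mapDomain, ← Finsupp.mapDomain_comp]
    exact congrArg (fun φ : Fin d → ℕ => MvPowerSeries.coeff (Finsupp.mapDomain φ m) f.1) (funext hσ)
  obtain ⟨q, hq⟩ := MvPolynomial.esymmAlgHom_surjective (σ := Fin d) R (n := d) (by simp) ⟨P, hPs⟩
  have hres : res d (eHom R (MvPolynomial.rename Fin.val q)) = res d f := by
    rw [res_eHom, hq, hP]
  set Q := MvPolynomial.rename Fin.val q with hQ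
  refine ⟨∑ s ∈ Q.support with ∑ i ∈ s.support, s i * (i + 1) ≤ d,
    MvPolynomial.monomial s (Q.coeff s), ?_⟩
  ext m
  have hsum : ∀ (t : Finset (ℕ →₀ ℕ)) (F : (ℕ →₀ ℕ) → MvPolynomial ℕ R),
      MvPowerSeries.coeff m (eHom R (∑ s ∈ t, F s)).1 =
      ∑ s ∈ t, MvPowerSeries.coeff m (eHom R (F s)).1 := by
    intro t F
    rw [map_sum, ← map_sum]
    simp
  rw [hsum]
  by_cases hm : m.degree ≤ d
  · rw [← coeff_eq_of_res_eq hres m hm]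
    conv_rhs => rw [Q.as_sum, hsum]
    refine Finset.sum_subset (Finset.filter_subset _ _) fun s hs hs' => ?_
    refine isHomog_eHom_monomial s _ m fun hh => hs' ?_
    rw [Finset.mem_filter]
    exact ⟨hs, hh ▸ hm⟩
  · have h0 : MvPowerSeries.coeff m f.1 = 0 := by
      by_contra h0; exact hm (hd m h0)
    rw [h0]
    refine Finset.sum_eq_zero fun s hs => isHomog_eHom_monomial s _ m fun hh => hm ?_
    rw [hh]
    exact (Finset.mem_filter.mp hs).2

variable (R) in
/-- The fundamental theorem: `Sym` is freely generated by `e_1, e_2, …`. -/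
def eEquiv : MvPolynomial ℕ R ≃ₐ[R] SymFun R :=
  AlgEquiv.ofBijective (eHom R) ⟨eHom_injective, eHom_surjective⟩

@[simp] lemma eEquiv_X (i : ℕ) : eEquiv R (MvPolynomial.X i) = e R (i + 1) := by
  simp [eEquiv, eHom]

@[simp] lemma eEquiv_symm_e (i : ℕ) : (eEquiv R).symm (e R (i + 1)) = MvPolynomial.X i := by
  rw [← eEquiv_X, AlgEquiv.symm_apply_apply]

lemma algHom_ext {A : Type*} [Semiring A] [Algebra R A] {φ ψ : SymFun R →ₐ[R] A}
    (H : ∀ n, φ (e R n) = ψ (e R n)) : φ = ψ := by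
  have : φ.comp (eEquiv R : MvPolynomial ℕ R →ₐ[R] SymFun R) =
      ψ.comp (eEquiv R : MvPolynomial ℕ R →ₐ[R] SymFun R) := by
    ext i
    simpa using H (i + 1)
  ext f
  obtain ⟨p, rfl⟩ := (eEquiv R).surjective f
  exact DFunLike.congr_fun this p

/-! #### The Hopf algebra structure -/

variable (R) in
/-- The coproduct `f ↦ f(X + Y)`, the algebra morphism with
`Δ e_n = ∑ e_i ⊗ e_{n-i}`; see `comul_spec`. -/
def comulHom : SymFun R →ₐ[R] SymFun R ⊗[R] SymFun R :=
  (MvPolynomial.aeval fun i => ∑ p ∈ antidiagonal (i + 1), e R p.1 ⊗ₜ[R] e R p.2).comp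
    (eEquiv R).symm.toAlgHom

variable (R) in
/-- The counit: the constant term. -/
def counitHom : SymFun R →ₐ[R] R where
  toFun f := MvPowerSeries.constantCoeff f.1
  map_one' := by simp
  map_mul' := by simp
  map_zero' := by simp
  map_add' := by simp
  commutes' r := MvPowerSeries.constantCoeff_C r

variable (R) in
/-- The antipode, the algebra morphism with `e_n ↦ (-1)^n h_n`. -/
def antipodeHom : SymFun R →ₐ[R] SymFun R :=
  (MvPolynomial.aeval fun i => (-1) ^ (i + 1) * h R (i + 1)).comp (eEquiv R).symm.toAlgHom

lemma comulHom_e (n : ℕ) :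
    comulHom R (e R n) = ∑ p ∈ antidiagonal n, e R p.1 ⊗ₜ[R] e R p.2 := by
  cases n with
  | zero => simp [Algebra.TensorProduct.one_def]
  | succ n => simp [comulHom]

lemma antipodeHom_e (n : ℕ) : antipodeHom R (e R n) = (-1) ^ n * h R n := by
  cases n with
  | zero => simp
  | succ n => simp [antipodeHom]

lemma counitHom_e (n : ℕ) : counitHom R (e R n) = if n = 0 then 1 else 0 := by
  classical
  change MvPowerSeries.coeff 0 (e R n).1 = _
  rw [coeff_e]
  simp [eq_comm]

instance : Bialgebra R (SymFun R) :=
  Bialgebra.ofAlgHom (comulHom R) (counitHom R)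
    (algHom_ext fun n => by
      simp only [AlgHom.coe_comp, Function.comp_apply,
        comulHom_e, map_sum, Algebra.TensorProduct.map_tmul, AlgHom.coe_id, id_eq,
        TensorProduct.sum_tmul, TensorProduct.tmul_sum]
      rw [Finset.sum_sigma', Finset.sum_sigma']
      refine Finset.sum_nbij' (fun x => ⟨(x.2.1, x.2.2 + x.1.2), (x.2.2, x.1.2)⟩)
        (fun x => ⟨(x.1.1 + x.2.1, x.2.2), (x.1.1, x.2.1)⟩) ?_ ?_ ?_ ?_ ?_
      · rintro ⟨⟨a, b⟩, ⟨c, d⟩⟩ hx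
        simp at hx ⊢
        lia
      · rintro ⟨⟨a, b⟩, ⟨c, d⟩⟩ hx
        simp at hx ⊢
        lia
      · rintro ⟨⟨a, b⟩, ⟨c, d⟩⟩ hx
        simp at hx ⊢
        lia
      · rintro ⟨⟨a, b⟩, ⟨c, d⟩⟩ hx
        simp at hx ⊢
        lia
      · rintro ⟨⟨a, b⟩, ⟨c, d⟩⟩ hx
        rfl)
    (algHom_ext fun n => by
      rw [AlgHom.comp_apply, comulHom_e, map_sum, Finset.sum_eq_single (0, n)]
      · simp
      · rintro ⟨a, b⟩ hp hne
        have : a ≠ 0 := by rintro rfl; simp at hp; simp [hp] at hne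
        simp [counitHom_e, this]
      · simp)
    (algHom_ext fun n => by
      rw [AlgHom.comp_apply, comulHom_e, map_sum, Finset.sum_eq_single (n, 0)]
      · simp
      · rintro ⟨a, b⟩ hp hne
        have : b ≠ 0 := by rintro rfl; simp at hp; simp [hp] at hne
        simp [counitHom_e, this]
      · simp)

lemma comul_e (n : ℕ) : Coalgebra.comul (R := R) (e R n) =
    ∑ p ∈ antidiagonal n, e R p.1 ⊗ₜ[R] e R p.2 := comulHom_e n

lemma counit_e (n : ℕ) : Coalgebra.counit (R := R) (e R n) = if n = 0 then 1 else 0 :=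
  counitHom_e n

lemma sum_antipodeHom_mul (n : ℕ) :
    ∑ p ∈ antidiagonal n, e R p.1 * ((-1) ^ p.2 * h R p.2) = if n = 0 then 1 else 0 := by
  have h1 := congrArg ((-1 : SymFun R) ^ n * ·) (sum_e_mul_h (R := R) n)
  simp only [Finset.mul_sum] at h1
  trans (-1 : SymFun R) ^ n * if n = 0 then 1 else 0
  · rw [← h1]
    refine Finset.sum_congr rfl fun p hp => ?_
    rw [HasAntidiagonal.mem_antidiagonal] at hp
    rw [← hp, pow_add]
    have : ((-1 : SymFun R) ^ p.1) * (-1) ^ p.1 = 1 := by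
      rcases neg_one_pow_eq_or (SymFun R) p.1 with h | h <;> rw [h] <;> ring
    linear_combination (-(-1) ^ p.2 * e R p.1 * h R p.2) * this
  · by_cases hn : n = 0 <;> simp [hn]

instance : HopfAlgebra R (SymFun R) :=
  HopfAlgebra.ofAlgHom (antipodeHom R)
    (algHom_ext fun n => by
      rw [AlgHom.comp_apply, Bialgebra.comulAlgHom_apply, comul_e, map_sum, AlgHom.comp_apply,
        Bialgebra.counitAlgHom_apply, counit_e]
      trans ∑ p ∈ antidiagonal n, antipodeHom R (e R p.1) * e R p.2
      · exact Finset.sum_congr rfl fun p _ => Algebra.TensorProduct.lift_tmul _ _ _ _ _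
      rw [← Finset.Nat.sum_antidiagonal_swap]
      have := sum_antipodeHom_mul (R := R) n
      simp only [Prod.fst_swap, Prod.snd_swap, antipodeHom_e]
      simp only [mul_comm (_ * h R _)]
      rw [this]
      split_ifs <;> simp)
    (algHom_ext fun n => by
      rw [AlgHom.comp_apply, Bialgebra.comulAlgHom_apply, comul_e, map_sum, AlgHom.comp_apply,
        Bialgebra.counitAlgHom_apply, counit_e]
      trans ∑ p ∈ antidiagonal n, e R p.1 * antipodeHom R (e R p.2)
      · exact Finset.sum_congr rfl fun p _ => Algebra.TensorProduct.lift_tmul _ _ _ _ _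
      simp only [antipodeHom_e]
      rw [sum_antipodeHom_mul]
      split_ifs <;> simp)

lemma antipode_e (n : ℕ) :
    HopfAlgebra.antipode R (e R n) = (-1) ^ n * h R n := antipodeHom_e n

variable (R) in
/-- `f ⊗ g ↦ f(X) g(Y)`, where `X` and `Y` are the variables `Sum.inl i` and `Sum.inr i`. -/
def tensorEval : SymFun R ⊗[R] SymFun R →ₐ[R] MvPowerSeries (ℕ ⊕ ℕ) R :=
  Algebra.TensorProduct.productMap
    ((MvPowerSeries.rename (Function.Embedding.inl : ℕ ↪ ℕ ⊕ ℕ)).comp (symSubalgebra R).val)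
    ((MvPowerSeries.rename (Function.Embedding.inr : ℕ ↪ ℕ ⊕ ℕ)).comp (symSubalgebra R).val)

lemma add_embDomain_inl (a b : ℕ →₀ ℕ) (i : ℕ) :
    (a.embDomain Function.Embedding.inl + b.embDomain Function.Embedding.inr : ℕ ⊕ ℕ →₀ ℕ)
      (Sum.inl i) = a i := by
  rw [Finsupp.add_apply, Finsupp.embDomain_of_notMem_range _ b _ (by simp), add_zero]
  exact Finsupp.embDomain_apply_self Function.Embedding.inl a i

lemma add_embDomain_inr (a b : ℕ →₀ ℕ) (i : ℕ) :
    (a.embDomain Function.Embedding.inl + b.embDomain Function.Embedding.inr : ℕ ⊕ ℕ →₀ ℕ)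
      (Sum.inr i) = b i := by
  rw [Finsupp.add_apply, Finsupp.embDomain_of_notMem_range _ a _ (by simp), zero_add]
  exact Finsupp.embDomain_apply_self Function.Embedding.inr b i

lemma coeff_tensorEval_tmul (f g : SymFun R) (a b : ℕ →₀ ℕ) :
    MvPowerSeries.coeff (a.embDomain Function.Embedding.inl + b.embDomain Function.Embedding.inr)
      (tensorEval R (f ⊗ₜ g)) = MvPowerSeries.coeff a f.1 * MvPowerSeries.coeff b g.1 := by
  classical
  have : tensorEval R (f ⊗ₜ g) = MvPowerSeries.rename (Function.Embedding.inl : ℕ ↪ ℕ ⊕ ℕ) f.1 *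
      MvPowerSeries.rename (Function.Embedding.inr : ℕ ↪ ℕ ⊕ ℕ) g.1 := by
    simp [tensorEval]
  rw [this, MvPowerSeries.coeff_mul,
    Finset.sum_eq_single (a.embDomain Function.Embedding.inl, b.embDomain Function.Embedding.inr)]
  · rw [MvPowerSeries.coeff_embDomain_rename, MvPowerSeries.coeff_embDomain_rename]
  · rintro ⟨p, q⟩ hpq hne
    rw [HasAntidiagonal.mem_antidiagonal] at hpq
    by_cases hp : p ∈ Set.range (Finsupp.mapDomain (Function.Embedding.inl : ℕ ↪ ℕ ⊕ ℕ))
    · by_cases hq : q ∈ Set.range (Finsupp.mapDomain (Function.Embedding.inr : ℕ ↪ ℕ ⊕ ℕ))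
      · exfalso
        obtain ⟨p, rfl⟩ := hp
        obtain ⟨q, rfl⟩ := hq
        apply hne
        rw [← Finsupp.embDomain_eq_mapDomain, ← Finsupp.embDomain_eq_mapDomain] at hpq ⊢
        have hl : ∀ i, p i = a i := fun i => by
          rw [← add_embDomain_inl p q i, hpq, add_embDomain_inl]
        have hr : ∀ i, q i = b i := fun i => by
          rw [← add_embDomain_inr p q i, hpq, add_embDomain_inr]
        rw [Finsupp.ext hl, Finsupp.ext hr]
      · rw [MvPowerSeries.coeff_rename_eq_zero _ _ hq, mul_zero]
    · rw [MvPowerSeries.coeff_rename_eq_zero _ _ hp, zero_mul]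
  · intro hh
    refine absurd ?_ hh
    rw [HasAntidiagonal.mem_antidiagonal]

/-- The coproduct is `f ↦ f(X + Y)`: the symmetric function `f` in the union of the two sets
of variables `X` and `Y`. -/
lemma comul_spec (f : SymFun R) : tensorEval R (Coalgebra.comul (R := R) f) =
    MvPowerSeries.renameEquiv R Equiv.natSumNatEquivNat.symm f.1 := by
  classical
  have : (tensorEval R).comp (comulHom R) =
      (MvPowerSeries.renameEquiv R Equiv.natSumNatEquivNat.symm).toAlgHom.comp
        (symSubalgebra R).val := by
    refine algHom_ext fun n => ?_
    rw [AlgHom.comp_apply, comulHom_e, map_sum]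
    ext m
    obtain ⟨a, b, rfl⟩ : ∃ a b : ℕ →₀ ℕ, m =
        a.embDomain Function.Embedding.inl + b.embDomain Function.Embedding.inr := by
      refine ⟨m.comapDomain Sum.inl Sum.inl_injective.injOn,
        m.comapDomain Sum.inr Sum.inr_injective.injOn, ?_⟩
      ext (i | i)
      · rw [add_embDomain_inl]; rfl
      · rw [add_embDomain_inr]; rfl
    have hR : MvPowerSeries.coeff
        (a.embDomain Function.Embedding.inl + b.embDomain Function.Embedding.inr)
        (MvPowerSeries.renameEquiv R Equiv.natSumNatEquivNat.symm (e R n).1) =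
        if a.degree + b.degree = n ∧ (∀ i, a i ≤ 1) ∧ ∀ i, b i ≤ 1 then 1 else 0 := by
      generalize Equiv.natSumNatEquivNat.symm = E
      obtain ⟨m, hm⟩ := exists_eq_embDomain E
        (a.embDomain Function.Embedding.inl + b.embDomain Function.Embedding.inr)
      have h1 : m.degree = a.degree + b.degree := by
        rw [← degree_embDomain E.toEmbedding m, ← hm, map_add,
          degree_embDomain, degree_embDomain]
      have h2 : (∀ i, m i ≤ 1) ↔ (∀ i, a i ≤ 1) ∧ ∀ i, b i ≤ 1 := by
        have h3 : ∀ i, m i = (a.embDomain Function.Embedding.inl +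
          b.embDomain Function.Embedding.inr : ℕ ⊕ ℕ →₀ ℕ) (E i) := by
          intro i
          rw [hm]
          exact (Finsupp.embDomain_apply_self E.toEmbedding m i).symm
        simp only [h3]
        rw [← E.surjective.forall
          (p := fun y => (a.embDomain Function.Embedding.inl +
            b.embDomain Function.Embedding.inr : ℕ ⊕ ℕ →₀ ℕ) y ≤ 1), Sum.forall]
        simp only [add_embDomain_inl, add_embDomain_inr]
      rw [hm]
      refine (MvPowerSeries.coeff_embDomain_rename E.toEmbedding _ m).trans ?_
      rw [coeff_e]
      exact if_congr (by rw [h1, h2]) rfl rfl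
    refine Eq.trans ?_ hR.symm
    rw [map_sum]
    simp only [coeff_tensorEval_tmul, coeff_e]
    by_cases hd : a.degree + b.degree = n
    · rw [Finset.sum_eq_single (a.degree, b.degree)]
      · by_cases h1 : ∀ i, a i ≤ 1 <;> by_cases h2 : ∀ i, b i ≤ 1 <;> simp [h1, h2, hd]
      · rintro ⟨i, j⟩ - hne
        rw [ne_eq, Prod.mk.injEq, not_and_or] at hne
        rcases hne with hne | hne
        · rw [if_neg fun hh => hne hh.1.symm, zero_mul]
        · rw [mul_comm, if_neg fun hh => hne hh.1.symm, zero_mul]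
      · intro hh
        exact absurd (HasAntidiagonal.mem_antidiagonal.mpr hd) hh
    · rw [if_neg fun hh => hd hh.1]
      refine Finset.sum_eq_zero fun p hp => ?_
      rw [HasAntidiagonal.mem_antidiagonal] at hp
      by_cases h1 : a.degree = p.1
      · rw [mul_comm, if_neg, zero_mul]
        rintro ⟨hh, -⟩
        exact hd (by rw [h1, hh, hp])
      · rw [if_neg fun hh => h1 hh.1, zero_mul]
  exact DFunLike.congr_fun this f

end SymFun

/-! ### The Lagrange series -/

/-- The coefficients `g_n` of the Lagrange series `g(t) = ∑ g_n t^n`, the unique solution of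
`g(t) = ∑_{k ≥ 0} h_k t^k g(t)^k`; see `lagrange_eq`. -/
def lagrange (R : Type*) [CommRing R] : ℕ → SymFun R
  | 0 => 1
  | n + 1 => ∑ k ∈ range (n + 1), SymFun.h R (k + 1) *
      PowerSeries.coeff (n - k)
        (PowerSeries.mk (fun m => if _ : m < n + 1 then lagrange R m else 0) ^ (k + 1))

/-- The functional equation of the Lagrange series: the coefficient of `t^n` in
`∑_{k ≥ 0} h_k t^k g(t)^k` is `g_n`. -/
lemma lagrange_eq (R : Type*) [CommRing R] (n : ℕ) :
    lagrange R n = ∑ k ∈ range (n + 1), SymFun.h R k *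
      PowerSeries.coeff (n - k) (PowerSeries.mk (lagrange R) ^ k) := by
  cases n with
  | zero => rw [lagrange]; simp
  | succ n =>
    rw [lagrange, Finset.sum_range_succ' _ (n + 1)]
    have h0 : SymFun.h R 0 * PowerSeries.coeff (n + 1 - 0) (PowerSeries.mk (lagrange R) ^ 0) = 0 := by
      rw [pow_zero, Nat.sub_zero, PowerSeries.coeff_one, if_neg (Nat.succ_ne_zero n), mul_zero]
    rw [h0, add_zero]
    refine Finset.sum_congr rfl fun k hk => ?_
    rw [Nat.add_sub_add_right]
    congr 1
    rw [Finset.mem_range] at hk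
    have h1 : (PowerSeries.X : PowerSeries (SymFun R)) ^ (n + 1) ∣
        PowerSeries.mk (fun m => if _ : m < n + 1 then lagrange R m else 0) -
          PowerSeries.mk (lagrange R) := by
      rw [PowerSeries.X_pow_dvd_iff]
      intro m hm
      rw [map_sub, PowerSeries.coeff_mk, PowerSeries.coeff_mk, dif_pos hm, sub_self]
    have h2 := h1.trans (sub_dvd_pow_sub_pow _ _ (k + 1))
    rw [PowerSeries.X_pow_dvd_iff] at h2
    have h3 := h2 (n - k) (Nat.lt_succ_of_le (Nat.sub_le n k))
    rwa [map_sub, sub_eq_zero] at h3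

/-- `g^μ = ∏ g_{μ_i}`. -/
def lagrangeProd (R : Type*) [CommRing R] (μ : Multiset ℕ) : SymFun R := (μ.map (lagrange R)).prod

/-! ### Noncrossing partitions -/

/-- A partition of `Fin n` (an equivalence relation) is noncrossing if there are no
`a < b < c < d` with `a, c` in one block and `b, d` in another. -/
def IsNoncrossing {n : ℕ} (s : Setoid (Fin n)) : Prop :=
  ∀ a b c d : Fin n, a < b → b < c → c < d → s a c → s b d → s a b

/-- The lattice `NC_n` of noncrossing partitions, ordered by refinement:
`π ≤ σ` if `π` is finer than `σ`. -/
abbrev NC (n : ℕ) : Type := {s : Setoid (Fin n) // IsNoncrossing s}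

namespace NC

variable {n : ℕ}

instance : Finite (Setoid (Fin n)) :=
  Finite.of_injective (fun s : Setoid (Fin n) => (fun a b => s a b : Fin n → Fin n → Prop))
    fun _ _ hst => Setoid.ext fun a b => iff_of_eq (congrFun (congrFun hst a) b)

instance : Fintype (NC n) := Fintype.ofFinite _

/-- The partition into singletons. -/
instance : OrderBot (NC n) where
  bot := ⟨⊥, fun _ _ _ _ hab hbc _ hac _ => absurd hac (hab.trans hbc).ne⟩
  bot_le π := bot_le (a := π.1)

/-- The partition with one block. -/
instance : OrderTop (NC n) where
  top := ⟨⊤, fun _ _ _ _ _ _ _ _ _ => trivial⟩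
  le_top π := le_top (a := π.1)

open Classical in
/-- The block of a partition containing `x`. -/
def block (s : Setoid (Fin n)) (x : Fin n) : Finset (Fin n) := univ.filter fun y => s x y

lemma mem_block {s : Setoid (Fin n)} {x y : Fin n} : y ∈ block s x ↔ s x y := by
  simp [block]

lemma block_nonempty (s : Setoid (Fin n)) (x : Fin n) : (block s x).Nonempty :=
  ⟨x, mem_block.mpr (s.refl x)⟩

/-- The set of blocks of a partition. -/
def blocks (s : Setoid (Fin n)) : Finset (Finset (Fin n)) := univ.image (block s)

/-- The reduced type `α(π)`: the multiset of the block sizes minus one, without the zeros. -/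
def reducedType (π : NC n) : Multiset ℕ :=
  ((blocks π.1).val.map fun B => B.card - 1).filter (· ≠ 0)

/-- The successor of `x` in its block, read cyclically in increasing order. -/
def next (s : Setoid (Fin n)) (x : Fin n) : Fin n :=
  if hx : ((block s x).filter (x < ·)).Nonempty then ((block s x).filter (x < ·)).min' hx
  else (block s x).min' (block_nonempty s x)

lemma rel_next (s : Setoid (Fin n)) (x : Fin n) : s x (next s x) := by
  unfold next
  split_ifs with hx
  · exact mem_block.mp (Finset.mem_filter.mp (Finset.min'_mem _ hx)).1
  · exact mem_block.mp (Finset.min'_mem _ (block_nonempty s x))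

lemma block_eq {s : Setoid (Fin n)} {x y : Fin n} (hxy : s x y) : block s x = block s y := by
  ext z
  rw [mem_block, mem_block]
  exact ⟨fun hz => s.trans (s.symm hxy) hz, fun hz => s.trans hxy hz⟩

/-- Either `next` goes to the next larger element of the block, or it goes from the maximum of
the block to its minimum. -/
lemma next_cases (s : Setoid (Fin n)) (x : Fin n) :
    (x < next s x ∧ ∀ z, s x z → x < z → next s x ≤ z) ∨
    ((∀ z, s x z → z ≤ x) ∧ ∀ z, s x z → next s x ≤ z) := by
  unfold next
  split_ifs with hx
  · refine Or.inl ⟨(Finset.mem_filter.mp (Finset.min'_mem _ hx)).2, fun z hz hlt => ?_⟩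
    exact Finset.min'_le _ _ (Finset.mem_filter.mpr ⟨mem_block.mpr hz, hlt⟩)
  · refine Or.inr ⟨fun z hz => ?_, fun z hz => Finset.min'_le _ _ (mem_block.mpr hz)⟩
    by_contra hlt
    exact hx ⟨z, Finset.mem_filter.mpr ⟨mem_block.mpr hz, not_le.mp hlt⟩⟩

lemma next_injective (s : Setoid (Fin n)) : Function.Injective (next s) := by
  intro x y hxy
  have hx := rel_next s x
  have hy := rel_next s y
  have hs : s x y := s.trans hx (hxy ▸ s.symm hy)
  rcases next_cases s x with ⟨h1, h2⟩ | ⟨h1, h2⟩ <;> rcases next_cases s y with ⟨h3, h4⟩ | ⟨h3, h4⟩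
  · rcases lt_trichotomy x y with hlt | heq | hlt
    · exact absurd (hxy ▸ h2 y hs hlt) (not_le.mpr h3)
    · exact heq
    · exact absurd (hxy ▸ h4 x (s.symm hs) hlt) (not_le.mpr h1)
  · exact absurd (hxy ▸ h4 x (s.symm hs)) (not_le.mpr h1)
  · exact absurd (hxy ▸ h2 y hs) (not_le.mpr h3)
  · exact le_antisymm (h3 x (s.symm hs)) (h1 y hs)

/-- The permutation `w_π` whose cycles are the blocks of `π`, read in increasing order. -/
def toPerm (s : Setoid (Fin n)) : Equiv.Perm (Fin n) :=
  Equiv.ofBijective (next s) (Finite.injective_iff_bijective.mp (next_injective s))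

@[simp] lemma toPerm_apply (s : Setoid (Fin n)) (x : Fin n) : toPerm s x = next s x := rfl

/-- The partition whose blocks are the cycles of `w_π⁻¹ γ_n`, where `γ_n = (1 2 … n)`. -/
def krewerasSetoid (s : Setoid (Fin n)) : Setoid (Fin n) :=
  Equiv.Perm.SameCycle.setoid ((toPerm s)⁻¹ * finRotate n)

/-- No block of `s` meets both the interval between `i` (excluded) and `j` (included) and the
complement of this interval. -/
def KRel (s : Setoid (Fin n)) (i j : Fin n) : Prop :=
  ∀ x y, s x y → ((x ≤ i ↔ x ≤ j) ↔ (y ≤ i ↔ y ≤ j))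

lemma krel_of {s : Setoid (Fin n)} {i j : Fin n}
    (H : ∀ x y, s x y → ¬ (x ≤ i ↔ x ≤ j) → ¬ (y ≤ i ↔ y ≤ j)) : KRel s i j := by
  intro x y hxy
  have h1 := H x y hxy
  have h2 := H y x (s.symm hxy)
  tauto

lemma KRel.symm {s : Setoid (Fin n)} {i j : Fin n} (hij : KRel s i j) : KRel s j i := by
  intro x y hxy
  have := hij x y hxy
  tauto

lemma KRel.trans {s : Setoid (Fin n)} {i j k : Fin n} (hij : KRel s i j) (hjk : KRel s j k) :
    KRel s i k := by
  intro x y hxy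
  have h1 := hij x y hxy
  have h2 := hjk x y hxy
  tauto

/-- The three possible positions of `j = w_π⁻¹ (γ i)`. -/
lemma image_cases (s : Setoid (Fin n)) (i : Fin n) (j : Fin n)
    (hj : next s j = finRotate n i) :
    ((∀ x, x ≤ i) ∧ (∃ z, s z j ∧ ∀ x, z ≤ x) ∧ ∀ z, s j z → z ≤ j) ∨
    ∃ k : Fin n, k.1 = i.1 + 1 ∧ s j k ∧
      ((j ≤ i ∧ ∀ z, s j z → j < z → k ≤ z) ∨ (k ≤ j ∧ ∀ z, s j z → z ≤ j ∧ k ≤ z)) := by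
  obtain _ | n := n
  · exact i.elim0
  have hs := rel_next s j
  have hc := next_cases s j
  rw [hj] at hs hc
  by_cases hi : i = Fin.last n
  · left
    subst hi
    rw [finRotate_last] at hs hc
    refine ⟨Fin.le_last, ⟨0, s.symm hs, fun x => Fin.zero_le x⟩, ?_⟩
    rcases hc with ⟨h1, -⟩ | ⟨h1, -⟩
    · exact absurd h1 (not_lt.mpr (Fin.zero_le j))
    · exact h1
  · right
    have hv : (finRotate (n + 1) i).1 = i.1 + 1 := coe_finRotate_of_ne_last hi
    refine ⟨finRotate (n + 1) i, hv, hs, ?_⟩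
    rcases hc with ⟨h1, h2⟩ | ⟨h1, h2⟩
    · exact Or.inl ⟨by rw [Fin.lt_def, hv] at h1; rw [Fin.le_def]; lia, h2⟩
    · exact Or.inr ⟨h1 _ hs, fun z hz => ⟨h1 z hz, h2 z hz⟩⟩

lemma krel_image {s : Setoid (Fin n)} (hs : IsNoncrossing s) {i j : Fin n}
    (hj : next s j = finRotate n i) : KRel s i j := by
  refine krel_of fun x y hxy hx => ?_
  rcases image_cases s i j hj with ⟨hi, ⟨z, hz, hz'⟩, hmax⟩ | ⟨k, hk, hjk, ⟨h1, h2⟩ | ⟨h1, h2⟩⟩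
  · -- `i` is the last element, and `j` is the maximum of the block of the first element
    rw [not_iff] at hx ⊢
    have hxj : ¬ x ≤ j := by simpa [hi x] using hx
    have : ¬ y ≤ j := by
      intro hyj
      have hxj' := not_le.mp hxj
      have key : s z x := by
        rcases (hz' y).eq_or_lt with rfl | hzy
        · exact s.symm hxy
        · rcases hyj.eq_or_lt with rfl | hyj
          · exact s.trans hz (s.symm hxy)
          · exact s.trans (hs z y j x hzy hyj hxj' hz (s.symm hxy)) (s.symm hxy)
      exact hxj (hmax x (s.trans (s.symm hz) key))
    simp [hi y, this]
  · -- `j < k = i + 1` are consecutive in their block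
    have hx' : j < x ∧ x < k := by
      simp only [Fin.le_def, Fin.lt_def] at *; lia
    have hnj : ¬ s j x := fun hh => absurd (h2 x hh hx'.1) (not_le.mpr hx'.2)
    have hy : j < y ∧ y < k := by
      constructor
      · by_contra hy
        rcases (not_lt.mp hy).eq_or_lt with rfl | hy
        · exact hnj (s.symm hxy)
        · have h3 := hs y j x k hy hx'.1 hx'.2 (s.symm hxy) hjk
          exact hnj (s.trans (s.symm h3) (s.symm hxy))
      · by_contra hy
        rcases (not_lt.mp hy).eq_or_lt with rfl | hy
        · exact hnj (s.trans hjk (s.symm hxy))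
        · exact hnj (hs j x k y hx'.1 hx'.2 hy hjk hxy)
    simp only [Fin.le_def, Fin.lt_def] at *; lia
  · -- `k = i + 1` and `j` are the minimum and the maximum of a block
    have hx' : k ≤ x ∧ x ≤ j := by
      simp only [Fin.le_def] at *; lia
    have hy : k ≤ y ∧ y ≤ j := by
      by_contra hy
      have hnj : ¬ s j y := fun hh => hy ⟨(h2 y hh).2, (h2 y hh).1⟩
      have hnx : ¬ s j x := fun hh => hnj (s.trans hh hxy)
      have hkx : k < x := lt_of_le_of_ne hx'.1 (by rintro rfl; exact hnx hjk)
      have hxj : x < j := lt_of_le_of_ne hx'.2 (by rintro rfl; exact hnx (s.refl _))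
      rcases lt_or_ge y k with h3 | h3
      · exact hnj (s.trans hjk (s.symm (hs y k x j h3 hkx hxj (s.symm hxy) (s.symm hjk))))
      · have h4 : j < y := lt_of_not_ge fun h4 => hy ⟨h3, h4⟩
        exact hnx (s.trans hjk (hs k x j y hkx hxj h4 (s.symm hjk) hxy))
    simp only [Fin.le_def] at *; lia

lemma next_inv_mul (s : Setoid (Fin n)) (i : Fin n) :
    next s (((toPerm s)⁻¹ * finRotate n) i) = finRotate n i :=
  (toPerm s).apply_symm_apply _

lemma krewerasSetoid_iff {s : Setoid (Fin n)} (hs : IsNoncrossing s) (i j : Fin n) :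
    krewerasSetoid s i j ↔ KRel s i j := by
  constructor
  · intro hij
    obtain ⟨m, -, hm⟩ := Equiv.Perm.SameCycle.exists_pow_eq'
      (f := (toPerm s)⁻¹ * finRotate n) hij
    subst hm
    clear hij
    induction m with
    | zero => exact fun x y _ => by simp
    | succ m ih =>
      refine ih.trans ?_
      rw [pow_succ', Equiv.Perm.mul_apply]
      exact krel_image hs (next_inv_mul s _)
  · have key : ∀ (d : ℕ) (i j : Fin n), j.1 = i.1 + d → KRel s i j → krewerasSetoid s i j := by
      intro d
      induction d using Nat.strong_induction_on with
      | _ d ih =>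
        intro i j hd hij
        rcases Nat.eq_zero_or_pos d with rfl | hpos
        · rw [Fin.ext (hd.trans (add_zero _))]
        set j' := ((toPerm s)⁻¹ * finRotate n) i with hj'
        have hstep : krewerasSetoid s i j' := ⟨1, by rw [zpow_one]⟩
        have hrel := krel_image hs (next_inv_mul s i)
        have hgt : i < j' ∧ j' ≤ j := by
          rcases image_cases s i j' (next_inv_mul s i) with ⟨hi, -⟩ | ⟨k, hk, hjk, -⟩
          · have := hi j
            rw [Fin.le_def] at this
            lia
          · have := hij j' k hjk
            simp only [Fin.le_def, Fin.lt_def] at *; lia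
        have hlt := hgt.1
        rw [Fin.lt_def] at hlt
        have hle := hgt.2
        rw [Fin.le_def] at hle
        exact (krewerasSetoid s).trans hstep
          (ih (j.1 - j'.1) (by lia) j' j (by lia) (hrel.symm.trans hij))
    intro hij
    rcases le_total i j with h | h
    · exact key (j.1 - i.1) i j (by rw [Fin.le_def] at h; lia) hij
    · exact (krewerasSetoid s).symm (key (i.1 - j.1) j i (by rw [Fin.le_def] at h; lia) hij.symm)

lemma isNoncrossing_krewerasSetoid {s : Setoid (Fin n)} (hs : IsNoncrossing s) :
    IsNoncrossing (krewerasSetoid s) := by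
  intro a b c d hab hbc hcd hac hbd
  rw [krewerasSetoid_iff hs] at *
  intro x y hxy
  have h1 := hac x y hxy
  have h2 := hbd x y hxy
  simp only [Fin.le_def, Fin.lt_def] at *
  lia

/-- The right Kreweras complement `K(π)`: the noncrossing partition with
`w_{K(π)} = w_π⁻¹ γ_n`; see `toPerm_kreweras`. -/
def kreweras (π : NC n) : NC n := ⟨krewerasSetoid π.1, isNoncrossing_krewerasSetoid π.2⟩

lemma toPerm_kreweras (π : NC n) :
    toPerm (kreweras π).1 = (toPerm π.1)⁻¹ * finRotate n := by
  ext1 i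
  set j := ((toPerm π.1)⁻¹ * finRotate n) i with hj
  have hij : krewerasSetoid π.1 i j := ⟨1, by rw [zpow_one]⟩
  have hn := rel_next (krewerasSetoid π.1) i
  change next (krewerasSetoid π.1) i = j
  have hc := next_cases (krewerasSetoid π.1) i
  have hrel : KRel π.1 i (next (krewerasSetoid π.1) i) := (krewerasSetoid_iff π.2 _ _).mp hn
  generalize next (krewerasSetoid π.1) i = p at hc hrel ⊢
  rcases image_cases π.1 i j (next_inv_mul π.1 i) with
    ⟨hi, ⟨z, hz, hz'⟩, -⟩ | ⟨k, hk, hjk, ⟨h1, -⟩ | ⟨h1, -⟩⟩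
  · have h2 := hrel z j hz
    have h3 := hi p
    have h4 := hi j
    have h5 := hi z
    have h6 := hz' p
    rcases hc with ⟨h7, -⟩ | ⟨-, h7⟩
    · exact absurd h7 (not_lt.mpr h3)
    · refine le_antisymm (h7 j hij) ?_
      tauto
  · have h2 := hrel j k hjk
    rcases hc with ⟨h7, -⟩ | ⟨-, h7⟩
    · simp only [Fin.le_def, Fin.lt_def, Fin.ext_iff] at *; lia
    · have h8 := h7 j hij
      simp only [Fin.le_def, Fin.ext_iff] at *; lia
  · have h2 := hrel j k hjk
    rcases hc with ⟨h7, h8⟩ | ⟨h7, -⟩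
    · have h9 := h8 j hij
      simp only [Fin.le_def, Fin.lt_def, Fin.ext_iff] at *; lia
    · have h8 := h7 j hij
      simp only [Fin.le_def] at *; lia

end NC

/-! ### Branches of binary trees -/

/-- The numbers of edges of the left branches (maximal chains of left edges) of a binary tree,
where the branch of the root is extended upwards by `k` edges. -/
def leftBranchesAux : ℕ → BinaryTree Unit → Multiset ℕ
  | _, .nil => 0
  | k, .node _ .nil r => k ::ₘ leftBranchesAux 0 r
  | k, .node _ l r => leftBranchesAux (k + 1) l + leftBranchesAux 0 r

/-- The multiset of the numbers of edges of the left branches of a binary tree. Every node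
belongs to exactly one left branch. -/
def leftBranches (t : BinaryTree Unit) : Multiset ℕ := leftBranchesAux 0 t

/-- The mirror image of a binary tree. -/
def mirror : BinaryTree Unit → BinaryTree Unit
  | .nil => .nil
  | .node _ l r => .node () (mirror r) (mirror l)

/-- The multiset of the numbers of edges of the right branches of a binary tree. -/
def rightBranches (t : BinaryTree Unit) : Multiset ℕ := leftBranches (mirror t)

/-! ### The reduced incidence Hopf algebra of the noncrossing partition lattices -/

namespace NC

variable {a b n : ℕ}

/-- The union of two partitions of disjoint sets. -/
def sumSetoid {α β : Type*} (s : Setoid α) (t : Setoid β) : Setoid (α ⊕ β) where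
  r := Sum.LiftRel s t
  iseqv := by
    refine ⟨fun x => ?_, fun {x y} hxy => ?_, fun {x y z} hxy hyz => ?_⟩
    · rcases x with u | u
      · exact .inl (s.refl u)
      · exact .inr (t.refl u)
    · cases hxy with
      | inl h => exact .inl (s.symm h)
      | inr h => exact .inr (t.symm h)
    · cases hxy with
      | inl h => cases hyz with | inl h' => exact .inl (s.trans h h')
      | inr h => cases hyz with | inr h' => exact .inr (t.trans h h')

lemma appendSetoid_rel (s : Setoid (Fin a)) (t : Setoid (Fin b)) (x y : Fin a ⊕ Fin b) :
    (sumSetoid s t).comap finSumFinEquiv.symm (finSumFinEquiv x) (finSumFinEquiv y) ↔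
      Sum.LiftRel s t x y := by
  change Sum.LiftRel _ _ (finSumFinEquiv.symm _) (finSumFinEquiv.symm _) ↔ _
  rw [Equiv.symm_apply_apply, Equiv.symm_apply_apply]

/-- The union of a partition of `{1, …, a}` and a (shifted) partition of `{a + 1, …, a + b}`. -/
def append (π : NC a) (σ : NC b) : NC (a + b) :=
  ⟨(sumSetoid π.1 σ.1).comap finSumFinEquiv.symm, by
    intro x y z w hxy hyz hzw hxz hyw
    obtain ⟨x, rfl⟩ := finSumFinEquiv.surjective x
    obtain ⟨y, rfl⟩ := finSumFinEquiv.surjective y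
    obtain ⟨z, rfl⟩ := finSumFinEquiv.surjective z
    obtain ⟨w, rfl⟩ := finSumFinEquiv.surjective w
    rw [appendSetoid_rel] at *
    cases hxz with
    | @inl x z h =>
      cases hyw with
      | @inl y w h' => exact .inl (π.2 x y z w hxy hyz hzw h h')
      | @inr y w h' =>
        have h1 : a + y.1 < z.1 := hyz
        have h2 := z.2
        lia
    | @inr x z h =>
      cases hyw with
      | @inl y w h' =>
        have h1 : a + x.1 < y.1 := hxy
        have h2 := y.2
        lia
      | @inr y w h' =>
        exact .inr (σ.2 x y z w (Nat.lt_of_add_lt_add_left hxy) (Nat.lt_of_add_lt_add_left hyz)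
          (Nat.lt_of_add_lt_add_left hzw) h h')⟩

/-- The restriction of a partition of `{1, …, a + b}` to `{1, …, a}`. -/
def restrictL (ρ : NC (a + b)) : NC a :=
  ⟨ρ.1.comap (Fin.castAdd b), fun _ _ _ _ hxy hyz hzw hxz hyw =>
    ρ.2 _ _ _ _ hxy hyz hzw hxz hyw⟩

/-- The restriction of a partition of `{1, …, a + b}` to `{a + 1, …, a + b}`. -/
def restrictR (ρ : NC (a + b)) : NC b :=
  ⟨ρ.1.comap (Fin.natAdd a), fun _ _ _ _ hxy hyz hzw hxz hyw =>
    ρ.2 _ _ _ _ (Nat.add_lt_add_left hxy a) (Nat.add_lt_add_left hyz a)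
      (Nat.add_lt_add_left hzw a) hxz hyw⟩

lemma append_rel {π : NC a} {σ : NC b} (x y : Fin a ⊕ Fin b) :
    (append π σ).1 (finSumFinEquiv x) (finSumFinEquiv y) ↔ Sum.LiftRel π.1 σ.1 x y :=
  appendSetoid_rel _ _ _ _

lemma append_mono {π π' : NC a} {σ σ' : NC b} (h : π ≤ π') (h' : σ ≤ σ') :
    append π σ ≤ append π' σ' :=
  fun {_ _} hxy => Sum.LiftRel.mono (fun _ _ k => h k) (fun _ _ k => h' k) hxy

lemma restrictL_append (π : NC a) (σ : NC b) : restrictL (append π σ) = π :=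
  Subtype.ext <| Setoid.ext fun x y => by
    refine (append_rel (Sum.inl x) (Sum.inl y)).trans ?_
    exact Sum.liftRel_inl_inl

lemma restrictR_append (π : NC a) (σ : NC b) : restrictR (append π σ) = σ :=
  Subtype.ext <| Setoid.ext fun x y => by
    refine (append_rel (Sum.inr x) (Sum.inr y)).trans ?_
    exact Sum.liftRel_inr_inr

lemma restrictL_mono {ρ ρ' : NC (a + b)} (h : ρ ≤ ρ') : restrictL ρ ≤ restrictL ρ' :=
  fun {_ _} hxy => h hxy

lemma restrictR_mono {ρ ρ' : NC (a + b)} (h : ρ ≤ ρ') : restrictR ρ ≤ restrictR ρ' :=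
  fun {_ _} hxy => h hxy

lemma append_restrict {ρ : NC (a + b)} {π : NC a} {σ : NC b} (h : ρ ≤ append π σ) :
    append (restrictL ρ) (restrictR ρ) = ρ :=
  Subtype.ext <| Setoid.ext fun x y => by
    obtain ⟨x, rfl⟩ := finSumFinEquiv.surjective x
    obtain ⟨y, rfl⟩ := finSumFinEquiv.surjective y
    rw [append_rel]
    constructor
    · rintro (⟨hxy⟩ | ⟨hxy⟩)
      · exact hxy
      · exact hxy
    · intro hxy
      have := h hxy
      rw [append_rel] at this
      cases this with
      | inl => exact .inl hxy
      | inr => exact .inr hxy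

/-- An interval between unions of partitions is a product of intervals. -/
def appendIso (π π' : NC a) (σ σ' : NC b) :
    Set.Icc (append π σ) (append π' σ') ≃o Set.Icc π π' × Set.Icc σ σ' where
  toFun ρ :=
    (⟨restrictL ρ.1, (restrictL_append π σ).ge.trans (restrictL_mono ρ.2.1),
      (restrictL_mono ρ.2.2).trans (restrictL_append π' σ').le⟩,
    ⟨restrictR ρ.1, (restrictR_append π σ).ge.trans (restrictR_mono ρ.2.1),
      (restrictR_mono ρ.2.2).trans (restrictR_append π' σ').le⟩)
  invFun p := ⟨append p.1.1 p.2.1, append_mono p.1.2.1 p.2.2.1, append_mono p.1.2.2 p.2.2.2⟩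
  left_inv ρ := Subtype.ext (append_restrict ρ.2.2)
  right_inv p := Prod.ext (Subtype.ext (restrictL_append _ _)) (Subtype.ext (restrictR_append _ _))
  map_rel_iff' {ρ ρ'} := by
    constructor
    · intro h
      have := append_mono h.1 h.2
      change append (restrictL ρ.1) (restrictR ρ.1) ≤
        append (restrictL ρ'.1) (restrictR ρ'.1) at this
      rwa [append_restrict ρ.2.2, append_restrict ρ'.2.2] at this
    · exact fun h => ⟨restrictL_mono h, restrictR_mono h⟩

end NC

instance NC.fintypeIcc {n : ℕ} (π σ : NC n) : Fintype (Set.Icc π σ) := Fintype.ofFinite _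

/-- The intervals of the lattices `NC_n`. -/
structure NCInterval where
  /-- The size of the partitioned set. -/
  n : ℕ
  /-- The lower bound. -/
  lo : NC n
  /-- The upper bound. -/
  hi : NC n
  /-- The interval is nonempty. -/
  le : lo ≤ hi

namespace NCInterval

/-- The elements of an interval, as a partially ordered set. -/
abbrev Elem (I : NCInterval) : Type := Set.Icc I.lo I.hi

/-- Two intervals are equivalent if they are isomorphic as partially ordered sets. -/
instance setoid : Setoid NCInterval where
  r I J := Nonempty (I.Elem ≃o J.Elem)
  iseqv := ⟨fun _ => ⟨OrderIso.refl _⟩, fun ⟨f⟩ => ⟨f.symm⟩, fun ⟨f⟩ ⟨g⟩ => ⟨f.trans g⟩⟩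

/-- An interval which is isomorphic to the Cartesian product of two given ones; see `prodIso`. -/
def prod (I J : NCInterval) : NCInterval where
  n := I.n + J.n
  lo := NC.append I.lo J.lo
  hi := NC.append I.hi J.hi
  le := NC.append_mono I.le J.le

/-- `I.prod J` is isomorphic to the Cartesian product of `I` and `J`. -/
def prodIso (I J : NCInterval) : (I.prod J).Elem ≃o I.Elem × J.Elem := NC.appendIso _ _ _ _

lemma subsingleton_iff (I : NCInterval) : Subsingleton I.Elem ↔ I.lo = I.hi := by
  constructor
  · intro _
    exact congrArg Subtype.val (Subsingleton.elim (α := I.Elem) ⟨I.lo, le_rfl, I.le⟩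
      ⟨I.hi, I.le, le_rfl⟩)
  · intro h
    exact ⟨fun x y => Subtype.ext (le_antisymm (x.2.2.trans (h.ge.trans y.2.1))
      (y.2.2.trans (h.ge.trans x.2.1)))⟩

end NCInterval

/-- The product of two order isomorphisms. -/
def prodCongrIso {α β γ δ : Type*} [LE α] [LE β] [LE γ] [LE δ] (f : α ≃o γ) (g : β ≃o δ) :
    α × β ≃o γ × δ where
  toEquiv := f.toEquiv.prodCongr g.toEquiv
  map_rel_iff' {_ _} := and_congr f.le_iff_le g.le_iff_le

/-- The product with a one-element interval. -/
def uniqueProdIso {α β : Type*} [PartialOrder α] [LE β] (a : α) :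
    Set.Icc a a × β ≃o β where
  toFun p := p.2
  invFun y := (⟨a, le_rfl, le_rfl⟩, y)
  left_inv p := Prod.ext (Subtype.ext (le_antisymm p.1.2.1 p.1.2.2)) rfl
  right_inv _ := rfl
  map_rel_iff' {p q} := ⟨fun h => ⟨p.1.2.2.trans q.1.2.1, h⟩, fun h => h.2⟩

/-- An isomorphism of intervals restricts to subintervals. -/
def iccRestrict {α β : Type*} [PartialOrder α] [PartialOrder β] {a b : α} {a' b' : β}
    (f : Set.Icc a b ≃o Set.Icc a' b') (x y : Set.Icc a b) :
    Set.Icc x.1 y.1 ≃o Set.Icc (f x).1 (f y).1 where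
  toFun z := ⟨(f ⟨z.1, x.2.1.trans z.2.1, z.2.2.trans y.2.2⟩).1,
    f.monotone z.2.1, f.monotone z.2.2⟩
  invFun z := ⟨(f.symm ⟨z.1, (f x).2.1.trans z.2.1, z.2.2.trans (f y).2.2⟩).1,
    (f.le_symm_apply (x := x)).mpr z.2.1, (f.symm_apply_le (x := y)).mpr z.2.2⟩
  left_inv z := by
    have := congrArg Subtype.val
      (f.symm_apply_apply ⟨z.1, x.2.1.trans z.2.1, z.2.2.trans y.2.2⟩)
    exact Subtype.ext this
  right_inv z := by
    have := congrArg Subtype.val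
      (f.apply_symm_apply ⟨z.1, (f x).2.1.trans z.2.1, z.2.2.trans (f y).2.2⟩)
    exact Subtype.ext this
  map_rel_iff' {z w} := f.le_iff_le

lemma iccIso_lo {α β : Type*} [PartialOrder α] [PartialOrder β] {a b : α} {a' b' : β}
    (f : Set.Icc a b ≃o Set.Icc a' b') (h : a ≤ b) (h' : a' ≤ b') :
    f ⟨a, le_rfl, h⟩ = ⟨a', le_rfl, h'⟩ := by
  refine le_antisymm ?_ (f ⟨a, le_rfl, h⟩).2.1
  rw [← f.le_symm_apply]
  exact (f.symm ⟨a', le_rfl, h'⟩).2.1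

lemma iccIso_hi {α β : Type*} [PartialOrder α] [PartialOrder β] {a b : α} {a' b' : β}
    (f : Set.Icc a b ≃o Set.Icc a' b') (h : a ≤ b) (h' : a' ≤ b') :
    f ⟨b, h, le_rfl⟩ = ⟨b', h', le_rfl⟩ := by
  refine le_antisymm (f ⟨b, h, le_rfl⟩).2.2 ?_
  rw [← f.symm_apply_le]
  exact (f.symm ⟨b', h', le_rfl⟩).2.2

/-- The isomorphism classes of intervals of the lattices `NC_n`. -/
def NCClass : Type := Quotient NCInterval.setoid

namespace NCClass

/-- The class of the interval `[π, σ]`. -/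
def mk {n : ℕ} (π σ : NC n) (h : π ≤ σ) : NCClass := Quotient.mk _ ⟨n, π, σ, h⟩

lemma mk_eq {n n' : ℕ} {π σ : NC n} {π' σ' : NC n'} {h : π ≤ σ} {h' : π' ≤ σ'}
    (f : Set.Icc π σ ≃o Set.Icc π' σ') : mk π σ h = mk π' σ' h' := Quotient.sound ⟨f⟩

lemma mk_congr {n : ℕ} {π σ π' σ' : NC n} {h : π ≤ σ} {h' : π' ≤ σ'} (h1 : π = π')
    (h2 : σ = σ') : mk π σ h = mk π' σ' h' := by
  subst h1 h2; rfl

lemma ind {P : NCClass → Prop} (H : ∀ (n : ℕ) (π σ : NC n) (h : π ≤ σ), P (mk π σ h)) (c) :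
    P c := Quotient.ind (fun I => H I.n I.lo I.hi I.le) c

/-- The product of classes is given by the Cartesian product, and the unit is the class of the
one-element intervals. -/
instance : CommMonoid NCClass where
  mul := Quotient.map₂ NCInterval.prod fun I I' ⟨f⟩ J J' ⟨g⟩ =>
    ⟨(I.prodIso J).trans ((prodCongrIso f g).trans (I'.prodIso J').symm)⟩
  one := mk (⊥ : NC 0) ⊥ le_rfl
  mul_assoc := by
    rintro ⟨I⟩ ⟨J⟩ ⟨K⟩
    exact Quotient.sound ⟨((I.prod J).prodIso K).trans
      ((prodCongrIso (I.prodIso J) (OrderIso.refl _)).trans ((OrderIso.prodAssoc _ _ _).trans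
        ((prodCongrIso (OrderIso.refl _) (J.prodIso K).symm).trans (I.prodIso (J.prod K)).symm)))⟩
  one_mul := by
    rintro ⟨I⟩
    exact Quotient.sound ⟨((NCInterval.mk 0 ⊥ ⊥ le_rfl).prodIso I).trans (uniqueProdIso _)⟩
  mul_one := by
    rintro ⟨I⟩
    exact Quotient.sound ⟨(I.prodIso (NCInterval.mk 0 ⊥ ⊥ le_rfl)).trans
      (OrderIso.prodComm.trans (uniqueProdIso _))⟩
  mul_comm := by
    rintro ⟨I⟩ ⟨J⟩
    exact Quotient.sound ⟨(I.prodIso J).trans (OrderIso.prodComm.trans (J.prodIso I).symm)⟩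

lemma mk_mul_mk {n m : ℕ} (π σ : NC n) (h : π ≤ σ) (π' σ' : NC m) (h' : π' ≤ σ') :
    mk π σ h * mk π' σ' h' =
      mk (NC.append π π') (NC.append σ σ') (NC.append_mono h h') := rfl

lemma mk_self {n : ℕ} (π : NC n) : mk π π le_rfl = 1 :=
  mk_eq (h' := le_rfl) (σ' := (⊥ : NC 0)) (π' := ⊥)
    { toFun := fun _ => ⟨⊥, le_rfl, le_rfl⟩
      invFun := fun _ => ⟨π, le_rfl, le_rfl⟩
      left_inv := fun x => Subtype.ext (le_antisymm x.2.1 x.2.2)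
      right_inv := fun x => Subtype.ext (le_antisymm x.2.1 x.2.2)
      map_rel_iff' := fun {x y} => ⟨fun _ => x.2.2.trans y.2.1, fun _ => le_rfl⟩ }

end NCClass

/-- The reduced incidence Hopf algebra `H_NC` of the lattices of noncrossing partitions: the free
module on the isomorphism classes of intervals of the `NC_n`, whose product is given by the
Cartesian product of intervals. -/
def HNC (R : Type*) [CommRing R] : Type _ := MonoidAlgebra R NCClass

namespace HNC

variable (R : Type*) [CommRing R]

instance : CommRing (HNC R) := inferInstanceAs (CommRing (MonoidAlgebra R NCClass))

instance : Algebra R (HNC R) := inferInstanceAs (Algebra R (MonoidAlgebra R NCClass))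

/-- The basis element of a class of intervals. -/
def of : NCClass →* HNC R := MonoidAlgebra.of R NCClass

variable {R} in
/-- The algebra morphism defined by a multiplicative function of intervals. -/
def lift {A : Type*} [Semiring A] [Algebra R A] (F : NCClass →* A) : HNC R →ₐ[R] A :=
  MonoidAlgebra.lift R A NCClass F

variable {R} in
@[simp] lemma lift_of {A : Type*} [Semiring A] [Algebra R A] (F : NCClass →* A) (c : NCClass) :
    lift F (of R c) = F c := MonoidAlgebra.lift_of F c

variable {R} in
lemma hom_ext {A : Type*} [AddCommMonoid A] [Module R A] {φ ψ : HNC R →ₗ[R] A}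
    (H : ∀ (n : ℕ) (π σ : NC n) (h : π ≤ σ),
      φ (of R (NCClass.mk π σ h)) = ψ (of R (NCClass.mk π σ h))) : φ = ψ := by
  have : ∀ c, φ (of R c) = ψ (of R c) := NCClass.ind H
  refine MonoidAlgebra.lhom_ext' fun c => LinearMap.ext_ring (this c)

/-- The element of `H_NC` given by the interval `[π, σ]`, and `0` if `π ≰ σ`. -/
def zeta {n : ℕ} (π σ : NC n) : HNC R :=
  open Classical in if h : π ≤ σ then of R (NCClass.mk π σ h) else 0

/-- The generator `y_n`, the class of the lattice `NC_{n+1}`. -/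
def y (n : ℕ) : HNC R := of R (NCClass.mk (⊥ : NC (n + 1)) ⊤ bot_le)

/-- The coproduct `∑ [π, τ] ⊗ [τ, σ]` of an interval `[π, σ]`. -/
def comulInterval (I : NCInterval) : HNC R ⊗[R] HNC R :=
  ∑ τ : I.Elem, of R (NCClass.mk I.lo τ.1 τ.2.1) ⊗ₜ[R] of R (NCClass.mk τ.1 I.hi τ.2.2)

lemma comulInterval_congr (I J : NCInterval) (f : I.Elem ≃o J.Elem) :
    comulInterval R I = comulInterval R J := by
  refine Fintype.sum_equiv f.toEquiv _ _ fun τ => ?_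
  have h1 := iccIso_lo f I.le J.le
  have h2 := iccIso_hi f I.le J.le
  congr 2
  · refine NCClass.mk_eq (((iccRestrict f ⟨I.lo, le_rfl, I.le⟩ τ)).trans (OrderIso.setCongr _ _ ?_))
    rw [h1]; rfl
  · refine NCClass.mk_eq (((iccRestrict f τ ⟨I.hi, I.le, le_rfl⟩)).trans (OrderIso.setCongr _ _ ?_))
    rw [h2]; rfl

lemma comulInterval_eq_one (I : NCInterval) (h : I.lo = I.hi) : comulInterval R I = 1 := by
  have hI : ∀ τ : I.Elem, τ.1 = I.lo := fun τ => le_antisymm (τ.2.2.trans h.ge) τ.2.1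
  rw [comulInterval, Finset.sum_eq_single (⟨I.lo, le_rfl, I.le⟩ : I.Elem)
    (fun τ _ hτ => absurd (Subtype.ext (hI τ)) hτ) (fun hh => absurd (Finset.mem_univ _) hh),
    Algebra.TensorProduct.one_def, ← map_one (of R), ← NCClass.mk_self I.lo]
  congr 2
  exact NCClass.mk_congr rfl h.symm

/-- The coproduct of a class of intervals. -/
def comulClass : NCClass →* HNC R ⊗[R] HNC R where
  toFun := Quotient.lift (comulInterval R) fun I J ⟨f⟩ => comulInterval_congr R I J f
  map_one' := comulInterval_eq_one R ⟨0, ⊥, ⊥, le_rfl⟩ rfl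
  map_mul' := by
    rintro ⟨I⟩ ⟨J⟩
    change comulInterval R (I.prod J) = comulInterval R I * comulInterval R J
    rw [comulInterval, comulInterval, comulInterval, Finset.sum_mul_sum, ← Fintype.sum_prod_type']
    refine Fintype.sum_equiv (I.prodIso J).toEquiv _ _ fun τ => ?_
    rw [Algebra.TensorProduct.tmul_mul_tmul, ← map_mul, ← map_mul, NCClass.mk_mul_mk,
      NCClass.mk_mul_mk]
    have hτ : τ.1 = NC.append (NC.restrictL τ.1) (NC.restrictR τ.1) :=
      (NC.append_restrict τ.2.2).symm
    congr 2
    · exact NCClass.mk_congr rfl hτ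
    · exact NCClass.mk_congr hτ rfl

open Classical in
/-- The counit of a class: `1` for one-element intervals and `0` for the others. -/
def counitClass : NCClass →* R where
  toFun := Quotient.lift (fun I => if I.lo = I.hi then 1 else 0) fun I J ⟨f⟩ =>
    if_congr (by rw [← I.subsingleton_iff, ← J.subsingleton_iff, f.toEquiv.subsingleton_congr])
      rfl rfl
  map_one' := if_pos rfl
  map_mul' := by
    rintro ⟨I⟩ ⟨J⟩
    change (if NC.append I.lo J.lo = NC.append I.hi J.hi then (1 : R) else 0) =
      (if I.lo = I.hi then 1 else 0) * (if J.lo = J.hi then 1 else 0)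
    have : NC.append I.lo J.lo = NC.append I.hi J.hi ↔ I.lo = I.hi ∧ J.lo = J.hi := by
      constructor
      · intro h
        exact ⟨by rw [← NC.restrictL_append I.lo J.lo, h, NC.restrictL_append],
          by rw [← NC.restrictR_append I.lo J.lo, h, NC.restrictR_append]⟩
      · rintro ⟨h1, h2⟩
        rw [h1, h2]
    simp only [this, ite_and, ite_mul, one_mul, zero_mul]

variable {R} {n : ℕ}

lemma zeta_of_le {π σ : NC n} (h : π ≤ σ) : zeta R π σ = of R (NCClass.mk π σ h) := dif_pos h

lemma zeta_of_not_le {π σ : NC n} (h : ¬ π ≤ σ) : zeta R π σ = 0 := dif_neg h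

lemma zeta_self (π : NC n) : zeta R π π = 1 := by
  rw [zeta_of_le le_rfl, NCClass.mk_self, map_one]

lemma comul_zeta (π σ : NC n) :
    lift (comulClass R) (zeta R π σ) = ∑ τ : NC n, zeta R π τ ⊗ₜ[R] zeta R τ σ := by
  by_cases h : π ≤ σ
  · rw [zeta_of_le h, lift_of]
    change comulInterval R ⟨n, π, σ, h⟩ = _
    refine Fintype.sum_of_injective Subtype.val Subtype.val_injective _ _ (fun τ hτ => ?_)
      fun τ => ?_
    · by_cases h1 : π ≤ τ
      · rw [zeta_of_not_le (fun h2 : τ ≤ σ => hτ ⟨⟨τ, h1, h2⟩, rfl⟩), TensorProduct.tmul_zero]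
      · rw [zeta_of_not_le h1, TensorProduct.zero_tmul]
    · rw [zeta_of_le τ.2.1, zeta_of_le τ.2.2]
  · rw [zeta_of_not_le h, map_zero]
    refine (Finset.sum_eq_zero fun τ _ => ?_).symm
    by_cases h1 : π ≤ τ
    · rw [zeta_of_not_le (fun h2 : τ ≤ σ => h (h1.trans h2)), TensorProduct.tmul_zero]
    · rw [zeta_of_not_le h1, TensorProduct.zero_tmul]

lemma counit_zeta (π σ : NC n) [Decidable (π = σ)] :
    lift (counitClass R) (zeta R π σ) = if π = σ then 1 else 0 := by
  by_cases h : π ≤ σ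
  · rw [zeta_of_le h, lift_of]
    by_cases h' : π = σ
    · rw [if_pos h']; exact if_pos h'
    · rw [if_neg h']; exact if_neg h'
  · rw [zeta_of_not_le h, map_zero, if_neg (fun h' => h h'.le)]

lemma algHom_ext_zeta {A : Type*} [Semiring A] [Algebra R A] {φ ψ : HNC R →ₐ[R] A}
    (H : ∀ (n : ℕ) (π σ : NC n), φ (zeta R π σ) = ψ (zeta R π σ)) : φ = ψ := by
  apply AlgHom.toLinearMap_injective
  refine hom_ext fun n π σ h => ?_
  have := H n π σ
  rwa [zeta_of_le h] at this

instance : Bialgebra R (HNC R) :=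
  Bialgebra.ofAlgHom (lift (comulClass R)) (lift (counitClass R))
    (algHom_ext_zeta fun n π σ => by
      simp only [AlgHom.coe_comp, Function.comp_apply, comul_zeta, map_sum,
        Algebra.TensorProduct.map_tmul, AlgHom.coe_id, id_eq, TensorProduct.sum_tmul,
        TensorProduct.tmul_sum]
      rw [Finset.sum_comm]
      rfl)
    (algHom_ext_zeta fun n π σ => by
      classical
      rw [AlgHom.comp_apply, comul_zeta, map_sum, Finset.sum_eq_single π]
      · rw [Algebra.TensorProduct.map_tmul, counit_zeta, if_pos rfl]; rfl
      · intro τ _ hτ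
        rw [Algebra.TensorProduct.map_tmul, counit_zeta, if_neg hτ.symm, TensorProduct.zero_tmul]
      · simp)
    (algHom_ext_zeta fun n π σ => by
      classical
      rw [AlgHom.comp_apply, comul_zeta, map_sum, Finset.sum_eq_single σ]
      · rw [Algebra.TensorProduct.map_tmul, counit_zeta, if_pos rfl]; rfl
      · intro τ _ hτ
        rw [Algebra.TensorProduct.map_tmul, counit_zeta, if_neg hτ, TensorProduct.tmul_zero]
      · simp)

lemma comul_def (π σ : NC n) : Coalgebra.comul (R := R) (zeta R π σ) =
    ∑ τ : NC n, zeta R π τ ⊗ₜ[R] zeta R τ σ := comul_zeta π σ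

lemma counit_def (π σ : NC n) [Decidable (π = σ)] :
    Coalgebra.counit (R := R) (zeta R π σ) = if π = σ then 1 else 0 := counit_zeta π σ

/-- The number of elements of an interval. -/
def card (c : NCClass) : ℕ :=
  Quotient.lift (fun I : NCInterval => Fintype.card I.Elem)
    (fun I J (h : Nonempty (I.Elem ≃o J.Elem)) => Fintype.card_congr h.some.toEquiv) c

open WithConv in
lemma conv_zeta (φ ψ : WithConv (HNC R →ₗ[R] HNC R)) (π σ : NC n) :
    (φ * ψ) (zeta R π σ) = ∑ τ : NC n, φ (zeta R π τ) * ψ (zeta R τ σ) := by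
  rw [LinearMap.convMul_apply, comul_def, map_sum, map_sum]
  rfl

variable (R) in
open WithConv in
/-- The endomorphism `u = 1 - id` of the convolution algebra. -/
def unipotent : WithConv (HNC R →ₗ[R] HNC R) := 1 - toConv LinearMap.id

lemma unipotent_zeta_self (π : NC n) : unipotent R (zeta R π π) = 0 := by
  classical
  change algebraMap R (HNC R) (Coalgebra.counit (R := R) (zeta R π π)) - zeta R π π = 0
  rw [counit_def, if_pos rfl, zeta_self, map_one, sub_self]

lemma card_pos (π σ : NC n) (h : π ≤ σ) : 0 < card (NCClass.mk π σ h) :=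
  Fintype.card_pos_iff.mpr ⟨(⟨π, le_rfl, h⟩ : (NCInterval.mk n π σ h).Elem)⟩

lemma card_lt {π τ σ : NC n} (h : π < τ) (h' : τ ≤ σ) :
    card (NCClass.mk τ σ h') < card (NCClass.mk π σ (h.le.trans h')) := by
  refine Fintype.card_lt_of_injective_of_notMem
    (fun x : (NCInterval.mk n τ σ h').Elem =>
      (⟨x.1, h.le.trans x.2.1, x.2.2⟩ : (NCInterval.mk n π σ (h.le.trans h')).Elem))
    (fun x y hxy => Subtype.ext (Subtype.mk.inj hxy)) (b := ⟨π, le_rfl, h.le.trans h'⟩) ?_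
  rintro ⟨x, hx⟩
  have h1 : x.1 = π := congrArg Subtype.val hx
  exact absurd (x.2.1.trans h1.le) h.not_ge

lemma card_le (π σ : NC n) (h : π ≤ σ) : card (NCClass.mk π σ h) ≤ Fintype.card (NC n) :=
  Fintype.card_le_of_injective (fun x : (NCInterval.mk n π σ h).Elem => x.1)
    Subtype.val_injective

lemma unipotent_pow_zeta (k : ℕ) (π σ : NC n) (h : π ≤ σ)
    (hk : card (NCClass.mk π σ h) ≤ k) : (unipotent R ^ k) (zeta R π σ) = 0 := by
  induction k generalizing π with
  | zero => exact absurd (card_pos π σ h) (by lia)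
  | succ k ih =>
    rw [pow_succ', conv_zeta]
    refine Finset.sum_eq_zero fun τ _ => ?_
    by_cases h1 : π ≤ τ
    · by_cases h2 : τ ≤ σ
      · rcases h1.eq_or_lt with rfl | hlt
        · rw [unipotent_zeta_self, zero_mul]
        · have := card_lt hlt h2
          rw [ih τ h2 (by lia), mul_zero]
      · rw [zeta_of_not_le h2, map_zero, mul_zero]
    · rw [zeta_of_not_le h1, map_zero, zero_mul]

variable (R) in
/-- The antipode, which is the convolution inverse `∑_k (1 - id)^k` of the identity; this series
is evaluated on an interval with `N` elements by its terms with `k < N`, as the others vanish. -/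
def antipodeMap : HNC R →ₗ[R] HNC R :=
  (Finsupp.lift (HNC R) R NCClass
    (fun c => ∑ k ∈ range (card c), (unipotent R ^ k) (of R c))) ∘ₗ
    (MonoidAlgebra.coeffLinearEquiv R : MonoidAlgebra R NCClass ≃ₗ[R] _).toLinearMap

lemma antipodeMap_of (c : NCClass) :
    antipodeMap R (of R c) = ∑ k ∈ range (card c), (unipotent R ^ k) (of R c) := by
  change Finsupp.lift (HNC R) R NCClass _ (Finsupp.single c 1) = _
  rw [Finsupp.lift_apply, Finsupp.sum_single_index (by simp), one_smul]

lemma antipodeMap_zeta (π σ : NC n) : antipodeMap R (zeta R π σ) =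
    (∑ k ∈ range (Fintype.card (NC n)), unipotent R ^ k) (zeta R π σ) := by
  have hsum : ∀ N : ℕ, (∑ k ∈ range N, unipotent R ^ k) (zeta R π σ) =
      ∑ k ∈ range N, (unipotent R ^ k) (zeta R π σ) := by
    intro N
    rw [WithConv.ofConv_sum, LinearMap.sum_apply]
  rw [hsum]
  by_cases h : π ≤ σ
  · rw [zeta_of_le h, antipodeMap_of]
    refine Finset.sum_subset (Finset.range_mono (card_le π σ h)) fun k _ hk => ?_
    rw [← zeta_of_le h]
    exact unipotent_pow_zeta k π σ h (by simpa using hk)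
  · simp [zeta_of_not_le h]

lemma unipotent_pow_card (π σ : NC n) :
    (unipotent R ^ Fintype.card (NC n)) (zeta R π σ) = 0 := by
  by_cases h : π ≤ σ
  · exact unipotent_pow_zeta _ π σ h (card_le π σ h)
  · rw [zeta_of_not_le h, map_zero]

open WithConv in
lemma id_eq_one_sub : (toConv LinearMap.id : WithConv (HNC R →ₗ[R] HNC R)) = 1 - unipotent R := by
  rw [unipotent, sub_sub_cancel]

open WithConv in
instance : HopfAlgebra R (HNC R) :=
  HopfAlgebra.ofConvInverse (antipodeMap R)
    (ofConv_injective <| hom_ext fun n π σ h => by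
      rw [← zeta_of_le h]
      refine (conv_zeta _ _ π σ).trans ?_
      change ∑ τ : NC n, antipodeMap R (zeta R π τ) *
        (toConv LinearMap.id : WithConv (HNC R →ₗ[R] HNC R)) (zeta R τ σ) = _
      refine (Finset.sum_congr rfl fun τ _ => congrArg (· * _) (antipodeMap_zeta π τ)).trans ?_
      rw [id_eq_one_sub, ← conv_zeta, geom_sum_mul_neg, ofConv_sub, LinearMap.sub_apply,
        unipotent_pow_card, sub_zero])
    (ofConv_injective <| hom_ext fun n π σ h => by
      rw [← zeta_of_le h]
      refine (conv_zeta _ _ π σ).trans ?_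
      change ∑ τ : NC n, (toConv LinearMap.id : WithConv (HNC R →ₗ[R] HNC R)) (zeta R π τ) *
        antipodeMap R (zeta R τ σ) = _
      refine (Finset.sum_congr rfl fun τ _ => congrArg (_ * ·) (antipodeMap_zeta τ σ)).trans ?_
      rw [id_eq_one_sub, ← conv_zeta, mul_neg_geom_sum, ofConv_sub, LinearMap.sub_apply,
        unipotent_pow_card, sub_zero])

end HNC

end

/-! Call g the Lagrange series of s if g(t) = s(t g(t)). Then s determines g, and g determines s
when g(0) = 1. The series of the g_n is the Lagrange series of H(t) = ∑ h_n t^n, and the coproduct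
sends H to (H ⊗ 1)(1 ⊗ H). So Δg is the Lagrange series of a product s s', and both coproduct
formulas expand such a series in terms of the Lagrange series a of s and b of s'.

One recursion, `IsBranchSum`, governs the expansion: S(n+1,k,m) is the sum of S(p,k+1,0) S(q,0,m+1)
over p + q = n. Its generating functions in n satisfy F₁₀ = a(t F₀₁) and F₀₁ = b(t F₁₀), and the
nonempty objects have generating function G = F₁₀ F₀₁. Substituting t F₀₁ into a(t) = s(t a(t))
gives F₁₀ = s(tG); likewise F₀₁ = s'(tG). Hence G = (s s')(tG), which is `IsBranchSum.isLagrange`.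
Binary trees satisfy the recursion by removal of the root. Noncrossing partitions satisfy it by
removal of the last element c of the first block: the parts to the left and right of c are
arbitrary, c enlarges the first block of the left part, and in the Kreweras complement c enlarges
the last block of the complement of the right part (`NC.IsJoin.kreweras`).

In the incidence algebra, [0, π] is a product of full lattices indexed by the blocks of π, and [π,
1] is isomorphic to [0, K(π)], because K reverses the order and products of full lattices are
self-dual (`NCClass.mk_top`). So the y_n generate and have the same coproduct as the g_n. As Sym is
free on the h_n, there is a morphism g_n ↦ y_n, and it is a surjective morphism of bialgebras.

Injectivity is tested on characters, with no classification of intervals. The rank of an interval is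
an isomorphism invariant, so [π, σ] ↦ q^rank is a character. Since 1/(1 - qt) is the Lagrange series
of 1 + qt, this character turns H(t) into 1 + qt. Convolution of characters multiplies these series,
so ∏ (1 - x_i t) occurs as well. Up to the antipode this is the restriction to finitely many
variables, and such restrictions separate symmetric functions. The second isomorphism is the first
followed by the antipode, which is an automorphism since Sym is commutative and cocommutative. -/

noncomputable section

/-! ### Compatibility with the antipodes -/

open WithConv in
-- The algebra morphisms H → K form a group under convolution, in which the inverse of f is f ∘ S.
-- Since S ∘ f is a left inverse of f, the two agree.
lemma BialgHom.map_antipode {R H K : Type*} [CommRing R] [CommRing H] [CommRing K]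
    [HopfAlgebra R H] [HopfAlgebra R K] (f : H →ₐc[R] K) (a : H) :
    f (HopfAlgebra.antipode R a) = HopfAlgebra.antipode R (f a) := by
  have h1 : toConv ((HopfAlgebra.antipodeAlgHom R K).comp (f : H →ₐ[R] K)) *
      toConv (f : H →ₐ[R] K) = 1 := by
    have h := AlgHom.convMul_comp_bialgHom_distrib (toConv (HopfAlgebra.antipodeAlgHom R K))
      (toConv (AlgHom.id R K)) f
    rw [AlgHom.antipode_id_cancel] at h
    refine (congrArg toConv h.symm).trans ?_
    refine congrArg toConv (AlgHom.ext fun x => ?_)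
    change algebraMap R K (Coalgebra.counit (R := R) (f x)) = algebraMap R K _
    exact congrArg _ (CoalgHomClass.counit_comp_apply f x)
  have h2 := eq_inv_of_mul_eq_one_left h1
  exact (DFunLike.congr_fun (congrArg ofConv h2) a).symm

/-! ### Substitution form of the functional equation of the Lagrange series -/

namespace PowerSeries

variable {A B : Type*} [CommRing A] [CommRing B]

/-- `g(t) = s(t g(t))`, coefficientwise. -/
def IsLagrange (s g : PowerSeries A) : Prop :=
  ∀ n, coeff n g = ∑ k ∈ range (n + 1), coeff k s * coeff (n - k) (g ^ k)

lemma hasSubst_of_X_dvd {b : PowerSeries A} (hb : X ∣ b) : HasSubst b :=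
  HasSubst.of_constantCoeff_zero' (X_dvd_iff.mp hb)

lemma coeff_subst_X_mul (s g : PowerSeries A) (n : ℕ) :
    coeff n (s.subst (X * g)) = ∑ k ∈ range (n + 1), coeff k s * coeff (n - k) (g ^ k) := by
  rw [coeff_subst' (hasSubst_of_X_dvd (dvd_mul_right X g)),
    finsum_eq_sum_of_support_subset (s := range (n + 1))]
  · refine Finset.sum_congr rfl fun k hk => ?_
    rw [mul_pow, coeff_X_pow_mul', if_pos (Nat.lt_succ_iff.mp (Finset.mem_range.mp hk)),
      smul_eq_mul]
  · intro k hk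
    rw [Function.mem_support, mul_pow, coeff_X_pow_mul'] at hk
    rw [Finset.coe_range, Set.mem_Iio]
    by_contra hlt
    exact hk (by rw [if_neg (by lia), smul_zero])

lemma isLagrange_iff {s g : PowerSeries A} : IsLagrange s g ↔ g = s.subst (X * g) := by
  rw [PowerSeries.ext_iff]
  exact forall_congr' fun n => by rw [coeff_subst_X_mul]

/-- For k ≥ 1 the k-th term of the equation for the n-th coefficient involves only coefficients of g
of index below n, so a congruence modulo X^n improves to one modulo X^(n+1). -/
lemma IsLagrange.unique {s g g' : PowerSeries A} (hg : IsLagrange s g) (hg' : IsLagrange s g') :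
    g = g' := by
  have key : ∀ n, (X : PowerSeries A) ^ n ∣ g - g' := by
    intro n
    induction n with
    | zero => simp
    | succ n ih =>
      rw [X_pow_dvd_iff]
      intro m hm
      rw [map_sub, sub_eq_zero, hg m, hg' m]
      refine Finset.sum_congr rfl fun k _ => ?_
      rcases Nat.eq_zero_or_pos k with rfl | hk
      · simp
      · congr 1
        have h := X_pow_dvd_iff.mp (ih.trans (sub_dvd_pow_sub_pow g g' k))
        rcases Nat.eq_zero_or_pos m with rfl | hm0
        -- Here m - k is truncated to 0; the constant terms agree because both are that of s.
        · have h0 : coeff 0 g = coeff 0 g' := by rw [hg 0, hg' 0]; simp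
          simp only [coeff_zero_eq_constantCoeff, Nat.zero_sub, map_pow] at h0 ⊢
          rw [h0]
        · have := h (m - k) (by lia)
          rwa [map_sub, sub_eq_zero] at this
  ext n
  have := X_pow_dvd_iff.mp (key (n + 1)) n (Nat.lt_succ_self n)
  rwa [map_sub, sub_eq_zero] at this

lemma IsLagrange.map {s g : PowerSeries A} (hg : IsLagrange s g) (f : A →+* B) :
    IsLagrange (PowerSeries.map f s) (PowerSeries.map f g) := fun n => by
  simp only [coeff_map, hg n, map_sum, map_mul, ← map_pow]

lemma IsLagrange.subst_eq {s g b : PowerSeries A} (hg : IsLagrange s g) (hb : X ∣ b) :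
    g.subst b = s.subst (b * g.subst b) := by
  have hb' := hasSubst_of_X_dvd hb
  conv_lhs => rw [isLagrange_iff.mp hg]
  rw [subst_comp_subst_apply (hasSubst_of_X_dvd (dvd_mul_right X g)) hb', subst_mul hb',
    subst_X hb']

end PowerSeries

/-! ### Coproduct and antipode of the complete homogeneous symmetric functions -/

namespace SymFun

variable (R : Type*) [CommRing R]

/-- `∑ h_n t^n`. -/
def hSeries : PowerSeries (SymFun R) := PowerSeries.mk (h R)

/-- `∑ e_n (-t)^n`. -/
def eSeries : PowerSeries (SymFun R) := PowerSeries.mk fun n => (-1) ^ n * e R n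

/-- The antipode as a morphism of rings. -/
def antipodeRingHom : SymFun R →+* SymFun R := (antipodeHom R : SymFun R →+* SymFun R)

/-- The ring `Sym ⊗ Sym`. -/
def SymTensor : Type _ := SymFun R ⊗[R] SymFun R

instance : CommRing (SymTensor R) := inferInstanceAs (CommRing (SymFun R ⊗[R] SymFun R))

/-- The coproduct as a morphism of rings. -/
def comulRingHom : SymFun R →+* SymTensor R := (comulHom R : SymFun R →+* SymFun R ⊗[R] SymFun R)

/-- The morphism `f ↦ f ⊗ 1`. -/
def inlHom : SymFun R →+* SymTensor R :=
  ((Algebra.TensorProduct.includeLeft : SymFun R →ₐ[R] SymFun R ⊗[R] SymFun R) :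
    SymFun R →+* SymFun R ⊗[R] SymFun R)

/-- The morphism `f ↦ 1 ⊗ f`. -/
def inrHom : SymFun R →+* SymTensor R :=
  ((Algebra.TensorProduct.includeRight : SymFun R →ₐ[R] SymFun R ⊗[R] SymFun R) :
    SymFun R →+* SymFun R ⊗[R] SymFun R)

variable {R}

lemma neg_one_mul_neg_one : (-1 : SymFun R) * -1 = 1 := by ring

lemma inlHom_mul_inrHom (f g : SymFun R) : inlHom R f * inrHom R g = f ⊗ₜ[R] g := by
  change (f ⊗ₜ[R] (1 : SymFun R)) * ((1 : SymFun R) ⊗ₜ[R] g) = f ⊗ₜ[R] g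
  rw [Algebra.TensorProduct.tmul_mul_tmul, mul_one, one_mul]

lemma comulRingHom_e (n : ℕ) :
    comulRingHom R (e R n) = ∑ p ∈ antidiagonal n, inlHom R (e R p.1) * inrHom R (e R p.2) := by
  simp only [inlHom_mul_inrHom]
  exact comulHom_e n

lemma eSeries_mul_hSeries : eSeries R * hSeries R = 1 := by
  ext1 n
  rw [PowerSeries.coeff_mul, PowerSeries.coeff_one, ← sum_e_mul_h n]
  refine Finset.sum_congr rfl fun p _ => ?_
  rw [eSeries, hSeries, PowerSeries.coeff_mk, PowerSeries.coeff_mk, mul_assoc]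

section Convolution

variable {A : Type*} [CommRing A] {u v w : SymFun R →+* A}

lemma map_eSeries_eq_mul
    (H : ∀ n, w (e R n) = ∑ p ∈ antidiagonal n, u (e R p.1) * v (e R p.2)) :
    PowerSeries.map w (eSeries R) =
      PowerSeries.map u (eSeries R) * PowerSeries.map v (eSeries R) := by
  ext1 n
  rw [PowerSeries.coeff_mul, PowerSeries.coeff_map, eSeries, PowerSeries.coeff_mk, map_mul,
    map_pow, map_neg, map_one, H, Finset.mul_sum]
  refine Finset.sum_congr rfl fun p hp => ?_
  rw [HasAntidiagonal.mem_antidiagonal] at hp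
  rw [PowerSeries.coeff_map, PowerSeries.coeff_map, PowerSeries.coeff_mk, PowerSeries.coeff_mk,
    map_mul, map_mul, map_pow, map_pow, map_neg, map_neg, map_one, map_one, ← hp, pow_add]
  ring

/-- The hypothesis says that w agrees with the convolution product of u and v on the generators e_n.
It makes the image of E(-t) multiplicative, and H(t) is the inverse of E(-t). -/
lemma map_hSeries_eq_mul
    (H : ∀ n, w (e R n) = ∑ p ∈ antidiagonal n, u (e R p.1) * v (e R p.2)) :
    PowerSeries.map w (hSeries R) =
      PowerSeries.map u (hSeries R) * PowerSeries.map v (hSeries R) := by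
  have h1 := congrArg (PowerSeries.map w) (eSeries_mul_hSeries (R := R))
  have h2 := congrArg (PowerSeries.map u) (eSeries_mul_hSeries (R := R))
  have h3 := congrArg (PowerSeries.map v) (eSeries_mul_hSeries (R := R))
  rw [map_mul, map_one] at h1 h2 h3
  rw [map_eSeries_eq_mul H] at h1
  linear_combination (PowerSeries.map u (hSeries R) * PowerSeries.map v (hSeries R)) * h1 -
    (PowerSeries.map w (hSeries R) * PowerSeries.map v (eSeries R) *
      PowerSeries.map v (hSeries R)) * h2 - PowerSeries.map w (hSeries R) * h3

end Convolution

lemma map_antipode_eSeries : PowerSeries.map (antipodeRingHom R) (eSeries R) = hSeries R := by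
  ext1 n
  rw [PowerSeries.coeff_map, eSeries, hSeries, PowerSeries.coeff_mk, PowerSeries.coeff_mk,
    map_mul, map_pow, map_neg, map_one]
  change _ * antipodeHom R (e R n) = _
  rw [antipodeHom_e, ← mul_assoc, ← mul_pow, neg_one_mul_neg_one, one_pow, one_mul]

/-- Applying the antipode to E(-t) H(t) = 1 shows that the image of H is the inverse of the image of
E(-t), which is H. -/
lemma map_antipode_hSeries : PowerSeries.map (antipodeRingHom R) (hSeries R) = eSeries R := by
  have h1 := congrArg (PowerSeries.map (antipodeRingHom R)) (eSeries_mul_hSeries (R := R))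
  rw [map_mul, map_one, map_antipode_eSeries] at h1
  linear_combination eSeries R * h1 -
    PowerSeries.map (antipodeRingHom R) (hSeries R) * eSeries_mul_hSeries (R := R)

lemma antipodeHom_h (n : ℕ) : antipodeHom R (h R n) = (-1) ^ n * e R n := by
  have := congrArg (PowerSeries.coeff n) (map_antipode_hSeries (R := R))
  rwa [PowerSeries.coeff_map, hSeries, eSeries, PowerSeries.coeff_mk, PowerSeries.coeff_mk] at this

lemma comulRingHom_h (n : ℕ) :
    comulRingHom R (h R n) = ∑ p ∈ antidiagonal n, inlHom R (h R p.1) * inrHom R (h R p.2) := by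
  have := congrArg (PowerSeries.coeff n) (map_hSeries_eq_mul (R := R) comulRingHom_e)
  rw [PowerSeries.coeff_map, PowerSeries.coeff_mul] at this
  simpa only [hSeries, PowerSeries.coeff_map, PowerSeries.coeff_mk] using this

lemma comulHom_h (n : ℕ) :
    comulHom R (h R n) = ∑ p ∈ antidiagonal n, h R p.1 ⊗ₜ[R] h R p.2 := by
  have := comulRingHom_h (R := R) n
  simp only [inlHom_mul_inrHom] at this
  exact this

lemma antipodeHom_antipodeHom (f : SymFun R) : antipodeHom R (antipodeHom R f) = f := by
  have : (antipodeHom R).comp (antipodeHom R) = AlgHom.id R (SymFun R) := algHom_ext fun n => by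
    rw [AlgHom.comp_apply, antipodeHom_e, map_mul, map_pow, map_neg, map_one, antipodeHom_h,
      ← mul_assoc, ← mul_pow, neg_one_mul_neg_one, one_pow, one_mul]
    rfl
  exact DFunLike.congr_fun this f

variable (R) in
/-- The antipode of `Sym` is an automorphism, as `Sym` is commutative and cocommutative. -/
def antipodeEquiv : SymFun R ≃ₐc[R] SymFun R :=
  BialgEquiv.ofAlgEquiv
    (AlgEquiv.ofAlgHom (antipodeHom R) (antipodeHom R) (AlgHom.ext antipodeHom_antipodeHom)
      (AlgHom.ext antipodeHom_antipodeHom))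
    (AlgHom.ext fun f => HopfAlgebra.counit_antipode (R := R) f)
    (algHom_ext fun n => by
      change Algebra.TensorProduct.map (antipodeHom R) (antipodeHom R) (comulHom R (e R n)) =
        comulHom R (antipodeHom R (e R n))
      -- The signs become scalars of R, so that they can be moved across the tensor product.
      have hs : ∀ k, ((-1) ^ k * h R k : SymFun R) = (-1 : R) ^ k • h R k := fun k => by
        rw [Algebra.smul_def, map_pow, map_neg, map_one]
      rw [comulHom_e, antipodeHom_e, hs, map_smul, comulHom_h, map_sum, Finset.smul_sum]
      refine Finset.sum_congr rfl fun p hp => ?_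
      rw [HasAntidiagonal.mem_antidiagonal] at hp
      rw [Algebra.TensorProduct.map_tmul, antipodeHom_e, antipodeHom_e, ← hp, pow_add, hs, hs,
        TensorProduct.smul_tmul_smul])

variable (R) in
/-- The Lagrange series. -/
def lagrangeSeries : PowerSeries (SymFun R) := PowerSeries.mk (lagrange R)

lemma isLagrange_lagrangeSeries : (hSeries R).IsLagrange (lagrangeSeries R) := fun n => by
  simpa only [hSeries, lagrangeSeries, PowerSeries.coeff_mk] using lagrange_eq R n

end SymFun

end

noncomputable section

/-! ### Generating functions of trees weighted by their left and right branches -/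

/-- The sequence `1, f 0, f 1, …`. -/
def shiftOne {A : Type*} [One A] (f : ℕ → A) : ℕ → A
  | 0 => 1
  | k + 1 => f k

/-- The recursion of the generating functions of binary trees by number of nodes, where the left
and right branches of the root are extended upwards by `k` and `m` edges. -/
structure IsBranchSum {A : Type*} [CommRing A] (a b : ℕ → A) (S : ℕ → ℕ → ℕ → A) : Prop where
  -- A branch extended upwards by k edges that ends in the empty tree has k nodes, hence k - 1
  -- edges; for k = 0 there is no branch and the factor is 1.
  zero : ∀ k m, S 0 k m = shiftOne a k * shiftOne b m
  succ : ∀ n k m, S (n + 1) k m =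
    ∑ p ∈ antidiagonal n, S p.1 (k + 1) 0 * S p.2 0 (m + 1)

namespace PowerSeries

variable {A : Type*} [CommRing A]

/-- Unrolling gives F 0 = a 0 + b a 1 + b² a 2 + …. Since X divides b, N unrollings determine the
series modulo X^N. The substituted shifts of the sequence a satisfy the same recursion. -/
lemma eq_subst_of_recursion {a : ℕ → A} {b : PowerSeries A} (hb : X ∣ b)
    {F : ℕ → PowerSeries A} (hF : ∀ k, F k = C (a k) + b * F (k + 1)) :
    F 0 = (mk a).subst b := by
  have hb' := hasSubst_of_X_dvd hb
  have hG : ∀ k, (mk fun n => a (n + k)).subst b =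
      C (a k) + b * (mk fun n => a (n + (k + 1))).subst b := by
    intro k
    conv_lhs => rw [eq_X_mul_shift_add_const (mk fun n => a (n + k))]
    rw [subst_add hb', subst_mul hb', subst_X hb', add_comm]
    congr 1
    · rw [← coeff_zero_eq_constantCoeff_apply, coeff_mk, zero_add]
      exact subst_C (a := b) (a k)
    · simp only [coeff_mk, add_assoc, add_comm 1 k]
  have key : ∀ N k, X ^ N ∣ F k - (mk fun n => a (n + k)).subst b := by
    intro N
    induction N with
    | zero => simp
    | succ N ih =>
      intro k
      rw [hF k, hG k, add_sub_add_left_eq_sub, ← mul_sub, pow_succ']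
      exact mul_dvd_mul hb (ih (k + 1))
  ext n
  have := X_pow_dvd_iff.mp (key (n + 1) 0) n (Nat.lt_succ_self n)
  rwa [map_sub, sub_eq_zero] at this

end PowerSeries

namespace IsBranchSum

open PowerSeries

variable {A : Type*} [CommRing A] {a b : ℕ → A} {S : ℕ → ℕ → ℕ → A}

lemma swap (hS : IsBranchSum a b S) : IsBranchSum b a fun n k m => S n m k where
  zero k m := by rw [hS.zero, mul_comm]
  succ n k m := by
    rw [hS.succ, ← Finset.Nat.sum_antidiagonal_swap]
    exact Finset.sum_congr rfl fun p _ => mul_comm _ _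

lemma mk_eq (hS : IsBranchSum a b S) (k m : ℕ) : (PowerSeries.mk fun n => S n k m) =
    C (shiftOne a k * shiftOne b m) +
      X * (PowerSeries.mk fun n => S n 0 (m + 1)) * PowerSeries.mk fun n => S n (k + 1) 0 := by
  ext n
  cases n with
  | zero => simp [hS.zero]
  | succ n =>
    rw [map_add, mul_assoc, coeff_succ_X_mul, coeff_mk, hS.succ, coeff_C, if_neg n.succ_ne_zero,
      zero_add, mul_comm, coeff_mul]
    simp only [coeff_mk]

/-- The left branch of the root is followed one node at a time: either it ends, with weight a k, or
it has a further node, which contributes X and the generating function S · 0 1 of its right subtree.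
-/
lemma mk_one_zero (hS : IsBranchSum a b S) : (PowerSeries.mk fun n => S n 1 0) =
    (PowerSeries.mk a).subst (X * PowerSeries.mk fun n => S n 0 1) :=
  eq_subst_of_recursion (F := fun k => PowerSeries.mk fun n => S n (k + 1) 0)
    (dvd_mul_right X _) fun k => by
      refine (hS.mk_eq (k + 1) 0).trans ?_
      simp only [shiftOne, mul_one, zero_add]

lemma mk_succ (hS : IsBranchSum a b S) : (PowerSeries.mk fun n => S (n + 1) 0 0) =
    (PowerSeries.mk fun n => S n 1 0) * PowerSeries.mk fun n => S n 0 1 := by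
  ext n
  rw [coeff_mk, hS.succ, coeff_mul]
  simp only [coeff_mk, zero_add]

/-- Write F₁₀, F₀₁ for the two series and G = F₁₀ F₀₁. Then F₁₀ = a(X F₀₁) = s(X F₀₁ · a(X F₀₁)) =
s(X F₀₁ F₁₀) = s(X G). -/
lemma mk_one_zero_eq (hS : IsBranchSum a b S) {s : PowerSeries A}
    (ha : s.IsLagrange (PowerSeries.mk a)) : (PowerSeries.mk fun n => S n 1 0) =
      s.subst (X * PowerSeries.mk fun n => S (n + 1) 0 0) := by
  conv_lhs => rw [hS.mk_one_zero, ha.subst_eq (dvd_mul_right X _), ← hS.mk_one_zero, mul_assoc]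
  rw [hS.mk_succ, mul_comm (PowerSeries.mk fun n => S n 1 0)]

/-- The generating function of the nonempty trees is a Lagrange series. -/
lemma isLagrange (hS : IsBranchSum a b S) {s s' : PowerSeries A}
    (ha : s.IsLagrange (PowerSeries.mk a)) (hb : s'.IsLagrange (PowerSeries.mk b)) :
    (s * s').IsLagrange (PowerSeries.mk fun n => S (n + 1) 0 0) := by
  -- With G as above, (s s')(X G) = s(X G) s'(X G) = F₁₀ F₀₁ = G; the factor s' comes from the
  -- symmetric recursion.
  rw [isLagrange_iff, subst_mul (hasSubst_of_X_dvd (dvd_mul_right X _)), ← hS.mk_one_zero_eq ha,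
    ← hS.swap.mk_one_zero_eq hb, hS.mk_succ]

end IsBranchSum

/-- The product of the weights `f (e b)` of the left branches of a tree, where the branch of the
root is extended upwards by `k` edges; these form a branch with `k - 1` edges if the tree is
empty. -/
def leftWeight {A : Type*} [CommMonoid A] (f : ℕ → A) : ℕ → BinaryTree Unit → A
  | k, .nil => shiftOne f k
  | k, .node _ l r => leftWeight f (k + 1) l * leftWeight f 0 r

/-- The two recursions differ at the empty tree: there `leftWeight` closes an extended branch, while
`leftBranchesAux` records nothing. For left subtrees, where k is positive, the empty tree must be
singled out; right subtrees are visited with k = 0, where both conventions give 1. -/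
lemma leftWeight_eq {A : Type*} [CommMonoid A] (f : ℕ → A) (t : BinaryTree Unit) :
    (∀ k, leftWeight f k t = if t = .nil then shiftOne f k else
      ((leftBranchesAux k t).map f).prod) ∧
    leftWeight f 0 t = ((leftBranchesAux 0 t).map f).prod := by
  induction t with
  | nil => exact ⟨fun k => by rw [if_pos rfl, leftWeight], by
      rw [leftWeight, shiftOne, leftBranchesAux]; rfl⟩
  | node u l r hl hr =>
    have key : ∀ k, leftWeight f k (.node u l r) =
        ((leftBranchesAux k (.node u l r)).map f).prod := by
      intro k
      rw [leftWeight, hl.1, hr.2]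
      cases l with
      | nil => rw [if_pos rfl, shiftOne, leftBranchesAux, Multiset.map_cons, Multiset.prod_cons]
      | node u' l' r' =>
        rw [if_neg (by simp), ← Multiset.prod_add, ← Multiset.map_add]
        rfl
    exact ⟨fun k => by rw [key, if_neg (by simp)], key 0⟩

/-- The sum over the trees with `n` nodes of the weights of their left and right branches. -/
def treeSum {A : Type*} [CommRing A] (a b : ℕ → A) (n k m : ℕ) : A :=
  ∑ t ∈ BinaryTree.treesOfNumNodesEq n, leftWeight a k t * leftWeight b m (mirror t)

/-- At the root, the left subtree prolongs the left branch and starts new right branches, while the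
right subtree prolongs the right branch and starts new left branches. -/
lemma isBranchSum_treeSum {A : Type*} [CommRing A] (a b : ℕ → A) :
    IsBranchSum a b (treeSum a b) where
  zero k m := by
    rw [treeSum, BinaryTree.treesOfNumNodesEq_zero, Finset.sum_singleton, mirror, leftWeight,
      leftWeight]
  succ n k m := by
    rw [treeSum, BinaryTree.treesOfNumNodesEq_succ, Finset.sum_biUnion]
    · refine Finset.sum_congr rfl fun p _ => ?_
      rw [Finset.sum_map, Finset.sum_product, treeSum, treeSum, Finset.sum_mul_sum]
      refine Finset.sum_congr rfl fun l _ => Finset.sum_congr rfl fun r _ => ?_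
      change leftWeight a (k + 1) l * leftWeight a 0 r *
        (leftWeight b (m + 1) (mirror r) * leftWeight b 0 (mirror l)) = _
      ring
    · intro p _ q _ hpq
      rw [Function.onFun, Finset.disjoint_left]
      intro t ht ht'
      simp only [Finset.mem_map, Finset.mem_product, BinaryTree.mem_treesOfNumNodesEq] at ht ht'
      obtain ⟨x, ⟨hx1, hx2⟩, rfl⟩ := ht
      obtain ⟨y, ⟨hy1, hy2⟩, hxy⟩ := ht'
      have := BinaryTree.node.inj hxy
      exact hpq (Prod.ext (by rw [← hx1, ← hy1, this.2.1]) (by rw [← hx2, ← hy2, this.2.2]))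

lemma treeSum_zero_zero {A : Type*} [CommRing A] (a b : ℕ → A) (n : ℕ) :
    treeSum a b n 0 0 = ∑ t ∈ BinaryTree.treesOfNumNodesEq n,
      ((leftBranches t).map a).prod * ((rightBranches t).map b).prod :=
  Finset.sum_congr rfl fun t _ => by
    rw [(leftWeight_eq a t).2, (leftWeight_eq b _).2]
    rfl

/-- The coefficients of a product of Lagrange series, for any algebra with two morphisms from
`Sym` and their convolution product. -/
lemma IsBranchSum.map_lagrange {R A : Type*} [CommRing R] [CommRing A] {u v w : SymFun R →+* A}
    (H : ∀ n, w (SymFun.e R n) =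
      ∑ p ∈ antidiagonal n, u (SymFun.e R p.1) * v (SymFun.e R p.2))
    {S : ℕ → ℕ → ℕ → A}
    (hS : IsBranchSum (fun n => u (lagrange R n)) (fun n => v (lagrange R n)) S) (n : ℕ) :
    w (lagrange R n) = S (n + 1) 0 0 := by
  have h1 := hS.isLagrange (SymFun.isLagrange_lagrangeSeries.map u)
    (SymFun.isLagrange_lagrangeSeries.map v)
  rw [← SymFun.map_hSeries_eq_mul H] at h1
  -- Both series are Lagrange series of w(H) = u(H) v(H).
  have h2 := (SymFun.isLagrange_lagrangeSeries.map w).unique h1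
  simpa only [SymFun.lagrangeSeries, PowerSeries.coeff_map, PowerSeries.coeff_mk] using
    congrArg (PowerSeries.coeff n) h2

lemma map_lagrangeProd {R A : Type*} [CommRing R] [CommRing A] (u : SymFun R →+* A)
    (μ : Multiset ℕ) : u (lagrangeProd R μ) = (μ.map fun n => u (lagrange R n)).prod := by
  rw [lagrangeProd, map_multiset_prod, Multiset.map_map]
  rfl

/-- The morphisms f ↦ f ⊗ 1 and f ↦ 1 ⊗ f have Δ as their convolution product. -/
theorem comul_lagrange_eq_sum_trees (R : Type*) [CommRing R] (n : ℕ) :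
    Coalgebra.comul (R := R) (lagrange R n) =
      ∑ t ∈ BinaryTree.treesOfNumNodesEq (n + 1), lagrangeProd R (leftBranches t) ⊗ₜ[R]
        lagrangeProd R (rightBranches t) := by
  have := (isBranchSum_treeSum _ _).map_lagrange (R := R) SymFun.comulRingHom_e n
  simp only [treeSum_zero_zero, ← map_lagrangeProd, SymFun.inlHom_mul_inrHom] at this
  exact this

end

noncomputable section

/-! ### Decomposition of noncrossing partitions at the last element of the first block -/

namespace NC

/-- The block of the first element. -/
def firstBlock {n : ℕ} (s : Setoid (Fin n)) : Finset (Fin n) :=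
  open Classical in univ.filter fun x => ∃ z, (∀ y, z ≤ y) ∧ s z x

/-- The block of the last element. -/
def lastBlock {n : ℕ} (s : Setoid (Fin n)) : Finset (Fin n) :=
  open Classical in univ.filter fun x => ∃ z, (∀ y, y ≤ z) ∧ s z x

lemma mem_firstBlock {n : ℕ} {s : Setoid (Fin n)} {x : Fin n} :
    x ∈ firstBlock s ↔ ∃ z, (∀ y, z ≤ y) ∧ s z x := by simp [firstBlock]

lemma mem_lastBlock {n : ℕ} {s : Setoid (Fin n)} {x : Fin n} :
    x ∈ lastBlock s ↔ ∃ z, (∀ y, y ≤ z) ∧ s z x := by simp [lastBlock]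

lemma mem_blocks {n : ℕ} {s : Setoid (Fin n)} {B : Finset (Fin n)} :
    B ∈ blocks s ↔ ∃ x, block s x = B := by simp [blocks]

lemma firstBlock_eq {n : ℕ} {s : Setoid (Fin n)} {z : Fin n} (hz : ∀ y, z ≤ y) :
    firstBlock s = block s z := by
  ext x
  rw [mem_firstBlock, mem_block]
  exact ⟨fun ⟨z', hz', h⟩ => le_antisymm (hz' z) (hz z') ▸ h, fun h => ⟨z, hz, h⟩⟩

lemma lastBlock_eq {n : ℕ} {s : Setoid (Fin n)} {z : Fin n} (hz : ∀ y, y ≤ z) :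
    lastBlock s = block s z := by
  ext x
  rw [mem_lastBlock, mem_block]
  exact ⟨fun ⟨z', hz', h⟩ => le_antisymm (hz z') (hz' z) ▸ h, fun h => ⟨z, hz, h⟩⟩

lemma firstBlock_mem {n : ℕ} (s : Setoid (Fin n)) : firstBlock s = ∅ ∨ firstBlock s ∈ blocks s := by
  cases n with
  | zero => exact Or.inl (Finset.eq_empty_of_isEmpty _)
  | succ n => exact Or.inr (mem_blocks.mpr ⟨0, (firstBlock_eq Fin.zero_le).symm⟩)

lemma lastBlock_mem {n : ℕ} (s : Setoid (Fin n)) : lastBlock s = ∅ ∨ lastBlock s ∈ blocks s := by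
  cases n with
  | zero => exact Or.inl (Finset.eq_empty_of_isEmpty _)
  | succ n => exact Or.inr (mem_blocks.mpr ⟨Fin.last n, (lastBlock_eq Fin.le_last).symm⟩)

lemma block_eq_iff {n : ℕ} {s : Setoid (Fin n)} {x y : Fin n} : block s x = block s y ↔ s x y :=
  ⟨fun h => s.symm (mem_block.mp (h ▸ mem_block.mpr (s.refl x))), block_eq⟩

/-- The product over the blocks of the `f (|B| - 1)`, where `k` elements are added to the block
`p`. -/
def blockWeight {A : Type*} [CommMonoid A] (f : ℕ → A) {n : ℕ} (k : ℕ) (s : Setoid (Fin n))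
    (p : Finset (Fin n)) : A :=
  shiftOne f (p.card + k) * ∏ B ∈ (blocks s).erase p, f (B.card - 1)

/-- With k = 0, the factor `shiftOne f p.card` is f (|p| - 1) if p is a block, which restores the
erased factor, and 1 if p is empty. So the weight does not depend on p. -/
lemma blockWeight_zero {A : Type*} [CommMonoid A] (f : ℕ → A) {n : ℕ} (s : Setoid (Fin n))
    {p : Finset (Fin n)} (hp : p = ∅ ∨ p ∈ blocks s) :
    blockWeight f 0 s p = ∏ B ∈ blocks s, f (B.card - 1) := by
  rcases hp with rfl | hp
  · rw [blockWeight, Finset.erase_eq_of_notMem, Finset.card_empty, shiftOne, one_mul]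
    intro h
    obtain ⟨x, hx⟩ := mem_blocks.mp h
    exact (block_nonempty s x).ne_empty hx
  · rw [blockWeight, ← Finset.mul_prod_erase _ _ hp]
    congr 1
    obtain ⟨x, rfl⟩ := mem_blocks.mp hp
    obtain ⟨m, hm⟩ := Nat.exists_eq_succ_of_ne_zero (Finset.card_pos.mpr (block_nonempty s x)).ne'
    rw [hm, add_zero]
    rfl

/-- The partition `u` of a set is obtained from partitions `s` and `t` of subsets whose complement
is a point, by adding this point to the part `p` of `s`. -/
structure IsJoin {a b n : ℕ} (l : Fin a ↪ Fin n) (c : Fin n) (r : Fin b ↪ Fin n)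
    (s : Setoid (Fin a)) (p : Finset (Fin a)) (t : Setoid (Fin b)) (u : Setoid (Fin n)) :
    Prop where
  cases : ∀ z, (∃ x, z = l x) ∨ z = c ∨ ∃ y, z = r y
  left : ∀ x y, u (l x) (l y) ↔ s x y
  right : ∀ x y, u (r x) (r y) ↔ t x y
  center_left : ∀ x, u c (l x) ↔ x ∈ p
  center_right : ∀ y, ¬ u c (r y)
  left_right : ∀ x y, ¬ u (l x) (r y)

namespace IsJoin

variable {a b n : ℕ} {l : Fin a ↪ Fin n} {c : Fin n} {r : Fin b ↪ Fin n}
  {s : Setoid (Fin a)} {p : Finset (Fin a)} {t : Setoid (Fin b)} {u u' : Setoid (Fin n)}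

lemma unique (h : IsJoin l c r s p t u) (h' : IsJoin l c r s p t u') : u = u' := by
  ext x y
  rcases h.cases x with ⟨x, rfl⟩ | rfl | ⟨x, rfl⟩ <;>
    rcases h.cases y with ⟨y, rfl⟩ | rfl | ⟨y, rfl⟩
  · rw [h.left, h'.left]
  · rw [u.comm', u'.comm', h.center_left, h'.center_left]
  · exact iff_of_false (h.left_right _ _) (h'.left_right _ _)
  · rw [h.center_left, h'.center_left]
  · exact iff_of_true (u.refl _) (u'.refl _)
  · exact iff_of_false (h.center_right _) (h'.center_right _)
  · exact iff_of_false (fun k => h.left_right _ _ (u.symm k)) fun k => h'.left_right _ _ (u'.symm k)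
  · exact iff_of_false (fun k => h.center_right _ (u.symm k)) fun k => h'.center_right _ (u'.symm k)
  · rw [h.right, h'.right]

lemma ne_left (h : IsJoin l c r s p t u) {x : Fin a} (hx : x ∉ p) : block u (l x) ≠ block u c :=
  fun hh => hx ((h.center_left x).mp (u.symm (block_eq_iff.mp hh)))

lemma block_left (h : IsJoin l c r s p t u) {x : Fin a} (hx : x ∉ p) :
    block u (l x) = (block s x).map l := by
  ext z
  rw [mem_block, Finset.mem_map]
  constructor
  · intro hz
    rcases h.cases z with ⟨y, rfl⟩ | rfl | ⟨y, rfl⟩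
    · exact ⟨y, mem_block.mpr ((h.left _ _).mp hz), rfl⟩
    · exact absurd ((h.center_left x).mp (u.symm hz)) hx
    · exact absurd hz (h.left_right _ _)
  · rintro ⟨y, hy, rfl⟩
    exact (h.left _ _).mpr (mem_block.mp hy)

lemma block_right (h : IsJoin l c r s p t u) (x : Fin b) :
    block u (r x) = (block t x).map r := by
  ext z
  rw [mem_block, Finset.mem_map]
  constructor
  · intro hz
    rcases h.cases z with ⟨y, rfl⟩ | rfl | ⟨y, rfl⟩
    · exact absurd (u.symm hz) (h.left_right _ _)
    · exact absurd (u.symm hz) (h.center_right _)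
    · exact ⟨y, mem_block.mpr ((h.right _ _).mp hz), rfl⟩
  · rintro ⟨y, hy, rfl⟩
    exact (h.right _ _).mpr (mem_block.mp hy)

lemma block_center (h : IsJoin l c r s p t u) (hc : ∀ x, l x ≠ c) :
    block u c = Finset.cons c (p.map l) (by simpa using fun x _ => hc x) := by
  ext z
  rw [mem_block, Finset.mem_cons, Finset.mem_map]
  constructor
  · intro hz
    rcases h.cases z with ⟨y, rfl⟩ | rfl | ⟨y, rfl⟩
    · exact Or.inr ⟨y, (h.center_left y).mp hz, rfl⟩
    · exact Or.inl rfl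
    · exact absurd hz (h.center_right _)
  · rintro (rfl | ⟨y, hy, rfl⟩)
    · exact u.refl _
    · exact (h.center_left y).mpr hy

/-- The block of c is the only one affected by the join; every other block is a block of s disjoint
from p or a block of t. -/
lemma blocks_erase (h : IsJoin l c r s p t u) (hp : p = ∅ ∨ p ∈ blocks s) :
    (blocks u).erase (block u c) =
      ((blocks s).erase p).map (Finset.mapEmbedding l).toEmbedding ∪
        (blocks t).map (Finset.mapEmbedding r).toEmbedding := by
  have hpx : ∀ x, block s x ≠ p → x ∉ p := by
    rintro x hne hx
    rcases hp with rfl | hp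
    · exact absurd hx (Finset.notMem_empty x)
    · obtain ⟨y, rfl⟩ := mem_blocks.mp hp
      exact hne (block_eq (s.symm (mem_block.mp hx)))
  ext B
  simp only [Finset.mem_erase, Finset.mem_union, Finset.mem_map, mem_blocks,
    RelEmbedding.coe_toEmbedding, Finset.mapEmbedding_apply]
  constructor
  · rintro ⟨hne, z, rfl⟩
    rcases h.cases z with ⟨x, rfl⟩ | rfl | ⟨x, rfl⟩
    · have hx : x ∉ p := fun hx => hne (block_eq (u.symm ((h.center_left x).mpr hx)))
      exact Or.inl ⟨block s x, ⟨fun hh => hx (hh ▸ mem_block.mpr (s.refl x)), x, rfl⟩,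
        (h.block_left hx).symm⟩
    · exact absurd rfl hne
    · exact Or.inr ⟨block t x, ⟨x, rfl⟩, (h.block_right x).symm⟩
  · rintro (⟨_, ⟨hne, x, rfl⟩, rfl⟩ | ⟨_, ⟨x, rfl⟩, rfl⟩)
    · rw [← h.block_left (hpx x hne)]
      exact ⟨h.ne_left (hpx x hne), _, rfl⟩
    · rw [← h.block_right]
      exact ⟨fun hh => h.center_right x (u.symm (block_eq_iff.mp hh)), _, rfl⟩

/-- The block of c is p with one more element, so k additional elements on it amount to k + 1 on p.
The part q is arbitrary, since nothing is added to it. -/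
lemma blockWeight {A : Type*} [CommMonoid A] (f : ℕ → A) (k : ℕ) (h : IsJoin l c r s p t u)
    (hp : p = ∅ ∨ p ∈ blocks s) (hc : ∀ x, l x ≠ c) {q : Finset (Fin b)}
    (hq : q = ∅ ∨ q ∈ blocks t) :
    blockWeight f k u (block u c) = blockWeight f (k + 1) s p * blockWeight f 0 t q := by
  rw [blockWeight_zero f t hq, NC.blockWeight, NC.blockWeight, h.blocks_erase hp,
    Finset.prod_union, Finset.prod_map, Finset.prod_map, h.block_center hc, Finset.card_cons,
    Finset.card_map, mul_assoc]
  · simp [add_assoc, add_comm 1 k]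
  · rw [Finset.disjoint_left]
    intro B hB hB'
    simp only [Finset.mem_map, Finset.mem_erase, mem_blocks, RelEmbedding.coe_toEmbedding,
      Finset.mapEmbedding_apply] at hB hB'
    obtain ⟨_, ⟨-, x, rfl⟩, rfl⟩ := hB
    obtain ⟨_, ⟨y, rfl⟩, hxy⟩ := hB'
    have hx : l x ∈ (block t y).map r := hxy ▸ Finset.mem_map_of_mem l (mem_block.mpr (s.refl x))
    obtain ⟨z, -, hz⟩ := Finset.mem_map.mp hx
    exact h.left_right x z (hz ▸ u.refl _)

end IsJoin

/-! ### Construction of the join of two noncrossing partitions around a point. -/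

section Join

variable (i j : ℕ)

/-- The first `i` elements. -/
def leftEmb : Fin i ↪ Fin (i + 1 + j) :=
  ⟨fun x => ⟨x, by lia⟩, fun x y h => Fin.ext (Fin.mk.inj h)⟩

/-- The element after the first `i` elements. -/
def centerPt : Fin (i + 1 + j) := ⟨i, by lia⟩

/-- The last `j` elements. -/
def rightEmb : Fin j ↪ Fin (i + 1 + j) :=
  ⟨fun x => ⟨i + 1 + x, by lia⟩, fun x y h => Fin.ext (Nat.add_left_cancel (Fin.mk.inj h))⟩

variable {i j}

@[simp] lemma leftEmb_val (x : Fin i) : (leftEmb i j x).1 = x := rfl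
@[simp] lemma centerPt_val : (centerPt i j).1 = i := rfl
@[simp] lemma rightEmb_val (x : Fin j) : (rightEmb i j x).1 = i + 1 + x := rfl

lemma leftEmb_ne (x : Fin i) : leftEmb i j x ≠ centerPt i j := fun h => by
  have := congrArg Fin.val h
  simp at this
  lia

lemma rightEmb_ne (x : Fin j) : rightEmb i j x ≠ centerPt i j := fun h => by
  have := congrArg Fin.val h
  simp at this
  lia

lemma cases_emb (z : Fin (i + 1 + j)) :
    (∃ x, z = leftEmb i j x) ∨ z = centerPt i j ∨ ∃ y, z = rightEmb i j y := by
  rcases lt_trichotomy z.1 i with h | h | h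
  · exact Or.inl ⟨⟨z, h⟩, rfl⟩
  · exact Or.inr (Or.inl (Fin.ext h))
  · exact Or.inr (Or.inr ⟨⟨z - (i + 1), by lia⟩, Fin.ext (by simp; lia)⟩)

open Classical in
/-- Labels of the parts of a join. -/
def joinLabel (s : Setoid (Fin i)) (t : Setoid (Fin j)) (z : Fin (i + 1 + j)) :
    Option (Quotient s ⊕ Quotient t) :=
  -- The label `none` belongs to the block of the centre.
  if h : z.1 < i then
    if (⟨z, h⟩ : Fin i) ∈ firstBlock s then none else some (.inl (Quotient.mk s ⟨z, h⟩))
  else if h' : i < z.1 then some (.inr (Quotient.mk t ⟨z - (i + 1), by lia⟩)) else none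

open Classical in
lemma joinLabel_left (s : Setoid (Fin i)) (t : Setoid (Fin j)) (x : Fin i) :
    joinLabel s t (leftEmb i j x) =
      if x ∈ firstBlock s then none else some (.inl (Quotient.mk s x)) := by
  rw [joinLabel, dif_pos (show (leftEmb i j x).1 < i from x.2)]
  rfl

lemma joinLabel_center (s : Setoid (Fin i)) (t : Setoid (Fin j)) :
    joinLabel s t (centerPt i j) = none := by
  rw [joinLabel, dif_neg (by simp), dif_neg (by simp)]

lemma joinLabel_right (s : Setoid (Fin i)) (t : Setoid (Fin j)) (x : Fin j) :
    joinLabel s t (rightEmb i j x) = some (.inr (Quotient.mk t x)) := by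
  rw [joinLabel, dif_neg (by simp; lia), dif_pos (by simp; lia)]
  simp

lemma firstBlock_rel {n : ℕ} {s : Setoid (Fin n)} {x y : Fin n} (hx : x ∈ firstBlock s) :
    y ∈ firstBlock s ↔ s x y := by
  obtain ⟨z, hz, h⟩ := mem_firstBlock.mp hx
  rw [mem_firstBlock]
  constructor
  · rintro ⟨z', hz', h'⟩
    obtain rfl := le_antisymm (hz' z) (hz z')
    exact s.trans (s.symm h) h'
  · exact fun hxy => ⟨z, hz, s.trans h hxy⟩

lemma isJoin_joinLabel (s : Setoid (Fin i)) (t : Setoid (Fin j)) :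
    IsJoin (leftEmb i j) (centerPt i j) (rightEmb i j) s (firstBlock s) t
      (Setoid.ker (joinLabel s t)) where
  cases := cases_emb
  left x y := by
    rw [Setoid.ker_def, joinLabel_left, joinLabel_left]
    by_cases hx : x ∈ firstBlock s
    · rw [if_pos hx, ← firstBlock_rel hx]
      split_ifs with hy <;> simp [hy]
    · rw [if_neg hx]
      split_ifs with hy
      · simp only [false_iff]
        exact fun h => hx ((firstBlock_rel hy).mpr (s.symm h))
      · rw [Option.some.injEq, Sum.inl.injEq, Quotient.eq]
  right x y := by
    rw [Setoid.ker_def, joinLabel_right, joinLabel_right, Option.some.injEq, Sum.inr.injEq,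
      Quotient.eq]
  center_left x := by
    rw [Setoid.ker_def, joinLabel_left, joinLabel_center]
    split_ifs with hx <;> simp [hx]
  center_right y := by
    rw [Setoid.ker_def, joinLabel_right, joinLabel_center]
    simp
  left_right x y := by
    rw [Setoid.ker_def, joinLabel_left, joinLabel_right]
    split_ifs with hx <;> simp

variable {s : Setoid (Fin i)} {t : Setoid (Fin j)} {u : Setoid (Fin (i + 1 + j))}

/-- A crossing inside one part is excluded by that part, and no block meets both parts. What remains
is a crossing whose largest element is the centre. -/
lemma IsJoin.isNoncrossing (hs : IsNoncrossing s) (ht : IsNoncrossing t)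
    (h : IsJoin (leftEmb i j) (centerPt i j) (rightEmb i j) s (firstBlock s) t u) :
    IsNoncrossing u := by
  intro x y z w hxy hyz hzw hxz hyw
  rcases h.cases x with ⟨x, rfl⟩ | rfl | ⟨x, rfl⟩
  · rcases h.cases y with ⟨y, rfl⟩ | rfl | ⟨y, rfl⟩
    · rw [h.left]
      rcases h.cases z with ⟨z, rfl⟩ | rfl | ⟨z, rfl⟩
      · rw [h.left] at hxz
        rcases h.cases w with ⟨w, rfl⟩ | rfl | ⟨w, rfl⟩
        · rw [h.left] at hyw
          exact hs x y z w hxy hyz hzw hxz hyw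
        -- The centre is replaced by the first element o, which lies in the block of y: unless o =
        -- x, the points o < x < y < z would cross in s.
        · obtain ⟨o, ho, hoy⟩ := mem_firstBlock.mp ((h.center_left y).mp (u.symm hyw))
          rcases (ho x).eq_or_lt with rfl | hlt
          · exact hoy
          · exact s.trans (s.symm (hs o x y z hlt hxy hyz hoy hxz)) hoy
        · exact absurd hyw (h.left_right _ _)
      · rcases h.cases w with ⟨w, rfl⟩ | rfl | ⟨w, rfl⟩
        · have := w.2
          simp [Fin.lt_def] at hzw
          lia
        · exact absurd hzw (lt_irrefl _)
        · exact absurd hyw (h.left_right _ _)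
      · exact absurd hxz (h.left_right _ _)
    · rcases h.cases z with ⟨z, rfl⟩ | rfl | ⟨z, rfl⟩
      · have := z.2
        simp [Fin.lt_def] at hyz
        lia
      · exact absurd hyz (lt_irrefl _)
      · exact absurd hxz (h.left_right _ _)
    · rcases h.cases z with ⟨z, rfl⟩ | rfl | ⟨z, rfl⟩
      · have := z.2
        simp [Fin.lt_def] at hyz
        lia
      · simp [Fin.lt_def] at hyz
        lia
      · exact absurd hxz (h.left_right _ _)
  · rcases h.cases z with ⟨z, rfl⟩ | rfl | ⟨z, rfl⟩
    · have := z.2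
      simp [Fin.lt_def] at hxy hyz
      lia
    · exact absurd (hxy.trans hyz) (lt_irrefl _)
    · exact absurd hxz (h.center_right _)
  · rcases h.cases y with ⟨y, rfl⟩ | rfl | ⟨y, rfl⟩
    · have := y.2
      simp [Fin.lt_def] at hxy
      lia
    · simp [Fin.lt_def] at hxy
      lia
    · rcases h.cases z with ⟨z, rfl⟩ | rfl | ⟨z, rfl⟩
      · have := z.2
        simp [Fin.lt_def] at hyz
        lia
      · simp [Fin.lt_def] at hyz
        lia
      · rcases h.cases w with ⟨w, rfl⟩ | rfl | ⟨w, rfl⟩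
        · have := w.2
          simp [Fin.lt_def] at hzw
          lia
        · simp [Fin.lt_def] at hzw
          lia
        · rw [h.right] at hxz hyw ⊢
          simp only [Fin.lt_def, rightEmb_val] at hxy hyz hzw
          exact ht x y z w (by rw [Fin.lt_def]; lia) (by rw [Fin.lt_def]; lia)
            (by rw [Fin.lt_def]; lia) hxz hyw

/-- The noncrossing partition obtained from `π` and `σ` by adding a point between them to the
first block of `π`. -/
def join (π : NC i) (σ : NC j) : NC (i + 1 + j) :=
  ⟨Setoid.ker (joinLabel π.1 σ.1), (isJoin_joinLabel π.1 σ.1).isNoncrossing π.2 σ.2⟩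

lemma isJoin_join (π : NC i) (σ : NC j) :
    IsJoin (leftEmb i j) (centerPt i j) (rightEmb i j) π.1 (firstBlock π.1) σ.1 (join π σ).1 :=
  isJoin_joinLabel π.1 σ.1

end Join

end NC

end

/-! ### Kreweras complements of joins, and the recursion for noncrossing partitions. -/

noncomputable section

namespace NC

variable {i j : ℕ} {s : Setoid (Fin i)} {t : Setoid (Fin j)} {u : Setoid (Fin (i + 1 + j))}

/-- The Kreweras complement of a join is a join, in which the point is added to the last block of
the complement of the right part. -/
lemma IsJoin.kreweras (hs : IsNoncrossing s) (ht : IsNoncrossing t)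
    (h : IsJoin (leftEmb i j) (centerPt i j) (rightEmb i j) s (firstBlock s) t u) :
    IsJoin (rightEmb i j) (centerPt i j) (leftEmb i j) (krewerasSetoid t)
      (lastBlock (krewerasSetoid t)) (krewerasSetoid s) (krewerasSetoid u) := by
  have hu := h.isNoncrossing hs ht
  have hll : ∀ x y, leftEmb i j x ≤ leftEmb i j y ↔ x ≤ y := fun x y => Iff.rfl
  have hrr : ∀ x y, rightEmb i j x ≤ rightEmb i j y ↔ x ≤ y := fun x y => by
    rw [Fin.le_def, Fin.le_def, rightEmb_val, rightEmb_val]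
    lia
  have hlc : ∀ x, leftEmb i j x ≤ centerPt i j := fun x => x.2.le
  have hcl : ∀ x, ¬ centerPt i j ≤ leftEmb i j x := fun x => not_le.mpr x.2
  have hcr : ∀ x, centerPt i j ≤ rightEmb i j x := fun x => by simp [Fin.le_def]; lia
  have hrc : ∀ x, ¬ rightEmb i j x ≤ centerPt i j := fun x => by simp [Fin.le_def]; lia
  have hlr : ∀ x y, leftEmb i j x ≤ rightEmb i j y := fun x y => (hlc x).trans (hcr y)
  have hrl : ∀ x y, ¬ rightEmb i j x ≤ leftEmb i j y := fun x y hh => hrc x (hh.trans (hlc y))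
  -- a relation of `u` involves two elements of the left part and the center, or of the right part
  have hcl' : ∀ x : Fin i, ∃ o, (∀ y, o ≤ y) ∧ u (centerPt i j) (leftEmb i j o) := by
    intro x
    have ho : ∀ y, (⟨0, x.1.zero_le.trans_lt x.2⟩ : Fin i) ≤ y := fun y => Nat.zero_le _
    exact ⟨_, ho, (h.center_left _).mpr (mem_firstBlock.mpr ⟨_, ho, s.refl _⟩)⟩
  -- The related pair formed by the centre and the first left element violates `KRel`: the centre
  -- lies between the two cuts, and the first element lies below both.
  have hsep : ∀ (x : Fin i) (z : Fin (i + 1 + j)), centerPt i j ≤ z →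
      (∀ y, leftEmb i j y ≤ z) → ¬ krewerasSetoid u (leftEmb i j x) z := by
    intro x z hz hz' hk
    obtain ⟨o, ho, hco⟩ := hcl' x
    have := (krewerasSetoid_iff hu _ _).mp hk _ _ hco
    simp only [hcl, hz, hll, ho, hz', iff_true] at this
  have hright : ∀ x y, krewerasSetoid u (rightEmb i j x) (rightEmb i j y) ↔
      krewerasSetoid t x y := by
    intro x y
    rw [krewerasSetoid_iff hu, krewerasSetoid_iff ht]
    constructor
    · intro hk v w hvw
      have := hk _ _ ((h.right v w).mpr hvw)
      simpa only [hrr] using this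
    · intro hk v w hvw
      -- A block outside the right part lies below both cuts, so only the blocks of t impose
      -- conditions.
      rcases h.cases v with ⟨v, rfl⟩ | rfl | ⟨v, rfl⟩ <;>
        rcases h.cases w with ⟨w, rfl⟩ | rfl | ⟨w, rfl⟩
      · simp only [hlr]
      · simp only [hlr, hcr]
      · exact absurd hvw (h.left_right _ _)
      · simp only [hlr, hcr]
      · simp only [hcr]
      · exact absurd hvw (h.center_right _)
      · exact absurd (u.symm hvw) (h.left_right _ _)
      · exact absurd (u.symm hvw) (h.center_right _)
      · simpa only [hrr] using hk v w ((h.right v w).mp hvw)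
  constructor
  · intro z
    rcases h.cases z with hz | hz | hz
    exacts [Or.inr (Or.inr hz), Or.inr (Or.inl hz), Or.inl hz]
  · exact hright
  · intro x y
    rw [krewerasSetoid_iff hu, krewerasSetoid_iff hs]
    constructor
    · intro hk v w hvw
      have := hk _ _ ((h.left v w).mpr hvw)
      simpa only [hll] using this
    · intro hk v w hvw
      -- Adding the centre to the first block of s imposes no new condition: the centre is above
      -- both cuts, and this block already contains the first element, which is below both and so
      -- forces all of the block to one side.
      have hfirst : ∀ w ∈ firstBlock s, (w ≤ x ↔ w ≤ y) := by
        intro w hw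
        obtain ⟨o, ho, how⟩ := mem_firstBlock.mp hw
        have := hk o w how
        simpa only [ho, true_iff] using this
      rcases h.cases v with ⟨v, rfl⟩ | rfl | ⟨v, rfl⟩ <;>
        rcases h.cases w with ⟨w, rfl⟩ | rfl | ⟨w, rfl⟩
      · simpa only [hll] using hk v w ((h.left v w).mp hvw)
      · have := hfirst v ((h.center_left v).mp (u.symm hvw))
        simp only [hll, hcl, this]
      · exact absurd hvw (h.left_right _ _)
      · have := hfirst w ((h.center_left w).mp hvw)
        simp only [hll, hcl, this]
      · simp only [hcl]
      · exact absurd hvw (h.center_right _)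
      · exact absurd (u.symm hvw) (h.left_right _ _)
      · exact absurd (u.symm hvw) (h.center_right _)
      · simp only [hrl]
  · intro y
    have hj : ∀ w, w ≤ (⟨j - 1, by have := y.2; lia⟩ : Fin j) := fun w => by
      have := w.2
      rw [Fin.le_def]
      exact Nat.le_sub_one_of_lt this
    generalize (⟨j - 1, by have := y.2; lia⟩ : Fin j) = z at hj
    rw [lastBlock_eq hj, mem_block, ← hright]
    -- The elements after the centre, up to the last one z, are exactly the right part, which is a
    -- union of blocks of u.
    have hcz : krewerasSetoid u (centerPt i j) (rightEmb i j z) := by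
      rw [krewerasSetoid_iff hu]
      intro v w hvw
      rcases h.cases v with ⟨v, rfl⟩ | rfl | ⟨v, rfl⟩ <;>
        rcases h.cases w with ⟨w, rfl⟩ | rfl | ⟨w, rfl⟩
      · simp only [hlr, hlc]
      · simp only [hlr, hlc, hcr, le_refl]
      · exact absurd hvw (h.left_right _ _)
      · simp only [hlr, hlc, hcr, le_refl]
      · simp only [hcr, le_refl]
      · exact absurd hvw (h.center_right _)
      · exact absurd (u.symm hvw) (h.left_right _ _)
      · exact absurd (u.symm hvw) (h.center_right _)
      · simp only [hrr, hj, hrc]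
    exact ⟨fun hk => (krewerasSetoid u).trans ((krewerasSetoid u).symm hcz) hk,
      fun hk => (krewerasSetoid u).trans hcz hk⟩
  · exact fun x hk => hsep x _ le_rfl hlc ((krewerasSetoid u).symm hk)
  · exact fun y x hk => hsep x _ (hcr y) (fun z => hlr z y) ((krewerasSetoid u).symm hk)

variable {A : Type*} [CommRing A] (a b : ℕ → A)

/-- The weight of a noncrossing partition and its complement, where `k` elements are added to the
first block of the partition and `m` to the last block of the complement. -/
def weight {n : ℕ} (k m : ℕ) (π : NC n) : A :=
  blockWeight a k π.1 (firstBlock π.1) *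
    blockWeight b m (kreweras π).1 (lastBlock (kreweras π).1)

/-- For i = 0 the centre is itself the first element; otherwise the first element is on the left and
is joined to the centre. -/
lemma firstBlock_join (π : NC i) (σ : NC j) :
    firstBlock (join π σ).1 = block (join π σ).1 (centerPt i j) := by
  have h := isJoin_join π σ
  cases i with
  | zero => exact firstBlock_eq fun y => Nat.zero_le _
  | succ i =>
    rw [firstBlock_eq (z := leftEmb (i + 1) j 0) fun y => Nat.zero_le _]
    refine block_eq ((join π σ).1.symm ((h.center_left 0).mpr ?_))
    exact mem_firstBlock.mpr ⟨0, Fin.zero_le, π.1.refl _⟩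

lemma lastBlock_kreweras_join (π : NC i) (σ : NC j) :
    lastBlock (kreweras (join π σ)).1 = block (kreweras (join π σ)).1 (centerPt i j) := by
  have h := (isJoin_join π σ).kreweras π.2 σ.2
  cases j with
  | zero => exact lastBlock_eq fun y => Nat.le_of_lt_succ y.2
  | succ j =>
    rw [lastBlock_eq (z := rightEmb i (j + 1) (Fin.last j)) fun y => by
      have := y.2
      simp [Fin.le_def]
      lia]
    refine block_eq ((kreweras (join π σ)).1.symm ((h.center_left (Fin.last j)).mpr ?_))
    exact mem_lastBlock.mpr ⟨_, Fin.le_last, (krewerasSetoid σ.1).refl _⟩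

/-- The centre enlarges the first block of π, and in the complement the last block of K(σ). So k
grows on π and m grows on σ, as for the two subtrees of a root. -/
lemma weight_join (k m : ℕ) (π : NC i) (σ : NC j) :
    weight a b k m (join π σ) = weight a b (k + 1) 0 π * weight a b 0 (m + 1) σ := by
  have h := isJoin_join π σ
  have h1 := h.blockWeight a k (firstBlock_mem π.1) leftEmb_ne (firstBlock_mem σ.1)
  have h2 := (h.kreweras π.2 σ.2).blockWeight b m (lastBlock_mem _) rightEmb_ne
    (lastBlock_mem (krewerasSetoid π.1))
  rw [← firstBlock_join] at h1
  have h3 := lastBlock_kreweras_join π σ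
  change lastBlock (krewerasSetoid (join π σ).1) = _ at h3
  rw [show krewerasSetoid (join π σ).1 = (kreweras (join π σ)).1 from rfl, ← h3] at h2
  rw [weight, h1]
  refine (congrArg _ h2).trans ?_
  rw [weight, weight]
  change _ * _ * (blockWeight b (m + 1) (kreweras σ).1 (lastBlock (kreweras σ).1) *
    blockWeight b 0 (kreweras π).1 (lastBlock (kreweras π).1)) = _
  ring

/-- The last element of the first block. -/
def top {n : ℕ} (π : NC (n + 1)) : Fin (n + 1) :=
  (firstBlock π.1).max' ⟨0, mem_firstBlock.mpr ⟨0, Fin.zero_le, π.1.refl _⟩⟩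

/-- Conversely to `isJoin_join`, a partition is a join around the last element of its first block.
-/
lemma rel_of_firstBlock_max {π : NC (i + 1 + j)}
    (hc : centerPt i j ∈ firstBlock π.1) (hmax : ∀ z ∈ firstBlock π.1, z ≤ centerPt i j) :
    IsJoin (leftEmb i j) (centerPt i j) (rightEmb i j) (π.1.comap (leftEmb i j))
      (firstBlock (π.1.comap (leftEmb i j))) (π.1.comap (rightEmb i j)) π.1 := by
  have hcr : ∀ y, ¬ π.1 (centerPt i j) (rightEmb i j y) := by
    intro y hy
    have := hmax _ ((firstBlock_rel hc).mpr hy)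
    simp [Fin.le_def] at this
    lia
  obtain ⟨o, ho, hoc⟩ := mem_firstBlock.mp hc
  have ho0 : o.1 = 0 := Nat.le_zero.mp (ho ⟨0, by lia⟩)
  refine ⟨cases_emb, fun _ _ => Iff.rfl, fun _ _ => Iff.rfl, fun x => ?_, hcr, fun x y hxy => ?_⟩
  · have hx : ∀ y, (⟨0, by have := x.2; lia⟩ : Fin i) ≤ y := fun y => Nat.zero_le _
    have hox : o = leftEmb i j ⟨0, by have := x.2; lia⟩ := Fin.ext ho0
    rw [firstBlock_eq hx, mem_block]
    change _ ↔ π.1 (leftEmb i j _) (leftEmb i j x)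
    rw [← hox]
    exact ⟨fun h => π.1.trans hoc h, fun h => π.1.trans (π.1.symm hoc) h⟩
  · rcases (ho (leftEmb i j x)).eq_or_lt with rfl | hlt
    · exact hcr y (π.1.trans (π.1.symm hoc) hxy)
    -- The first element and the centre are in one block, so a block meeting both sides of the
    -- centre would cross it.
    · have h1 := π.2 o (leftEmb i j x) (centerPt i j) (rightEmb i j y) hlt x.2
        (by simp [Fin.lt_def]; lia) hoc hxy
      exact hcr y (π.1.trans (π.1.symm hoc) (π.1.trans h1 hxy))

open Classical in
-- Partitions whose first block ends at c correspond to pairs of partitions of the two sides of c,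
-- by restriction and `join`.
lemma sum_weight_of_top {n : ℕ} (k m : ℕ) (c : Fin (n + 1)) :
    ∑ π : NC (n + 1) with top π = c, weight a b k m π =
      (∑ π : NC c, weight a b (k + 1) 0 π) * ∑ σ : NC (n - c), weight a b 0 (m + 1) σ := by
  obtain ⟨i, hi⟩ := c
  obtain ⟨j, rfl⟩ := Nat.exists_eq_add_of_le (Nat.lt_succ_iff.mp hi)
  -- The size is a variable N because i + j + 1 and i + 1 + j are not definitionally equal.
  have key : ∀ (N : ℕ) (hN : N = i + 1 + j) (c : Fin N), c.1 = i →
      ∑ π : NC N with c ∈ firstBlock π.1 ∧ ∀ z ∈ firstBlock π.1, z ≤ c, weight a b k m π =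
      (∑ π : NC i, weight a b (k + 1) 0 π) * ∑ σ : NC j, weight a b 0 (m + 1) σ := by
    rintro N rfl c hc
    obtain rfl : c = centerPt i j := Fin.ext hc
    rw [Finset.sum_mul_sum, ← Finset.sum_product']
    symm
    refine Finset.sum_nbij (fun p => join p.1 p.2) ?_ ?_ ?_ ?_
    · rintro ⟨π, σ⟩ -
      have h := isJoin_join π σ
      rw [Finset.mem_filter]
      simp only [firstBlock_join, mem_block]
      refine ⟨Finset.mem_univ _, (join π σ).1.refl _, fun z hz => ?_⟩
      rcases h.cases z with ⟨z, rfl⟩ | rfl | ⟨z, rfl⟩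
      · exact z.2.le
      · exact le_rfl
      · exact absurd hz (h.center_right z)
    · rintro ⟨π, σ⟩ - ⟨π', σ'⟩ - heq
      have h := isJoin_join π σ
      have h' := isJoin_join π' σ'
      simp only at heq
      rw [heq] at h
      refine Prod.ext (Subtype.ext (Setoid.ext fun x y => ?_))
        (Subtype.ext (Setoid.ext fun x y => ?_))
      · exact (h.left x y).symm.trans (h'.left x y)
      · exact (h.right x y).symm.trans (h'.right x y)
    · intro π hπ
      simp only [Finset.coe_filter, Set.mem_ofPred_eq] at hπ
      have hj := rel_of_firstBlock_max hπ.2.1 hπ.2.2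
      refine ⟨(⟨π.1.comap (leftEmb i j), fun x y z w hxy hyz hzw hxz hyw =>
        π.2 _ _ _ _ hxy hyz hzw hxz hyw⟩, ⟨π.1.comap (rightEmb i j),
        fun x y z w hxy hyz hzw hxz hyw => π.2 (rightEmb i j x) (rightEmb i j y)
          (rightEmb i j z) (rightEmb i j w) (Nat.add_lt_add_left hxy _)
          (Nat.add_lt_add_left hyz _) (Nat.add_lt_add_left hzw _) hxz hyw⟩), by simp, ?_⟩
      exact Subtype.ext ((isJoin_join _ _).unique hj)
    · rintro ⟨π, σ⟩ -
      exact (weight_join a b k m π σ).symm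
  have h1 := key (i + j + 1) (by lia) ⟨i, hi⟩ rfl
  change _ = (∑ π : NC i, weight a b (k + 1) 0 π) *
    ∑ σ : NC (i + j - i), weight a b 0 (m + 1) σ
  rw [Nat.add_sub_cancel_left, ← h1]
  refine Finset.sum_congr (Finset.filter_congr fun π _ => ?_) fun _ _ => rfl
  exact Finset.max'_eq_iff _ _ _

/-- The sum of the weights of the noncrossing partitions. -/
def weightSum (n k m : ℕ) : A := ∑ π : NC n, weight a b k m π

lemma isBranchSum_weightSum : IsBranchSum a b (weightSum a b) where
  zero k m := by
    have hsub : ∀ s s' : Setoid (Fin 0), s = s' := fun s s' => Setoid.ext fun x => x.elim0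
    have hw : ∀ (f : ℕ → A) (k : ℕ) (s : Setoid (Fin 0)) (p : Finset (Fin 0)),
        blockWeight f k s p = shiftOne f k := by
      intro f k s p
      have hp : p = ∅ := Finset.eq_empty_of_isEmpty p
      have hb : blocks s = ∅ := Finset.image_eq_empty.mpr (Finset.eq_empty_of_isEmpty _)
      rw [blockWeight, hb, hp]
      simp
    rw [weightSum, Finset.sum_eq_single (⊥ : NC 0) (fun π _ h => absurd (Subtype.ext (hsub _ _)) h)
      (fun h => absurd (Finset.mem_univ _) h), weight, hw, hw]
  succ n k m := by
    classical
    rw [weightSum, ← Finset.sum_fiberwise univ (fun π : NC (n + 1) => top π),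
      Finset.Nat.sum_antidiagonal_eq_sum_range_succ_mk, Finset.sum_range]
    exact Finset.sum_congr rfl fun c _ => sum_weight_of_top a b k m c

/-- Singleton blocks are discarded in the reduced type; they contribute f 0 = 1. -/
lemma prod_reducedType {M : Type*} [CommMonoid M] (f : ℕ → M) (hf : f 0 = 1) {n : ℕ} (π : NC n) :
    ((reducedType π).map f).prod = ∏ B ∈ blocks π.1, f (B.card - 1) := by
  have key : ∀ m : Multiset ℕ, ((m.filter fun x => x ≠ 0).map f).prod = (m.map f).prod := by
    intro m
    induction m using Multiset.induction with
    | empty => rfl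
    | cons x m ih =>
      by_cases hx : x = 0
      · rw [Multiset.filter_cons_of_neg (p := fun x => x ≠ 0) _ (by simpa using hx), ih, Multiset.map_cons,
          Multiset.prod_cons, hx, hf, one_mul]
      · rw [Multiset.filter_cons_of_pos (p := fun x => x ≠ 0) _ hx, Multiset.map_cons, Multiset.prod_cons, ih,
          Multiset.map_cons, Multiset.prod_cons]
  rw [reducedType, key, Multiset.map_map]
  rfl

variable {a b} in
lemma weightSum_zero_zero (ha : a 0 = 1) (hb : b 0 = 1) (n : ℕ) :
    weightSum a b n 0 0 = ∑ π : NC n, ((reducedType π).map a).prod *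
      ((reducedType (kreweras π)).map b).prod :=
  Finset.sum_congr rfl fun π _ => by
    rw [prod_reducedType a ha, prod_reducedType b hb, weight,
      blockWeight_zero _ _ (firstBlock_mem _), blockWeight_zero _ _ (lastBlock_mem _)]

end NC

lemma lagrange_zero (R : Type*) [CommRing R] : lagrange R 0 = 1 := by rw [lagrange]

theorem comul_lagrange_eq_sum_noncrossing (R : Type*) [CommRing R] (n : ℕ) :
    Coalgebra.comul (R := R) (lagrange R n) =
      ∑ π : NC (n + 1), lagrangeProd R (NC.reducedType π) ⊗ₜ[R]
        lagrangeProd R (NC.reducedType (NC.kreweras π)) := by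
  have := (NC.isBranchSum_weightSum _ _).map_lagrange (R := R) SymFun.comulRingHom_e n
  rw [NC.weightSum_zero_zero (by rw [lagrange_zero, map_one]) (by rw [lagrange_zero, map_one])]
    at this
  simp only [← map_lagrangeProd, SymFun.inlHom_mul_inrHom] at this
  exact this

end

noncomputable section

/-! ### The intervals of the lattices of noncrossing partitions -/

namespace NC

variable {n : ℕ}

/-- If x < y are in one block, `next` moves x upwards without passing y, so iteration reaches y by
induction on the distance. -/
lemma sameCycle_toPerm_iff {s : Setoid (Fin n)} {x y : Fin n} :
    (toPerm s).SameCycle x y ↔ s x y := by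
  constructor
  · intro h
    obtain ⟨m, -, rfl⟩ := Equiv.Perm.SameCycle.exists_pow_eq' h
    clear h
    induction m with
    | zero => exact s.refl x
    | succ m ih =>
      rw [pow_succ', Equiv.Perm.mul_apply, toPerm_apply]
      exact s.trans ih (rel_next s _)
  · have key : ∀ (d : ℕ) (x y : Fin n), y.1 = x.1 + d → s x y → (toPerm s).SameCycle x y := by
      intro d
      induction d using Nat.strong_induction_on with
      | _ d ih =>
        intro x y hd hxy
        rcases Nat.eq_zero_or_pos d with rfl | hpos
        · rw [Fin.ext (hd.trans (add_zero _))]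
        have hlt : x < y := by rw [Fin.lt_def]; lia
        have hn := rel_next s x
        rcases next_cases s x with ⟨h1, h2⟩ | ⟨h1, -⟩
        · have h3 := h2 y hxy hlt
          rw [Fin.lt_def] at h1
          rw [Fin.le_def] at h3
          have h4 := ih (y.1 - (next s x).1) (by lia) (next s x) y (by lia)
            (s.trans (s.symm hn) hxy)
          exact Equiv.Perm.SameCycle.trans ⟨1, by rw [zpow_one]; rfl⟩ h4
        · exact absurd hlt (not_lt.mpr (h1 y hxy))
    intro hxy
    rcases le_total x y with h | h
    · exact key (y.1 - x.1) x y (by rw [Fin.le_def] at h; lia) hxy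
    · exact (key (x.1 - y.1) y x (by rw [Fin.le_def] at h; lia) (s.symm hxy)).symm

lemma kreweras_injective : Function.Injective (kreweras : NC n → NC n) := by
  intro π σ h
  have h1 : toPerm π.1 = toPerm σ.1 := by
    have := toPerm_kreweras π
    rw [h, toPerm_kreweras σ] at this
    exact inv_injective (mul_right_cancel this).symm
  refine Subtype.ext (Setoid.ext fun x y => ?_)
  rw [← sameCycle_toPerm_iff, h1, sameCycle_toPerm_iff]

/-- `KRel` imposes one condition for each related pair, so a coarser partition has a finer
complement. -/
lemma kreweras_anti {π σ : NC n} (h : π ≤ σ) : kreweras σ ≤ kreweras π := by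
  intro x y hxy
  change krewerasSetoid π.1 x y
  rw [krewerasSetoid_iff π.2]
  intro z w hzw
  exact (krewerasSetoid_iff σ.2 x y).mp hxy z w (h hzw)

/-- A bijection of a finite set has finite order, so its inverse is one of its iterates and hence
monotone. -/
lemma le_of_map_le_of_finite {α : Type*} [PartialOrder α] [Finite α] {f : α → α}
    (hf : Monotone f) (hinj : Function.Injective f) {x y : α} (h : f x ≤ f y) : x ≤ y := by
  let e : Equiv.Perm α := Equiv.ofBijective f (Finite.injective_iff_bijective.mp hinj)
  have hpos := orderOf_pos e
  have he : ∀ z, f^[orderOf e - 1] (f z) = z := by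
    intro z
    rw [← Function.iterate_succ_apply, Nat.succ_eq_add_one, Nat.sub_add_cancel hpos]
    have h1 := DFunLike.congr_fun (pow_orderOf_eq_one e) z
    rwa [← Equiv.Perm.iterate_eq_pow] at h1
  rw [← he x, ← he y]
  exact hf.iterate _ h

/-- The square of K is monotone and injective on a finite poset, hence reflects the order. -/
lemma kreweras_le_iff {π σ : NC n} : kreweras π ≤ kreweras σ ↔ σ ≤ π := by
  refine ⟨fun h => ?_, kreweras_anti⟩
  exact le_of_map_le_of_finite (f := fun π : NC n => kreweras (kreweras π))
    (fun _ _ h => kreweras_anti (kreweras_anti h)) (kreweras_injective.comp kreweras_injective)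
    (kreweras_anti h)

/-- The Kreweras complement as a permutation of `NC_n`. -/
def krewerasEquiv : NC n ≃ NC n :=
  Equiv.ofBijective kreweras (Finite.injective_iff_bijective.mp kreweras_injective)

lemma kreweras_top : kreweras (⊤ : NC n) = ⊥ := by
  obtain ⟨π, hπ⟩ := (krewerasEquiv (n := n)).surjective ⊥
  exact le_bot_iff.mp (hπ ▸ kreweras_anti le_top)

/-- The restriction of a partition to a subset. -/
def comap {a : ℕ} (l : Fin a ↪o Fin n) (π : NC n) : NC a :=
  ⟨π.1.comap l, fun _ _ _ _ hxy hyz hzw hxz hyw =>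
    π.2 _ _ _ _ (l.strictMono hxy) (l.strictMono hyz) (l.strictMono hzw) hxz hyw⟩

lemma comap_rel {a : ℕ} {l : Fin a ↪o Fin n} {π : NC n} {x y : Fin a} :
    (comap l π).1 x y ↔ π.1 (l x) (l y) := Iff.rfl

lemma comap_mono {a : ℕ} (l : Fin a ↪o Fin n) {π σ : NC n} (h : π ≤ σ) :
    comap l π ≤ comap l σ := fun {_ _} hxy => h hxy

lemma comap_bot {a : ℕ} (l : Fin a ↪o Fin n) : comap l ⊥ = ⊥ :=
  le_bot_iff.mp fun {_ _} hxy => l.injective hxy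

/-- Two subsets which are unions of blocks of `σ` and are complements of each other. -/
structure Splits {a b : ℕ} (l : Fin a ↪o Fin n) (r : Fin b ↪o Fin n) (σ : NC n) : Prop where
  cases : ∀ z, (∃ x, z = l x) ∨ ∃ y, z = r y
  left_right : ∀ x y, ¬ σ.1 (l x) (r y)

namespace Splits

variable {a b : ℕ} {l : Fin a ↪o Fin n} {r : Fin b ↪o Fin n} {σ : NC n}

lemma mono (h : Splits l r σ) {π : NC n} (hπ : π ≤ σ) : Splits l r π :=
  ⟨h.cases, fun x y hxy => h.left_right x y (hπ hxy)⟩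

lemma symm (h : Splits l r σ) : Splits r l σ :=
  ⟨fun z => (h.cases z).symm, fun x y hxy => h.left_right y x (σ.1.symm hxy)⟩

lemma le_of_comap_le (h : Splits l r σ) {ρ ρ' : NC n} (hρ : ρ ≤ σ)
    (h1 : comap l ρ ≤ comap l ρ') (h2 : comap r ρ ≤ comap r ρ') : ρ ≤ ρ' := by
  intro x y hxy
  rcases h.cases x with ⟨x, rfl⟩ | ⟨x, rfl⟩ <;> rcases h.cases y with ⟨y, rfl⟩ | ⟨y, rfl⟩
  · exact h1 hxy
  · exact absurd hxy ((h.mono hρ).left_right _ _)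
  · exact absurd hxy ((h.mono hρ).symm.left_right _ _)
  · exact h2 hxy

lemma ne (h : Splits l r σ) (x : Fin a) (y : Fin b) : l x ≠ r y :=
  fun hh => h.left_right x y (hh ▸ σ.1.refl _)

/-- The union of partitions of complementary subsets. -/
def glueSetoid (h : Splits l r σ) (s : Setoid (Fin a)) (t : Setoid (Fin b)) :
    Setoid (Fin n) where
  r z w := (∃ x y, z = l x ∧ w = l y ∧ s x y) ∨ ∃ x y, z = r x ∧ w = r y ∧ t x y
  iseqv := by
    refine ⟨fun z => ?_, ?_, ?_⟩
    · rcases h.cases z with ⟨x, rfl⟩ | ⟨x, rfl⟩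
      · exact Or.inl ⟨x, x, rfl, rfl, s.refl x⟩
      · exact Or.inr ⟨x, x, rfl, rfl, t.refl x⟩
    · rintro _ _ (⟨x, y, rfl, rfl, hxy⟩ | ⟨x, y, rfl, rfl, hxy⟩)
      · exact Or.inl ⟨y, x, rfl, rfl, s.symm hxy⟩
      · exact Or.inr ⟨y, x, rfl, rfl, t.symm hxy⟩
    · rintro _ _ _ (⟨x, y, rfl, rfl, hxy⟩ | ⟨x, y, rfl, rfl, hxy⟩)
        (⟨y', z, hy, rfl, hyz⟩ | ⟨y', z, hy, rfl, hyz⟩)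
      · obtain rfl := l.injective hy
        exact Or.inl ⟨x, z, rfl, rfl, s.trans hxy hyz⟩
      · exact absurd hy (h.ne _ _)
      · exact absurd hy.symm (h.ne _ _)
      · obtain rfl := r.injective hy
        exact Or.inr ⟨x, z, rfl, rfl, t.trans hxy hyz⟩

lemma glueSetoid_left (h : Splits l r σ) {s : Setoid (Fin a)} {t : Setoid (Fin b)} {x y : Fin a} :
    h.glueSetoid s t (l x) (l y) ↔ s x y := by
  constructor
  · rintro (⟨x', y', hx, hy, hxy⟩ | ⟨x', y', hx, hy, hxy⟩)
    · rwa [l.injective hx, l.injective hy]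
    · exact absurd hx (h.ne _ _)
  · exact fun hxy => Or.inl ⟨x, y, rfl, rfl, hxy⟩

lemma glueSetoid_right (h : Splits l r σ) {s : Setoid (Fin a)} {t : Setoid (Fin b)}
    {x y : Fin b} : h.glueSetoid s t (r x) (r y) ↔ t x y := by
  constructor
  · rintro (⟨x', y', hx, hy, hxy⟩ | ⟨x', y', hx, hy, hxy⟩)
    · exact absurd hx.symm (h.ne _ _)
    · rwa [r.injective hx, r.injective hy]
  · exact fun hxy => Or.inr ⟨x, y, rfl, rfl, hxy⟩

lemma glueSetoid_le (h : Splits l r σ) {π : NC a} {τ : NC b} (hπ : π ≤ comap l σ)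
    (hτ : τ ≤ comap r σ) {z w : Fin n} (hzw : h.glueSetoid π.1 τ.1 z w) : σ.1 z w := by
  rcases hzw with ⟨x, y, rfl, rfl, hxy⟩ | ⟨x, y, rfl, rfl, hxy⟩
  · exact hπ hxy
  · exact hτ hxy

/-- The glued partition refines σ. A crossing between the two pieces would make σ relate them, and a
crossing within a piece is excluded there. -/
lemma isNoncrossing_glueSetoid (h : Splits l r σ) {π : NC a} {τ : NC b} (hπ : π ≤ comap l σ)
    (hτ : τ ≤ comap r σ) : IsNoncrossing (h.glueSetoid π.1 τ.1) := by
  intro x y z w hxy hyz hzw hxz hyw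
  have hσ := σ.2 x y z w hxy hyz hzw (h.glueSetoid_le hπ hτ hxz) (h.glueSetoid_le hπ hτ hyw)
  rcases hxz with ⟨x, z, rfl, rfl, hxz⟩ | ⟨x, z, rfl, rfl, hxz⟩ <;>
    rcases hyw with ⟨y, w, rfl, rfl, hyw⟩ | ⟨y, w, rfl, rfl, hyw⟩
  · exact h.glueSetoid_left.mpr (π.2 x y z w (l.lt_iff_lt.mp hxy) (l.lt_iff_lt.mp hyz)
      (l.lt_iff_lt.mp hzw) hxz hyw)
  · exact absurd hσ (h.left_right _ _)
  · exact absurd hσ (h.symm.left_right _ _)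
  · exact h.glueSetoid_right.mpr (τ.2 x y z w (r.lt_iff_lt.mp hxy) (r.lt_iff_lt.mp hyz)
      (r.lt_iff_lt.mp hzw) hxz hyw)

/-- An interval is the product of its restrictions to complementary unions of blocks of its upper
bound. -/
lemma nonempty_iso (h : Splits l r σ) {π : NC n} (hπ : π ≤ σ) :
    Nonempty (Set.Icc π σ ≃o Set.Icc (comap l π) (comap l σ) × Set.Icc (comap r π) (comap r σ)) := by
  let f : Set.Icc π σ ↪o Set.Icc (comap l π) (comap l σ) × Set.Icc (comap r π) (comap r σ) :=
    OrderEmbedding.ofMapLEIff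
      (fun ρ => (⟨comap l ρ.1, comap_mono l ρ.2.1, comap_mono l ρ.2.2⟩,
        ⟨comap r ρ.1, comap_mono r ρ.2.1, comap_mono r ρ.2.2⟩))
      fun ρ ρ' => ⟨fun hh => h.le_of_comap_le ρ.2.2 hh.1 hh.2,
        fun hh => ⟨comap_mono l hh, comap_mono r hh⟩⟩
  refine ⟨RelIso.ofSurjective f ?_⟩
  rintro ⟨⟨ρ, h1, h2⟩, ⟨τ, h3, h4⟩⟩
  have hl : comap l (⟨h.glueSetoid ρ.1 τ.1, h.isNoncrossing_glueSetoid h2 h4⟩ : NC n) = ρ :=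
    Subtype.ext (Setoid.ext fun _ _ => h.glueSetoid_left)
  have hr : comap r (⟨h.glueSetoid ρ.1 τ.1, h.isNoncrossing_glueSetoid h2 h4⟩ : NC n) = τ :=
    Subtype.ext (Setoid.ext fun _ _ => h.glueSetoid_right)
  refine ⟨⟨⟨h.glueSetoid ρ.1 τ.1, h.isNoncrossing_glueSetoid h2 h4⟩, ?_,
    fun {_ _} => h.glueSetoid_le h2 h4⟩, Prod.ext (Subtype.ext hl) (Subtype.ext hr)⟩
  exact h.le_of_comap_le hπ (h1.trans hl.ge) (h3.trans hr.ge)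

lemma block_left (h : Splits l r σ) (x : Fin a) :
    block σ.1 (l x) = (block (comap l σ).1 x).map l.toEmbedding := by
  ext z
  rw [mem_block, Finset.mem_map]
  constructor
  · intro hz
    rcases h.cases z with ⟨y, rfl⟩ | ⟨y, rfl⟩
    · exact ⟨y, mem_block.mpr hz, rfl⟩
    · exact absurd hz (h.left_right _ _)
  · rintro ⟨y, hy, rfl⟩
    exact comap_rel.mp (mem_block.mp hy)

lemma blocks_eq (h : Splits l r σ) : blocks σ.1 =
    (blocks (comap l σ).1).map (Finset.mapEmbedding l.toEmbedding).toEmbedding ∪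
      (blocks (comap r σ).1).map (Finset.mapEmbedding r.toEmbedding).toEmbedding := by
  ext B
  simp only [Finset.mem_union, Finset.mem_map, mem_blocks, RelEmbedding.coe_toEmbedding,
    Finset.mapEmbedding_apply]
  constructor
  · rintro ⟨z, rfl⟩
    rcases h.cases z with ⟨x, rfl⟩ | ⟨x, rfl⟩
    · exact Or.inl ⟨_, ⟨x, rfl⟩, (h.block_left x).symm⟩
    · exact Or.inr ⟨_, ⟨x, rfl⟩, (h.symm.block_left x).symm⟩
  · rintro (⟨_, ⟨x, rfl⟩, rfl⟩ | ⟨_, ⟨x, rfl⟩, rfl⟩)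
    · exact ⟨_, h.block_left x⟩
    · exact ⟨_, h.symm.block_left x⟩

lemma prod_blocks {M : Type*} [CommMonoid M] (f : ℕ → M) (h : Splits l r σ) :
    ∏ B ∈ blocks σ.1, f B.card =
      (∏ B ∈ blocks (comap l σ).1, f B.card) * ∏ B ∈ blocks (comap r σ).1, f B.card := by
  rw [h.blocks_eq, Finset.prod_union, Finset.prod_map, Finset.prod_map]
  · simp
  · rw [Finset.disjoint_left]
    intro B hB hB'
    simp only [Finset.mem_map, mem_blocks, RelEmbedding.coe_toEmbedding,
      Finset.mapEmbedding_apply] at hB hB'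
    obtain ⟨_, ⟨x, rfl⟩, rfl⟩ := hB
    obtain ⟨_, ⟨y, rfl⟩, hxy⟩ := hB'
    have hx : l x ∈ (block (comap r σ).1 y).map r.toEmbedding :=
      hxy ▸ Finset.mem_map_of_mem l.toEmbedding (mem_block.mpr ((comap l σ).1.refl x))
    obtain ⟨z, -, hz⟩ := Finset.mem_map.mp hx
    exact h.ne x z hz.symm

end Splits

/-- A partition with several blocks splits. -/
lemma exists_splits {σ : NC n} (hn : n ≠ 0) (hσ : σ ≠ ⊤) :
    ∃ (a b : ℕ) (l : Fin a ↪o Fin n) (r : Fin b ↪o Fin n), a < n ∧ b < n ∧ Splits l r σ := by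
  obtain ⟨n, rfl⟩ := Nat.exists_eq_succ_of_ne_zero hn
  -- The two pieces are the block of the first element and its complement.
  set B := block σ.1 0 with hB
  have hB0 : (0 : Fin (n + 1)) ∈ B := mem_block.mpr (σ.1.refl 0)
  have hne : B ≠ univ := by
    intro h
    apply hσ
    refine top_le_iff.mp ?_
    intro x y _
    have hx : ∀ x, σ.1 0 x := fun x => mem_block.mp (hB ▸ h ▸ Finset.mem_univ x)
    exact σ.1.trans (σ.1.symm (hx x)) (hx y)
  refine ⟨B.card, Bᶜ.card, B.orderEmbOfFin rfl, Bᶜ.orderEmbOfFin rfl, ?_, ?_, ?_, ?_⟩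
  · simpa using Finset.card_lt_card (Finset.ssubset_univ_iff.mpr hne)
  · rw [Finset.card_compl, Fintype.card_fin]
    have := Finset.card_pos.mpr ⟨0, hB0⟩
    lia
  · intro z
    by_cases hz : z ∈ B
    · left
      have : z ∈ Set.range (B.orderEmbOfFin rfl) := by rw [Finset.range_orderEmbOfFin]; exact hz
      obtain ⟨x, hx⟩ := this
      exact ⟨x, hx.symm⟩
    · right
      have : z ∈ Set.range (Bᶜ.orderEmbOfFin rfl) := by
        rw [Finset.range_orderEmbOfFin]
        exact Finset.mem_compl.mpr hz
      obtain ⟨x, hx⟩ := this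
      exact ⟨x, hx.symm⟩
  · intro x y hxy
    have hx := mem_block.mp (B.orderEmbOfFin_mem rfl x)
    have hy := Finset.mem_compl.mp (Bᶜ.orderEmbOfFin_mem rfl y)
    exact hy (mem_block.mpr (σ.1.trans hx hxy))

end NC

/-! ### Factorization of intervals into full lattices. -/

namespace NCClass

open NC

variable {n : ℕ}

/-- The class of the lattice `NC_{n+1}`. -/
def full (n : ℕ) : NCClass := mk (⊥ : NC (n + 1)) ⊤ bot_le

lemma full_zero : full 0 = 1 := by
  have : (⊤ : NC 1) = ⊥ := Subtype.ext (Setoid.ext fun x y => iff_of_true trivial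
    (Subsingleton.elim x y))
  rw [full, mk_congr rfl this (h' := le_rfl), mk_self]

lemma mk_of_splits {a b : ℕ} {l : Fin a ↪o Fin n} {r : Fin b ↪o Fin n} {σ : NC n}
    (h : Splits l r σ) (π : NC n) (hπ : π ≤ σ) : mk π σ hπ =
      mk (comap l π) (comap l σ) (comap_mono l hπ) * mk (comap r π) (comap r σ) (comap_mono r hπ) := by
  obtain ⟨f⟩ := h.nonempty_iso hπ
  rw [mk_mul_mk]
  exact mk_eq (f.trans (appendIso _ _ _ _).symm)

/-- The interval below `π` is a product of full lattices indexed by the blocks of `π`. -/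
lemma mk_bot (π : NC n) : mk ⊥ π bot_le = ∏ B ∈ blocks π.1, full (B.card - 1) := by
  induction n using Nat.strong_induction_on with
  | _ n ih =>
    rcases Nat.eq_zero_or_pos n with rfl | hn
    · have h1 : π = ⊥ := Subtype.ext (Setoid.ext fun x => x.elim0)
      have h2 : blocks π.1 = ∅ := Finset.image_eq_empty.mpr (Finset.eq_empty_of_isEmpty _)
      rw [h2, Finset.prod_empty, mk_congr rfl h1 (h' := le_rfl), mk_self]
    · by_cases hπ : π = ⊤
      · obtain ⟨n, rfl⟩ := Nat.exists_eq_succ_of_ne_zero hn.ne'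
        subst hπ
        have : blocks (⊤ : NC (n + 1)).1 = {univ} := by
          ext B
          have hB : ∀ x, block (⊤ : NC (n + 1)).1 x = univ := fun x =>
            Finset.eq_univ_of_forall fun y => mem_block.mpr trivial
          rw [mem_blocks, Finset.mem_singleton]
          simp only [hB]
          exact ⟨fun ⟨_, h⟩ => h.symm, fun h => ⟨0, h.symm⟩⟩
        rw [this, Finset.prod_singleton, Finset.card_univ, Fintype.card_fin]
        rfl
      · obtain ⟨a, b, l, r, ha, hb, h⟩ := exists_splits hn.ne' hπ
        rw [mk_of_splits h, h.prod_blocks fun k => full (k - 1), ← ih a ha, ← ih b hb]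
        congr 1
        · exact mk_congr (comap_bot l) rfl
        · exact mk_congr (comap_bot r) rfl

/-- The classes of the intervals that are products of full lattices. -/
def fullProducts : Submonoid NCClass := Submonoid.closure (Set.range full)

lemma full_mem (n : ℕ) : full n ∈ fullProducts := Submonoid.subset_closure ⟨n, rfl⟩

lemma mk_bot_mem (π : NC n) : mk ⊥ π bot_le ∈ fullProducts := by
  rw [mk_bot]
  exact Submonoid.prod_mem _ fun B _ => full_mem _

/-- Two posets are anti-isomorphic. -/
def AntiIso (α β : Type*) [LE α] [LE β] : Prop := ∃ f : α ≃ β, ∀ x y, f x ≤ f y ↔ y ≤ x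

lemma antiIso_kreweras (π σ : NC n) :
    AntiIso (Set.Icc π σ) (Set.Icc (kreweras σ) (kreweras π)) := by
  refine ⟨krewerasEquiv.subtypeEquiv fun ρ => ?_, fun x y => kreweras_le_iff⟩
  change π ≤ ρ ∧ ρ ≤ σ ↔ kreweras σ ≤ kreweras ρ ∧ kreweras ρ ≤ kreweras π
  rw [kreweras_le_iff, kreweras_le_iff, and_comm]

/-- The Kreweras complement reverses the order of each full lattice, and self-duality passes to
products. -/
lemma exists_selfDual {c : NCClass} (hc : c ∈ fullProducts) :
    ∃ I : NCInterval, Quotient.mk _ I = c ∧ AntiIso I.Elem I.Elem := by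
  induction hc using Submonoid.closure_induction with
  | mem c h =>
    obtain ⟨n, rfl⟩ := h
    refine ⟨⟨n + 1, ⊥, ⊤, bot_le⟩, rfl, ?_⟩
    have h1 := antiIso_kreweras (⊥ : NC (n + 1)) ⊤
    have h2 : kreweras (⊥ : NC (n + 1)) = ⊤ := by
      obtain ⟨π, hπ⟩ := (krewerasEquiv (n := n + 1)).surjective ⊤
      exact top_le_iff.mp (hπ ▸ kreweras_anti bot_le)
    rw [kreweras_top, h2] at h1
    exact h1
  | one => exact ⟨⟨0, ⊥, ⊥, le_rfl⟩, rfl, Equiv.refl _, fun x y =>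
      iff_of_true (x.2.2.trans y.2.1) (y.2.2.trans x.2.1)⟩
  | mul c d _ _ hc hd =>
    obtain ⟨I, rfl, f, hf⟩ := hc
    obtain ⟨J, rfl, g, hg⟩ := hd
    refine ⟨I.prod J, rfl, ((I.prodIso J).toEquiv.trans (f.prodCongr g)).trans
      (I.prodIso J).symm.toEquiv, fun x y => ?_⟩
    change (I.prodIso J).symm _ ≤ (I.prodIso J).symm _ ↔ _
    rw [(I.prodIso J).symm.le_iff_le, ← (I.prodIso J).le_iff_le]
    exact and_congr (hf _ _) (hg _ _)

lemma antiIso_of_mem {π σ : NC n} {h : π ≤ σ} (hc : mk π σ h ∈ fullProducts) :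
    AntiIso (Set.Icc π σ) (Set.Icc π σ) := by
  obtain ⟨I, hI, f, hf⟩ := exists_selfDual hc
  obtain ⟨e⟩ : Nonempty (I.Elem ≃o Set.Icc π σ) := Quotient.exact hI
  refine ⟨(e.symm.toEquiv.trans f).trans e.toEquiv, fun x y => ?_⟩
  change e _ ≤ e _ ↔ _
  exact (e.le_iff_le.trans (hf _ _)).trans e.symm.le_iff_le

/-- K reverses the order between [π, 1] and [0, K(π)]; the latter is a product of full lattices,
hence self-dual, and composing the two reversals gives an isomorphism. -/
lemma mk_top (π : NC n) : mk π ⊤ le_top = mk ⊥ (kreweras π) bot_le := by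
  have h := antiIso_kreweras π ⊤
  rw [kreweras_top] at h
  obtain ⟨f, hf⟩ := h
  obtain ⟨g, hg⟩ := antiIso_of_mem (mk_bot_mem (kreweras π))
  exact mk_eq ⟨f.trans g, fun {x y} => (hg _ _).trans (hf _ _)⟩

/-- Splitting along the blocks of σ reduces to σ = ⊤, where `mk_top` gives an interval that starts
at ⊥. -/
lemma mem_fullProducts (c : NCClass) : c ∈ fullProducts := by
  induction c using NCClass.ind with
  | H n π σ h =>
    induction n using Nat.strong_induction_on with
    | _ n ih =>
      by_cases hσ : σ = ⊤
      · subst hσ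
        rw [mk_top]
        exact mk_bot_mem _
      · by_cases hn : n = 0
        · subst hn
          exact absurd (Subtype.ext (Setoid.ext fun x => x.elim0)) hσ
        · obtain ⟨a, b, l, r, ha, hb, hs⟩ := exists_splits hn hσ
          rw [mk_of_splits hs]
          exact mul_mem (ih a ha _ _ _) (ih b hb _ _ _)

end NCClass

/-! ### Coproduct of the y_n and generation by them. -/

namespace HNC

open NC

variable (R : Type*) [CommRing R]

lemma of_mk_bot {n : ℕ} (π : NC n) : of R (NCClass.mk ⊥ π bot_le) =
    ((reducedType π).map (y R)).prod := by
  rw [NCClass.mk_bot, map_prod, prod_reducedType]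
  · rfl
  · exact (congrArg (of R) NCClass.full_zero).trans (map_one _)

/-- This has the shape of `comul_lagrange_eq_sum_noncrossing`, with y_n in place of g_n. -/
lemma comul_y (n : ℕ) : Coalgebra.comul (R := R) (y R n) =
    ∑ π : NC (n + 1), ((reducedType π).map (y R)).prod ⊗ₜ[R]
      ((reducedType (kreweras π)).map (y R)).prod := by
  have h : y R n = zeta R (⊥ : NC (n + 1)) ⊤ := (zeta_of_le bot_le).symm
  rw [h, comul_def]
  refine Finset.sum_congr rfl fun π _ => ?_
  rw [zeta_of_le bot_le, zeta_of_le le_top, NCClass.mk_top, of_mk_bot, of_mk_bot]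

lemma adjoin_y : Algebra.adjoin R (Set.range (y R)) = ⊤ := by
  rw [eq_top_iff]
  have h : ∀ c, of R c ∈ Algebra.adjoin R (Set.range (y R)) := by
    intro c
    induction NCClass.mem_fullProducts c using Submonoid.closure_induction with
    | mem c h =>
      obtain ⟨n, rfl⟩ := h
      exact Algebra.subset_adjoin ⟨n, rfl⟩
    | one => rw [map_one]; exact one_mem _
    | mul c d _ _ hc hd => rw [map_mul]; exact mul_mem hc hd
  intro a _
  induction a using MonoidAlgebra.induction_on with
  | of c => exact h c
  | add a b ha hb => exact add_mem (ha trivial) (hb trivial)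
  | smul r a ha => exact Subalgebra.smul_mem _ (ha trivial) r

end HNC

end

noncomputable section

/-! ### The rank of an interval -/

namespace NC

variable {n : ℕ}

/-- The minimal elements of the blocks. -/
def mins (s : Setoid (Fin n)) : Finset (Fin n) :=
  open Classical in univ.filter fun x => ∀ y, s x y → x ≤ y

lemma mem_mins {s : Setoid (Fin n)} {x : Fin n} : x ∈ mins s ↔ ∀ y, s x y → x ≤ y := by
  simp [mins]

lemma exists_mem_mins (s : Setoid (Fin n)) (x : Fin n) : ∃ z ∈ mins s, s x z :=
  ⟨_, mem_mins.mpr fun y hy => Finset.min'_le _ y (mem_block.mpr (s.trans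
    (mem_block.mp (Finset.min'_mem _ (block_nonempty s x))) hy)),
    mem_block.mp (Finset.min'_mem _ (block_nonempty s x))⟩

lemma eq_of_mem_mins {s : Setoid (Fin n)} {x y : Fin n} (hx : x ∈ mins s) (hy : y ∈ mins s)
    (h : s x y) : x = y :=
  le_antisymm (mem_mins.mp hx y h) (mem_mins.mp hy x (s.symm h))

lemma exists_rel_of_lt {π σ : NC n} (h : π < σ) : ∃ x y, x < y ∧ σ.1 x y ∧ ¬ π.1 x y := by
  by_contra! H
  refine h.not_ge fun {x y} hxy => ?_
  rcases lt_trichotomy x y with hlt | rfl | hlt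
  · exact H x y hlt hxy
  · exact π.1.refl _
  · exact π.1.symm (H y x hlt (σ.1.symm hxy))

lemma mins_mono {π σ : NC n} (h : π ≤ σ) : mins σ.1 ⊆ mins π.1 := fun _ hx =>
  mem_mins.mpr fun y hy => mem_mins.mp hx y (h hy)

/-- If no minimum were lost, two points related in σ but not in π would have minima in π that are
related minima of σ, hence equal. -/
lemma card_mins_lt {π σ : NC n} (h : π < σ) : (mins σ.1).card < (mins π.1).card := by
  refine Finset.card_lt_card ((mins_mono h.le).ssubset_of_ne fun heq => ?_)
  obtain ⟨x, y, -, hxy, hne⟩ := exists_rel_of_lt h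
  obtain ⟨x', hx', hxx'⟩ := exists_mem_mins π.1 x
  obtain ⟨y', hy', hyy'⟩ := exists_mem_mins π.1 y
  have h1 : σ.1 x' y' := σ.1.trans (σ.1.symm (h.le hxx')) (σ.1.trans hxy (h.le hyy'))
  rw [← heq] at hx' hy'
  obtain rfl := eq_of_mem_mins hx' hy' h1
  exact hne (π.1.trans hxx' (π.1.symm hyy'))

open Classical in
/-- The union of the blocks of `x` and `y`. -/
def mergeSetoid (s : Setoid (Fin n)) (x y : Fin n) : Setoid (Fin n) :=
  Setoid.ker fun z => if s y z then Quotient.mk s x else Quotient.mk s z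

lemma mergeSetoid_rel {s : Setoid (Fin n)} {x y z w : Fin n} : mergeSetoid s x y z w ↔
    s z w ∨ (s x z ∨ s y z) ∧ (s x w ∨ s y w) := by
  rw [mergeSetoid, Setoid.ker_def]
  split_ifs with h1 h2 h2
  · simp [h1, h2]
  · rw [Quotient.eq]
    have : ¬ s z w := fun h => h2 (s.trans h1 h)
    change s x w ↔ _
    tauto
  · rw [Quotient.eq]
    have : ¬ s z w := fun h => h1 (s.trans h2 (s.symm h))
    change s z x ↔ _
    rw [s.comm' (x := z)]
    tauto
  · rw [Quotient.eq]
    have : s x z → s x w → s z w := fun h h' => s.trans (s.symm h) h'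
    tauto

/-- If a point of a block lies between two points of another block, then so does the block. -/
lemma mem_Ioo_of_rel {s : Setoid (Fin n)} (hs : IsNoncrossing s) {p q u v : Fin n} (hpq : s p q)
    (huv : s u v) (hpu : ¬ s p u) (hu : p < u ∧ u < q) : p < v ∧ v < q := by
  have hpv : ¬ s p v := fun h => hpu (s.trans h (s.symm huv))
  have hvp : v ≠ p := by rintro rfl; exact hpv (s.refl _)
  have hvq : v ≠ q := by rintro rfl; exact hpv hpq
  constructor
  · by_contra hlt
    exact hpv (s.symm (hs v p u q (lt_of_le_of_ne (not_lt.mp hlt) hvp) hu.1 hu.2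
      (s.symm huv) hpq))
  · by_contra hlt
    exact hpu (hs p u q v hu.1 hu.2 (lt_of_le_of_ne (not_lt.mp hlt) hvq.symm) hpq huv)

/-- Two blocks of `π` may be merged if they contain consecutive elements of a block of a coarser
noncrossing partition. -/
lemma isNoncrossing_mergeSetoid {π σ : NC n} (h : π ≤ σ) {x y : Fin n} (hlt : x < y)
    (hxy : σ.1 x y) (hmin : ∀ z, x < z → z < y → ¬ σ.1 x z) :
    IsNoncrossing (mergeSetoid π.1 x y) := by
  -- No other block of π separates x from y: if it is not in the σ-block of x and y, this is because
  -- σ is noncrossing; if it is, this is because x and y are consecutive there.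
  have key : ∀ p q, p < q → π.1 p q → ¬ (π.1 x p ∨ π.1 y p) →
      ((p < x ∧ x < q) ↔ (p < y ∧ y < q)) := by
    intro p q hpq hπ hp
    rw [not_or] at hp
    have hxp : x ≠ p := by rintro rfl; exact hp.1 (π.1.refl _)
    have hyq : y ≠ q := by rintro rfl; exact hp.2 (π.1.symm hπ)
    constructor
    · intro hx
      by_cases hσ : σ.1 p x
      · refine ⟨hx.1.trans hlt, ?_⟩
        by_contra hy
        exact hmin q hx.2 (lt_of_le_of_ne (not_lt.mp hy) hyq.symm)
          (σ.1.trans (σ.1.symm hσ) (h hπ))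
      · exact mem_Ioo_of_rel σ.2 (h hπ) hxy hσ hx
    · intro hy
      by_cases hσ : σ.1 p y
      · refine ⟨?_, hlt.trans hy.2⟩
        by_contra hx
        exact hmin p (lt_of_le_of_ne (not_lt.mp hx) hxp) hy.1
          (σ.1.trans hxy (σ.1.symm hσ))
      · exact mem_Ioo_of_rel σ.2 (h hπ) (σ.1.symm hxy) hσ hy
  -- The same for any two points of the merged block, passing through x and y.
  have key' : ∀ p q, p < q → π.1 p q → ¬ (π.1 x p ∨ π.1 y p) → ∀ u v,
      (π.1 x u ∨ π.1 y u) → (π.1 x v ∨ π.1 y v) → p < u ∧ u < q → p < v ∧ v < q := by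
    intro p q hpq hπ hp u v hu hv hm
    have h1 := key p q hpq hπ hp
    have hpx : ∀ w, (π.1 x w ∨ π.1 y w) → ¬ π.1 p w := fun w hw hpw =>
      hp (hw.imp (fun k => π.1.trans k (π.1.symm hpw)) fun k => π.1.trans k (π.1.symm hpw))
    have hx : p < x ∧ x < q := by
      rcases hu with hu | hu
      · exact mem_Ioo_of_rel π.2 hπ (π.1.symm hu) (hpx u (Or.inl hu)) hm
      · exact h1.mpr (mem_Ioo_of_rel π.2 hπ (π.1.symm hu) (hpx u (Or.inr hu)) hm)
    rcases hv with hv | hv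
    · exact mem_Ioo_of_rel π.2 hπ hv (hpx x (Or.inl (π.1.refl x))) hx
    · exact mem_Ioo_of_rel π.2 hπ hv (hpx y (Or.inr (π.1.refl y))) (h1.mp hx)
  intro a b c d hab hbc hcd hac hbd
  rw [mergeSetoid_rel] at *
  by_cases ha : π.1 x a ∨ π.1 y a
  · by_cases hb : π.1 x b ∨ π.1 y b
    · exact Or.inr ⟨ha, hb⟩
    · rcases hbd with hbd | hbd
      · rcases hac with hac | hac
        · exact Or.inl (π.2 a b c d hab hbc hcd hac hbd)
        · exact absurd (key' b d (hbc.trans hcd) hbd hb c a hac.2 hac.1 ⟨hbc, hcd⟩).1 hab.not_gt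
      · exact absurd hbd.1 hb
  · rcases hac with hac | hac
    · rcases hbd with hbd | hbd
      · exact Or.inl (π.2 a b c d hab hbc hcd hac hbd)
      · exact absurd (key' a c (hab.trans hbc) hac ha b d hbd.1 hbd.2 ⟨hab, hbc⟩).2 hcd.not_gt
    · exact absurd hac.1 ha

/-- A lost minimum is the minimum of one of the two merged blocks and exceeds an element of the
other. Two lost minima of different blocks would each exceed the other. -/
lemma card_mins_mergeSetoid (s : Setoid (Fin n)) (x y : Fin n) :
    (mins s).card ≤ (mins (mergeSetoid s x y)).card + 1 := by
  have h : (mins s \ mins (mergeSetoid s x y)).card ≤ 1 := by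
    rw [Finset.card_le_one]
    have key : ∀ z ∈ mins s \ mins (mergeSetoid s x y), (s x z ∨ s y z) ∧
        ∀ z' ∈ mins s \ mins (mergeSetoid s x y), ¬ s z z' → z' < z := by
      intro z hz
      rw [Finset.mem_sdiff, mem_mins, mem_mins] at hz
      obtain ⟨hz, hz'⟩ := hz
      push Not at hz'
      obtain ⟨w, hw, hlt⟩ := hz'
      rw [mergeSetoid_rel] at hw
      have hzw : ¬ s z w := fun hh => (hz w hh).not_gt hlt
      have hM := hw.resolve_left hzw
      refine ⟨hM.1, fun z' hz' hne => ?_⟩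
      rw [Finset.mem_sdiff, mem_mins, mem_mins] at hz'
      obtain ⟨hz1, hz2⟩ := hz'
      push Not at hz2
      obtain ⟨w', hw', hlt'⟩ := hz2
      rw [mergeSetoid_rel] at hw'
      have hM' := hw'.resolve_left fun hh => (hz1 w' hh).not_gt hlt'
      refine (hz1 w ?_).trans_lt hlt
      have ht : ∀ {o u v}, s o u → s o v → s u v := fun h1 h2 => s.trans (s.symm h1) h2
      rcases hM.1 with h1 | h1 <;> rcases hM.2 with h2 | h2 <;> rcases hM'.1 with h3 | h3
      exacts [absurd (ht h1 h2) hzw, absurd (ht h1 h2) hzw, absurd (ht h1 h3) hne, ht h3 h2,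
        ht h3 h2, absurd (ht h1 h3) hne, absurd (ht h1 h2) hzw, absurd (ht h1 h2) hzw]
    intro z hz z' hz'
    by_cases hzz : s z z'
    · exact eq_of_mem_mins (Finset.mem_sdiff.mp hz).1 (Finset.mem_sdiff.mp hz').1 hzz
    · exact absurd ((key z hz).2 z' hz' hzz) ((key z' hz').2 z hz fun hh => hzz (s.symm hh)).not_gt
  have := Finset.card_le_card_sdiff_add_card (s := mins s) (t := mins (mergeSetoid s x y))
  lia

/-- Take x < y at minimal distance among the pairs related in σ but not in π, and merge their
blocks. A point of their σ-block between them would be related to both in π, by minimality, so x and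
y are consecutive. -/
lemma exists_cover {π σ : NC n} (h : π < σ) :
    ∃ ρ : NC n, π < ρ ∧ ρ ≤ σ ∧ (mins π.1).card ≤ (mins ρ.1).card + 1 := by
  classical
  have hex : ∃ d, ∃ x y : Fin n, y.1 = x.1 + d ∧ x < y ∧ σ.1 x y ∧ ¬ π.1 x y := by
    obtain ⟨x, y, hlt, hxy⟩ := exists_rel_of_lt h
    exact ⟨y.1 - x.1, x, y, by rw [Fin.lt_def] at hlt; lia, hlt, hxy⟩
  obtain ⟨x, y, hd, hlt, hxy, hne⟩ := Nat.find_spec hex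
  have hmin : ∀ u v : Fin n, u < v → v.1 - u.1 < y.1 - x.1 → σ.1 u v → π.1 u v := by
    intro u v huv hlt' hσ
    by_contra hπ
    rw [Fin.lt_def] at huv
    exact Nat.find_min hex (m := v.1 - u.1) (by lia) ⟨u, v, by lia, huv, hσ, hπ⟩
  refine ⟨⟨mergeSetoid π.1 x y, isNoncrossing_mergeSetoid h.le hlt hxy fun z hxz hzy hσ => ?_⟩,
    ?_, ?_, card_mins_mergeSetoid _ _ _⟩
  · rw [Fin.lt_def] at hxz hzy
    have h1 := hmin x z hxz (by lia) hσ
    have h2 := hmin z y hzy (by lia) (σ.1.trans (σ.1.symm hσ) hxy)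
    exact hne (π.1.trans h1 h2)
  · refine lt_of_le_not_ge (fun {_ _} hh => mergeSetoid_rel.mpr (Or.inl hh)) fun hle => hne ?_
    exact hle (mergeSetoid_rel.mpr (Or.inr ⟨Or.inl (π.1.refl x), Or.inr (π.1.refl y)⟩))
  · intro z w hzw
    have hM : ∀ {u}, (π.1 x u ∨ π.1 y u) → σ.1 x u := fun hu =>
      hu.elim (fun k => h.le k) fun k => σ.1.trans hxy (h.le k)
    rcases mergeSetoid_rel.mp hzw with hh | ⟨h1, h2⟩
    · exact h.le hh
    · exact σ.1.trans (σ.1.symm (hM h1)) (hM h2)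

/-- Going up from x to σ by the steps of `exists_cover`, the number of blocks drops by at most one
each time, while any strictly decreasing g drops by at least one. So g drops at least as much as the
number of blocks. -/
lemma card_mins_add_le {π σ : NC n} (h : π ≤ σ) {g : Set.Icc π σ → ℕ}
    (hg : ∀ x y, x < y → g y < g x) (x : Set.Icc π σ) :
    (mins x.1.1).card + g ⟨σ, h, le_rfl⟩ ≤ g x + (mins σ.1).card := by
  induction hk : (mins x.1.1).card using Nat.strong_induction_on generalizing x with
  | _ k ih =>
    rcases x.2.2.eq_or_lt with heq | hlt
    · obtain rfl : x = ⟨σ, h, le_rfl⟩ := Subtype.ext heq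
      simp only at hk
      lia
    · obtain ⟨ρ, h1, h2, h3⟩ := exists_cover hlt
      have h4 := card_mins_lt h1
      have h5 := ih _ (hk ▸ h4) ⟨ρ, x.2.1.trans h1.le, h2⟩ rfl
      have h6 := hg x ⟨ρ, x.2.1.trans h1.le, h2⟩ h1
      lia

lemma card_mins_append {a b : ℕ} (π : NC a) (σ : NC b) :
    (mins (append π σ).1).card = (mins π.1).card + (mins σ.1).card := by
  classical
  have hl : ∀ x : Fin a, Fin.castAdd b x ∈ mins (append π σ).1 ↔ x ∈ mins π.1 := by
    intro x
    rw [mem_mins, mem_mins]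
    constructor
    · intro h y hy
      exact h (Fin.castAdd b y) ((append_rel (.inl x) (.inl y)).mpr (.inl hy))
    · intro h y hy
      obtain ⟨y, rfl⟩ := finSumFinEquiv.surjective y
      cases (append_rel (.inl x) y).mp hy with
      | @inl _ y hxy => exact h y hxy
  have hr : ∀ x : Fin b, Fin.natAdd a x ∈ mins (append π σ).1 ↔ x ∈ mins σ.1 := by
    intro x
    rw [mem_mins, mem_mins]
    constructor
    · intro h y hy
      exact Nat.le_of_add_le_add_left
        (h (Fin.natAdd a y) ((append_rel (.inr x) (.inr y)).mpr (.inr hy)))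
    · intro h y hy
      obtain ⟨y, rfl⟩ := finSumFinEquiv.surjective y
      cases (append_rel (.inr x) y).mp hy with
      | @inr _ y hxy => exact Nat.add_le_add_left (h y hxy) a
  have hcard : ∀ {m : ℕ} (S : Finset (Fin m)), S.card = ∑ x, if x ∈ S then 1 else 0 := by
    intro m S
    simp
  rw [hcard, hcard (mins π.1), hcard (mins σ.1), Fin.sum_univ_add]
  simp only [hl, hr]

end NC

namespace NCClass

open NC

/-- With g the number of blocks transported from J, this bounds the rank of I by that of J; the
inverse isomorphism gives equality, so the rank depends only on the class. -/
lemma card_mins_le_of_iso {I J : NCInterval} (f : I.Elem ≃o J.Elem) :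
    (mins I.lo.1).card + (mins J.hi.1).card ≤ (mins J.lo.1).card + (mins I.hi.1).card := by
  have h := card_mins_add_le I.le (g := fun x => (mins (f x).1.1).card)
    (fun x y hxy => card_mins_lt (f.lt_iff_lt.mpr hxy)) ⟨I.lo, le_rfl, I.le⟩
  have h1 : f ⟨I.lo, le_rfl, I.le⟩ = ⟨J.lo, le_rfl, J.le⟩ := iccIso_lo f I.le J.le
  have h2 : f ⟨I.hi, I.le, le_rfl⟩ = ⟨J.hi, J.le, le_rfl⟩ := iccIso_hi f I.le J.le
  rwa [h1, h2] at h

/-- The rank of an interval. -/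
def rank : NCClass → ℕ :=
  Quotient.lift (fun I => (mins I.lo.1).card - (mins I.hi.1).card) fun I J ⟨f⟩ => by
    have h1 := card_mins_le_of_iso f
    have h2 := card_mins_le_of_iso f.symm
    have h3 := Finset.card_le_card (mins_mono I.le)
    have h4 := Finset.card_le_card (mins_mono J.le)
    lia

lemma rank_mk {n : ℕ} (π σ : NC n) (h : π ≤ σ) :
    rank (mk π σ h) = (mins π.1).card - (mins σ.1).card := rfl

lemma rank_one : rank 1 = 0 := Nat.sub_self _

lemma rank_mul (c d : NCClass) : rank (c * d) = rank c + rank d := by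
  induction c using NCClass.ind with
  | H n π σ h =>
    induction d using NCClass.ind with
    | H n' π' σ' h' =>
      rw [mk_mul_mk, rank_mk, rank_mk, rank_mk, card_mins_append, card_mins_append]
      have h3 := Finset.card_le_card (mins_mono h)
      have h4 := Finset.card_le_card (mins_mono h')
      lia

lemma rank_full (n : ℕ) : rank (full n) = n := by
  have h1 : mins (⊥ : NC (n + 1)).1 = univ :=
    Finset.eq_univ_of_forall fun x => mem_mins.mpr fun y hy => (show x = y from hy).le
  have h2 : mins (⊤ : NC (n + 1)).1 = {0} := by
    ext x
    rw [mem_mins, Finset.mem_singleton]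
    constructor
    · exact fun h => le_antisymm (h 0 trivial) (Fin.zero_le x)
    · rintro rfl y -
      exact Fin.zero_le y
  rw [full, rank_mk, h1, h2, Finset.card_univ, Fintype.card_fin, Finset.card_singleton,
    Nat.add_sub_cancel]

end NCClass

namespace HNC

variable {R : Type*} [CommRing R] {A : Type*} [CommRing A] [Algebra R A]

variable (R) in
/-- The character which maps an interval of rank `n` to `q^n`. -/
def rankHom (q : A) : HNC R →ₐ[R] A :=
  lift
    { toFun := fun c => q ^ NCClass.rank c
      map_one' := by rw [NCClass.rank_one, pow_zero]
      map_mul' := fun c d => by rw [NCClass.rank_mul, pow_add] }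

lemma rankHom_y (q : A) (n : ℕ) : rankHom R q (y R n) = q ^ n := by
  rw [rankHom, y, lift_of]
  exact congrArg (q ^ ·) (NCClass.rank_full n)

end HNC

end

noncomputable section

/-! ### The isomorphism -/

namespace PowerSeries

variable {A : Type*} [CommRing A]

/-- Since g has constant term 1, the n-th coefficient of s enters the n-th equation with factor 1,
and the other terms involve earlier coefficients of s. -/
lemma IsLagrange.unique_left {s s' g : PowerSeries A} (hg : s.IsLagrange g)
    (hg' : s'.IsLagrange g) (h0 : constantCoeff g = 1) : s = s' := by
  ext n
  induction n using Nat.strong_induction_on with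
  | _ n ih =>
    have h1 := (hg n).symm.trans (hg' n)
    rw [Finset.sum_range_succ, Finset.sum_range_succ, Finset.sum_congr rfl fun k hk => by
      rw [ih k (Finset.mem_range.mp hk)], add_right_inj] at h1
    simpa [h0] using h1

lemma coeff_pow_mem {R : Type*} [CommRing R] [Algebra R A] (S : Subalgebra R A)
    {g : PowerSeries A} (hg : ∀ n, coeff n g ∈ S) (k n : ℕ) : coeff n (g ^ k) ∈ S := by
  induction k generalizing n with
  | zero =>
    rw [pow_zero, coeff_one]
    split_ifs
    exacts [one_mem S, zero_mem S]
  | succ k ih =>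
    rw [pow_succ, coeff_mul]
    exact sum_mem fun p _ => mul_mem (ih _) (hg _)

/-- The series g = 1/(1 - pX) satisfies g = 1 + pX g. -/
lemma isLagrange_geometric (p : A) :
    (1 + C p * X : PowerSeries A).IsLagrange (mk fun n => p ^ n) := by
  intro n
  cases n with
  | zero => simp
  | succ n =>
    rw [Finset.sum_range_succ', Finset.sum_range_succ']
    have h : ∑ k ∈ range n, coeff (k + 1 + 1) (1 + C p * X : PowerSeries A) *
        coeff (n + 1 - (k + 1 + 1)) ((mk fun n => p ^ n) ^ (k + 1 + 1)) = 0 :=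
      Finset.sum_eq_zero fun k _ => by
        simp [coeff_one]
    rw [h]
    simp [coeff_one, pow_succ']

end PowerSeries

namespace SymFun

variable (R : Type*) [CommRing R]

/-- The functional equation is solved for h_n, which enters with coefficient g_0^n = 1. -/
lemma h_mem_adjoin_lagrange (n : ℕ) : h R n ∈ Algebra.adjoin R (Set.range (lagrange R)) := by
  have hg : ∀ n, lagrange R n ∈ Algebra.adjoin R (Set.range (lagrange R)) :=
    fun n => Algebra.subset_adjoin ⟨n, rfl⟩
  induction n using Nat.strong_induction_on with
  | _ n ih =>
    have h1 := lagrange_eq R n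
    rw [Finset.sum_range_succ, Nat.sub_self, PowerSeries.coeff_zero_eq_constantCoeff_apply,
      map_pow, ← PowerSeries.coeff_zero_eq_constantCoeff_apply, PowerSeries.coeff_mk,
      lagrange_zero, one_pow, mul_one] at h1
    rw [← sub_eq_iff_eq_add'.mpr h1]
    refine sub_mem (hg n) (sum_mem fun k hk => mul_mem (ih k (Finset.mem_range.mp hk)) ?_)
    exact PowerSeries.coeff_pow_mem _ (fun m => by rw [PowerSeries.coeff_mk]; exact hg m) _ _

/-- Sym is generated by the e_n, hence, by applying the antipode, by the h_n. -/
lemma adjoin_lagrange : Algebra.adjoin R (Set.range (lagrange R)) = ⊤ := by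
  rw [eq_top_iff]
  intro f _
  obtain ⟨p, hp⟩ := (eEquiv R).surjective (antipodeHom R f)
  rw [← antipodeHom_antipodeHom f, ← hp]
  clear hp
  induction p using MvPolynomial.induction_on with
  | C r =>
    have : antipodeHom R (eEquiv R (MvPolynomial.C r)) = algebraMap R _ r :=
      ((antipodeHom R).comp (eEquiv R : MvPolynomial ℕ R →ₐ[R] SymFun R)).commutes r
    rw [this]
    exact Subalgebra.algebraMap_mem _ r
  | add p q hp hq =>
    rw [map_add, map_add]
    exact add_mem hp hq
  | mul_X p i hp =>
    rw [map_mul, map_mul, eEquiv_X, antipodeHom_e]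
    exact mul_mem hp (mul_mem (pow_mem (neg_mem (one_mem _)) _) (h_mem_adjoin_lagrange R _))

/-- The counit sends H to 1, and the Lagrange series of 1 is 1. -/
lemma counit_lagrange (n : ℕ) :
    Coalgebra.counit (R := R) (lagrange R n) = if n = 0 then 1 else 0 := by
  classical
  have h1 := (isLagrange_lagrangeSeries (R := R)).map (counitHom R : SymFun R →+* R)
  have h2 : PowerSeries.map (counitHom R : SymFun R →+* R) (hSeries R) = 1 := by
    ext n
    rw [PowerSeries.coeff_map, hSeries, PowerSeries.coeff_mk, PowerSeries.coeff_one]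
    change MvPowerSeries.coeff 0 (h R n).1 = _
    rw [coeff_h]
    simp [eq_comm]
  have h3 : (1 : PowerSeries R).IsLagrange 1 := fun n => by
    rw [Finset.sum_range_succ']
    simp [PowerSeries.coeff_one]
  rw [h2] at h1
  have h4 := congrArg (PowerSeries.coeff n) (h1.unique h3)
  rwa [PowerSeries.coeff_map, lagrangeSeries, PowerSeries.coeff_mk, PowerSeries.coeff_one] at h4

/-- The images of the `h_n` under the morphism `g_n ↦ y_n`. -/
def hImage (n : ℕ) : HNC R :=
  HNC.y R n - ∑ k : Fin n, hImage k *
    PowerSeries.coeff (n - k) (PowerSeries.mk (HNC.y R) ^ (k : ℕ))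

end SymFun

namespace HNC

variable (R : Type*) [CommRing R]

lemma y_zero : y R 0 = 1 := (congrArg (of R) NCClass.full_zero).trans (map_one _)

lemma counit_y (n : ℕ) : Coalgebra.counit (R := R) (y R n) = if n = 0 then 1 else 0 := by
  classical
  have h : y R n = zeta R (⊥ : NC (n + 1)) ⊤ := (zeta_of_le bot_le).symm
  rw [h, counit_def]
  refine if_congr ⟨fun heq => ?_, ?_⟩ rfl rfl
  · have h1 : (⊥ : NC (n + 1)).1 0 (Fin.last n) := heq ▸ trivial
    have h2 : (0 : Fin (n + 1)) = Fin.last n := h1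
    exact (congrArg Fin.val h2).symm
  · rintro rfl
    exact Subtype.ext (Setoid.ext fun x y => iff_of_true
      (Fin.subsingleton_one.elim x y) trivial)

end HNC

namespace SymFun

variable (R : Type*) [CommRing R]

lemma isLagrange_y : (PowerSeries.mk (hImage R)).IsLagrange (PowerSeries.mk (HNC.y R)) := by
  intro n
  rw [Finset.sum_range_succ, Nat.sub_self, PowerSeries.coeff_zero_eq_constantCoeff_apply,
    map_pow, ← PowerSeries.coeff_zero_eq_constantCoeff_apply]
  simp only [PowerSeries.coeff_mk]
  rw [HNC.y_zero, one_pow, mul_one, hImage, Finset.sum_range]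
  ring

/-- The morphism `h_n ↦ hImage n`. -/
def toHNC : SymFun R →ₐ[R] HNC R :=
  -- The free generators at hand are the e_n, so the antipode first turns h_n into (-1)^n e_n.
  ((MvPolynomial.aeval fun i => (-1) ^ (i + 1) * hImage R (i + 1)).comp
    (eEquiv R).symm.toAlgHom).comp (antipodeHom R)

variable {R}

lemma toHNC_h (n : ℕ) : toHNC R (h R n) = hImage R n := by
  rw [toHNC, AlgHom.comp_apply, antipodeHom_h, map_mul, map_pow, map_neg, map_one]
  cases n with
  | zero =>
    rw [e_zero, map_one, hImage]
    simp [HNC.y_zero]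
  | succ n =>
    have : ((-1 : HNC R) ^ (n + 1)) * (-1) ^ (n + 1) = 1 := by
      rw [← mul_pow, neg_mul_neg, one_mul, one_pow]
    simp [← mul_assoc, this]

/-- The image of the series of the g_n and the series of the y_n are Lagrange series of the same
series. -/
lemma toHNC_lagrange (n : ℕ) : toHNC R (lagrange R n) = HNC.y R n := by
  have h1 := (isLagrange_lagrangeSeries (R := R)).map (toHNC R : SymFun R →+* HNC R)
  have h2 : PowerSeries.map (toHNC R : SymFun R →+* HNC R) (hSeries R) =
      PowerSeries.mk (hImage R) := by
    ext n
    rw [PowerSeries.coeff_map, hSeries, PowerSeries.coeff_mk, PowerSeries.coeff_mk]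
    exact toHNC_h n
  rw [h2] at h1
  have h3 := congrArg (PowerSeries.coeff n) (h1.unique (isLagrange_y R))
  rwa [PowerSeries.coeff_map, lagrangeSeries, PowerSeries.coeff_mk, PowerSeries.coeff_mk] at h3

lemma toHNC_lagrangeProd (μ : Multiset ℕ) :
    toHNC R (lagrangeProd R μ) = (μ.map (HNC.y R)).prod := by
  refine (map_lagrangeProd (toHNC R : SymFun R →+* HNC R) μ).trans ?_
  exact congrArg (fun φ => (Multiset.map φ μ).prod) (funext toHNC_lagrange)

/-- Both sides are algebra morphisms, so it suffices to compare them on the generators g_n, where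
the sums over noncrossing partitions match term by term. -/
lemma map_toHNC_comul (f : SymFun R) :
    Algebra.TensorProduct.map (toHNC R) (toHNC R) (comulHom R f) =
      Bialgebra.comulAlgHom R (HNC R) (toHNC R f) := by
  have : (Algebra.TensorProduct.map (toHNC R) (toHNC R)).comp (comulHom R) =
      (Bialgebra.comulAlgHom R (HNC R)).comp (toHNC R) := by
    refine AlgHom.ext_of_adjoin_eq_top (adjoin_lagrange R) ?_
    rintro _ ⟨n, rfl⟩
    rw [AlgHom.comp_apply, AlgHom.comp_apply, toHNC_lagrange, Bialgebra.comulAlgHom_apply,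
      HNC.comul_y]
    refine (congrArg (Algebra.TensorProduct.map (toHNC R) (toHNC R))
      (comul_lagrange_eq_sum_noncrossing R n)).trans ?_
    rw [map_sum]
    refine Finset.sum_congr rfl fun π _ => ?_
    rw [Algebra.TensorProduct.map_tmul, toHNC_lagrangeProd, toHNC_lagrangeProd]
  exact DFunLike.congr_fun this f

variable (R) in
/-- The morphism of bialgebras `g_n ↦ y_n`. -/
def toHNCBialgHom : SymFun R →ₐc[R] HNC R :=
  BialgHom.ofAlgHom (toHNC R)
    (AlgHom.ext_of_adjoin_eq_top (adjoin_lagrange R) (by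
      rintro _ ⟨n, rfl⟩
      rw [AlgHom.comp_apply, toHNC_lagrange, Bialgebra.counitAlgHom_apply,
        Bialgebra.counitAlgHom_apply, HNC.counit_y, counit_lagrange]))
    (AlgHom.ext map_toHNC_comul)

lemma toHNC_surjective : Function.Surjective (toHNC R) := by
  rw [← AlgHom.range_eq_top, eq_top_iff, ← HNC.adjoin_y, Algebra.adjoin_le_iff]
  rintro _ ⟨n, rfl⟩
  exact ⟨lagrange R n, toHNC_lagrange n⟩

/-! ### Characters of the incidence algebra, and injectivity. -/

section Characters

variable {A : Type*} [CommRing A] [Algebra R A]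

/-- The values of a character on the `h_n`. -/
def charSeries (χ : HNC R →ₐ[R] A) : PowerSeries A :=
  PowerSeries.mk fun n => χ (toHNC R (h R n))

/-- The character sends y_n to p^n, so the image of H has Lagrange series 1/(1 - pX), which
determines it. -/
lemma charSeries_rankHom (p : A) :
    charSeries (HNC.rankHom R p) = 1 + PowerSeries.C p * PowerSeries.X := by
  have h1 := (isLagrange_lagrangeSeries (R := R)).map
    ((HNC.rankHom R p).comp (toHNC R) : SymFun R →+* A)
  have h2 : PowerSeries.map ((HNC.rankHom R p).comp (toHNC R) : SymFun R →+* A)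
      (lagrangeSeries R) = PowerSeries.mk fun n => p ^ n := by
    ext n
    rw [PowerSeries.coeff_map, lagrangeSeries, PowerSeries.coeff_mk, PowerSeries.coeff_mk]
    change HNC.rankHom R p (toHNC R (lagrange R n)) = _
    rw [toHNC_lagrange, HNC.rankHom_y]
  rw [h2] at h1
  refine Eq.trans ?_ (h1.unique_left (PowerSeries.isLagrange_geometric p) (by simp))
  ext n
  rw [charSeries, PowerSeries.coeff_map, hSeries, PowerSeries.coeff_mk, PowerSeries.coeff_mk]
  rfl

/-- The convolution product of two characters. -/
def convChar (χ ψ : HNC R →ₐ[R] A) : HNC R →ₐ[R] A :=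
  (Algebra.TensorProduct.productMap χ ψ).comp (Bialgebra.comulAlgHom R (HNC R))

/-- Under `toHNC`, which respects coproducts, Δ h_n = ∑ h_i ⊗ h_{n-i} turns convolution into the
product of series. -/
lemma charSeries_convChar (χ ψ : HNC R →ₐ[R] A) :
    charSeries (convChar χ ψ) = charSeries χ * charSeries ψ := by
  ext n
  rw [charSeries, PowerSeries.coeff_mul, PowerSeries.coeff_mk, convChar, AlgHom.comp_apply,
    ← map_toHNC_comul, comulHom_h, map_sum, map_sum]
  refine Finset.sum_congr rfl fun p _ => ?_
  rw [Algebra.TensorProduct.map_tmul, Algebra.TensorProduct.productMap_apply_tmul, charSeries,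
    charSeries, PowerSeries.coeff_mk, PowerSeries.coeff_mk]

lemma exists_charSeries_eq_prod {ι : Type*} (s : Finset ι) (p : ι → A) :
    ∃ χ : HNC R →ₐ[R] A, charSeries χ =
      ∏ i ∈ s, (1 + PowerSeries.C (p i) * PowerSeries.X) := by
  classical
  induction s using Finset.induction with
  | empty =>
    refine ⟨HNC.rankHom R 0, ?_⟩
    rw [charSeries_rankHom, map_zero, zero_mul, add_zero, Finset.prod_empty]
  | insert i s hi ih =>
    obtain ⟨χ, hχ⟩ := ih
    exact ⟨convChar (HNC.rankHom R (p i)) χ, by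
      rw [charSeries_convChar, charSeries_rankHom, hχ, Finset.prod_insert hi]⟩

lemma coeff_prod_one_add {ι : Type*} (s : Finset ι) (p : ι → A) (n : ℕ) :
    PowerSeries.coeff n (∏ i ∈ s, (1 + PowerSeries.C (p i) * PowerSeries.X)) =
      ∑ t ∈ s.powersetCard n, ∏ i ∈ t, p i := by
  classical
  rw [Finset.prod_one_add, map_sum, Finset.powersetCard_eq_filter, Finset.sum_filter]
  refine Finset.sum_congr rfl fun t _ => ?_
  rw [Finset.prod_mul_distrib, Finset.prod_const, ← map_prod, PowerSeries.coeff_C_mul,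
    PowerSeries.coeff_X_pow]
  by_cases h : t.card = n
  · rw [if_pos h, if_pos h.symm, mul_one]
  · rw [if_neg h, if_neg fun hh => h hh.symm, mul_zero]

end Characters

/-- The restrictions to finitely many variables factor through `toHNC`. -/
lemma exists_char_eq_res (N : ℕ) : ∃ χ : HNC R →ₐ[R] MvPowerSeries (Fin N) R,
    ∀ f, χ (toHNC R (antipodeHom R f)) = res N f := by
  -- For p_i = -x_i the series is ∏ (1 - x_i t) = ∑ (-1)^n e_n t^n, so h_n goes to (-1)^n e_n of the
  -- N variables; precomposing with the antipode gives e_n ↦ e_n.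
  obtain ⟨χ, hχ⟩ := exists_charSeries_eq_prod (R := R) (A := MvPowerSeries (Fin N) R) univ
    fun i => -MvPowerSeries.X i
  have hh : ∀ n, χ (toHNC R (h R n)) = (-1) ^ n * res N (e R n) := by
    intro n
    have := congrArg (PowerSeries.coeff n) hχ
    rw [charSeries, PowerSeries.coeff_mk, coeff_prod_one_add] at this
    rw [this, res_e, MvPolynomial.esymm, ← MvPolynomial.coeToMvPowerSeries.ringHom_apply, map_sum,
      Finset.mul_sum]
    refine Finset.sum_congr rfl fun t ht => ?_
    rw [Finset.prod_neg, (Finset.mem_powersetCard.mp ht).2, map_prod]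
    simp
  have : (χ.comp (toHNC R)).comp (antipodeHom R) = res N := algHom_ext fun n => by
    rw [AlgHom.comp_apply, AlgHom.comp_apply, antipodeHom_e, map_mul, map_mul, hh, map_pow,
      map_pow, map_neg, map_neg, map_one, map_one, ← mul_assoc, ← mul_pow, neg_mul_neg, one_mul,
      one_pow, one_mul]
  exact ⟨χ, DFunLike.congr_fun this⟩

/-- An element of the kernel is the antipode of some f' all of whose restrictions to finitely many
variables vanish; the coefficient of f' at m is already visible in `m.degree` variables. -/
lemma toHNC_injective : Function.Injective (toHNC R) := by
  rw [injective_iff_map_eq_zero]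
  intro f hf
  rw [← antipodeHom_antipodeHom f] at hf ⊢
  generalize antipodeHom R f = f' at hf
  have h0 : f' = 0 := by
    apply Subtype.ext
    ext m
    obtain ⟨χ, hχ⟩ := exists_char_eq_res (R := R) m.degree
    refine coeff_eq_of_res_eq (N := m.degree) ?_ m le_rfl
    rw [← hχ, hf, map_zero, map_zero]
  rw [h0, map_zero]

variable (R) in
/-- The isomorphism of bialgebras `g_n ↦ y_n`. -/
def equivHNC : SymFun R ≃ₐc[R] HNC R :=
  BialgEquiv.ofBijective (toHNCBialgHom R) ⟨toHNC_injective, toHNC_surjective⟩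

lemma equivHNC_symm_y (n : ℕ) : (equivHNC R).symm (HNC.y R n) = lagrange R n :=
  (equivHNC R).toEquiv.symm_apply_eq.mpr (toHNC_lagrange n).symm

end SymFun

end

theorem mainTheorem9 (R : Type*) [CommRing R] :
    -- the coproduct as a sum over noncrossing partitions
    (∀ n : ℕ, Coalgebra.comul (R := R) (lagrange R n) =
      ∑ π : NC (n + 1), lagrangeProd R (NC.reducedType π) ⊗ₜ[R]
        lagrangeProd R (NC.reducedType (NC.kreweras π))) ∧
    -- the coproduct as a sum over binary trees
    (∀ n : ℕ, Coalgebra.comul (R := R) (lagrange R n) =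
      ∑ t ∈ BinaryTree.treesOfNumNodesEq (n + 1), lagrangeProd R (leftBranches t) ⊗ₜ[R]
        lagrangeProd R (rightBranches t)) ∧
    -- the isomorphism of Hopf algebras given by `y_n ↦ g_n(X)`
    (∃ Φ : HNC R ≃ₐc[R] SymFun R, (∀ n : ℕ, Φ (HNC.y R n) = lagrange R n) ∧
      ∀ a : HNC R, Φ (HopfAlgebra.antipode R a) = HopfAlgebra.antipode R (Φ a)) ∧
    -- the isomorphism of Hopf algebras given by `y_n ↦ g_n(-X)`
    (∃ Ψ : HNC R ≃ₐc[R] SymFun R,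
      (∀ n : ℕ, Ψ (HNC.y R n) = HopfAlgebra.antipode R (lagrange R n)) ∧
      ∀ a : HNC R, Ψ (HopfAlgebra.antipode R a) = HopfAlgebra.antipode R (Ψ a)) := by
  refine ⟨comul_lagrange_eq_sum_noncrossing R, comul_lagrange_eq_sum_trees R,
    ⟨(SymFun.equivHNC R).symm, SymFun.equivHNC_symm_y,
      BialgHom.map_antipode ((SymFun.equivHNC R).symm : HNC R →ₐc[R] SymFun R)⟩,
    -- The second isomorphism is the first one followed by the antipode of Sym.
    ⟨(SymFun.equivHNC R).symm.trans (SymFun.antipodeEquiv R), fun n => ?_,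
      BialgHom.map_antipode
        ((SymFun.equivHNC R).symm.trans (SymFun.antipodeEquiv R) : HNC R →ₐc[R] SymFun R)⟩⟩
  exact congrArg (SymFun.antipodeEquiv R) (SymFun.equivHNC_symm_y n)
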